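/- Conventions. Local rings are commutative Noetherian. Complexes have lower grading and may be unbounded; $\mathsf D(A)$ is the derived category of $A$-modules and $\simeq$ denotes isomorphism in it. For a local ring $(S,\mathfrak n,l)$ let $\mathsf D_+(S)$ (respectively $\mathsf D_-(S)$) consist of the complexes $M$ such that every $H_n(M)$ is finitely generated and $H_n(M)=0$ for $n\ll 0$ (respectively $n\gg0$), and let $\mathsf D^b(S)=\mathsf D_+(S)\cap \mathsf D_-(S)$. Let $K[\boldsymbol x;M]=K[\boldsymbol x;S]\otimes_S M$ denote the Koszul complex on a finite list $\boldsymbol x$ of elements of $S$, and put $K^M=K[\boldsymbol x;M]$ when $\boldsymbol x$ is a minimal generating set of $\mathfrak n$. A complex $V$ is formal in $\mathsf D(A)$ if $V\simeq H(V)$, where $H(V)$ has zero differential. The homotopical Loewy length of a complex $M$ of $S$-modules is the least integer $i\ge0$ such that $M\simeq V$ in $\mathsf D(S)$ for some complex $V$ with $\mathfrak n^iV=0$. Let $\varphi\colon(R,\mathfrak m,k)\to(S,\mathfrak n,l)$ be a local homomorphism, let $\operatorname{edim}\varphi$ be the minimal number of generators of the ideal $\mathfrak n/\mathfrak mS$ of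 $S/\mathfrak mS$, and let $\boldsymbol y$ be a list of $\operatorname{edim}\varphi$ elements of $S$ whose images generate $\mathfrak n/\mathfrak mS$. Complexes of $S$-modules are viewed as complexes of $R$-modules through $\varphi$; if $N$ is one, then $\operatorname{Tor}^R_n(L,N)=H_n(L\otimes^{\mathbf L}_RN)$ and $\operatorname{Ext}_R^n(L,N)=H_{-n}(\mathbf R\!\operatorname{Hom}_R(L,N))$ are $S$-modules through $N$. The Betti numbers of $M\in\mathsf D_+(S)$ and the Bass numbers of $M\in\mathsf D_-(S)$ over $\varphi$ are $$\beta_n^\varphi(M)=\operatorname{rank}_l\operatorname{Tor}_n^R(k,K[\boldsymbol y;M]),\qquad \mu^n_\varphi(M)=\operatorname{rank}_l\operatorname{Ext}_R^{n-\operatorname{edim}\varphi}(k,K[\boldsymbol y;M]).$$ The curvature of a sequence $(a_n)$ is $\limsup_n\sqrt[n]{a_n}$, and its complexity is the least natural number $d$ for which there is $b\in\mathbb R$ with $a_n\le b\,n^{d-1}$ for all $n\gg0$ (and $\infty$ if there is none). Write $\operatorname{curv}_\varphi M$, $\operatorname{cx}_\varphi M$ for the curvature and complexity of $(\beta_n^\varphi(M))$;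 write $\operatorname{inj\,curv}_\varphi M$, $\operatorname{inj\,cx}_\varphi M$ for those of $(\mu^n_\varphi(M))$; and set $\operatorname{curv}_Rk=\operatorname{curv}_{\mathrm{id}_R}k$, $\operatorname{cx}_Rk=\operatorname{cx}_{\mathrm{id}_R}k$. Proposition. Let $c$ be the homotopical Loewy length of $K^S$, and assume $\varphi(\mathfrak m)\subseteq\mathfrak n^c$. For every complex $M$ of $S$-modules the following hold. (1) The complex $K^M$ is formal in $\mathsf D(R)$. (2) For every $L\in\mathsf D(R)$ the $S$-modules $\operatorname{Tor}^R_n(L,K^M)$ and $H_n(K^M)$ are annihilated by $\mathfrak n$, and there are isomorphisms of graded $l$-vector spaces $\operatorname{Tor}^R_*(L,K^M)\cong\operatorname{Tor}^R_*(L,k)\otimes_kH_*(K^M)$, with $l$ acting on the right-hand side through $H_*(K^M)$. (3) If $M\in\mathsf D_+(S)$ and $M\not\simeq0$, then $\operatorname{curv}_\varphi M\ge\operatorname{curv}_Rk$ and $\operatorname{cx}_\varphi M\ge\operatorname{cx}_Rk$. (4) If $M\in\mathsf D_-(S)$ and $M\not\simeq0$, then $\operatorname{inj\,curv}_\varphi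 M\ge\operatorname{curv}_Rk$ and $\operatorname{inj\,cx}_\varphi M\ge\operatorname{cx}_Rk$. (5) If $M\in\mathsf D^b(S)$ and $M\not\simeq0$, then equalities hold in (3) and (4). -/

import Mathlib

/-! Complexes are indexed cohomologically, as `CochainComplex _ ℤ`: the lower grading of a complex
`M` is recovered by `M_n = M^{-n}`, so that `H_n(M) = M.homology (-n)`. The maximal ideals of the
local rings `R` and `S` are denoted `𝔪` and `𝔫` in comments, and their residue fields `k`, `l`. -/
open CategoryTheory Limits
open scoped ZeroObject
universe u
namespace DerivedKoszul
section Resolutions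
variable {R : Type u} [CommRing R]

/-- The inclusions of the sphere `R` in degree `n + 1` into the disc `R = R` in degrees
`n, n + 1`. -/
noncomputable def sphereToDisc (n : ℤ) :
    (HomologicalComplex.single (ModuleCat.{u} R) (ComplexShape.up ℤ) (n + 1)).obj
      (ModuleCat.of R R) ⟶
    HomologicalComplex.double (𝟙 (ModuleCat.of R R))
      (show (ComplexShape.up ℤ).Rel n (n + 1) from rfl) :=
  HomologicalComplex.mkHomFromSingle
    (HomologicalComplex.doubleXIso₁ _ _ (by lia)).inv
    (fun k _ => by rw [HomologicalComplex.double_d_eq_zero₀ _ _ _ _ (by lia), comp_zero])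

variable (R) in
/-- The set of all sphere-to-disc inclusions. -/
def cells : MorphismProperty (CochainComplex (ModuleCat.{u} R) ℤ) :=
  MorphismProperty.ofHoms (fun n : ℤ => sphereToDisc (R := R) n)

lemma sphereToDisc_f (n : ℤ) : (sphereToDisc (R := R) n).f (n + 1) =
    (HomologicalComplex.singleObjXSelf _ _ _).hom ≫
      (HomologicalComplex.doubleXIso₁ (𝟙 (ModuleCat.of R R))
        (show (ComplexShape.up ℤ).Rel n (n + 1) from rfl) (by lia)).inv := by
  simp [sphereToDisc]

instance (n : ℤ) : Mono (sphereToDisc (R := R) n) := by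
  have : ∀ i, Mono ((sphereToDisc (R := R) n).f i) := by
    intro i
    by_cases h : i = n + 1
    · subst h
      rw [sphereToDisc_f]
      infer_instance
    · constructor
      intro Z g h' _
      exact (HomologicalComplex.isZero_single_obj_X _ _ _ _ h).eq_of_tgt _ _
  exact HomologicalComplex.mono_of_mono_f _ this

instance : MorphismProperty.IsSmall.{u} (cells R) := by
  refine ⟨?_⟩
  let f : ℤ → (cells R).toSet := fun n => ⟨Arrow.mk (sphereToDisc n), ⟨n⟩⟩
  have hf : Function.Surjective f := by
    rintro ⟨a, ha⟩
    obtain ⟨n, h⟩ := (MorphismProperty.ofHoms_iff _ _).1 ha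
    exact ⟨n, Subtype.ext h.symm⟩
  exact small_of_surjective hf

open MorphismProperty in
instance : HasSmallObjectArgument.{u} (cells R) := by
  let G : ℤ → CochainComplex (ModuleCat.{u} R) ℤ := fun n =>
    (HomologicalComplex.single (ModuleCat.{u} R) (ComplexShape.up ℤ) (n + 1)).obj
      (ModuleCat.of R R)
  obtain ⟨κ, hκ', hκ⟩ := HasCardinalLT.exists_regular_cardinal.{u}
    (Σ n, Shrink.{u} (Subobject (G n)))
  have : Fact κ.IsRegular := ⟨hκ'⟩
  have : Nonempty κ.ord.ToType := by simpa using hκ'.ne_zero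
  have := WellFoundedLT.toOrderBot κ.ord.ToType
  exact ⟨κ, inferInstance, inferInstance,
    { preservesColimit {A B X Y} i hi f hf := by
        let hf' : (monomorphisms _).TransfiniteCompositionOfShape κ.ord.ToType f :=
          { toTransfiniteCompositionOfShape := hf.toTransfiniteCompositionOfShape
            map_mem j hj := by
              have := (hf.attachCells j hj).pushouts_coproducts
              simp only [ofHoms_homFamily] at this
              refine (?_ : _ ≤ monomorphisms _) _ this
              rw [pushouts_le_iff, coproducts_le_iff]
              rintro _ _ _ ⟨n⟩
              exact inferInstanceAs (Mono (sphereToDisc n)) }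
        have (j j' : κ.ord.ToType) (φ : j ⟶ j') : Mono (hf'.F.map φ) := hf'.mem_map φ
        obtain ⟨n⟩ := hi
        apply IsGrothendieckAbelian.preservesColimit_coyoneda_obj_of_mono (Y := hf'.F) (κ := κ)
        refine hκ.of_injective (fun x => ⟨n, equivShrink _ x⟩) ?_
        intro x y h
        simpa using h }⟩

/-- Elementwise form of the right lifting property with respect to the cells. -/
lemma rlp_cells {F L : CochainComplex (ModuleCat.{u} R) ℤ} {p : F ⟶ L} (hp : (cells R).rlp p)
    (n : ℤ) (z : F.X (n + 1)) (a : L.X n) (hz : F.d (n + 1) (n + 1 + 1) z = 0)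
    (ha : L.d n (n + 1) a = p.f (n + 1) z) : ∃ w : F.X n, F.d n (n + 1) w = z ∧ p.f n w = a := by
  let z' : ModuleCat.of R R ⟶ F.X (n + 1) := ModuleCat.ofHom (LinearMap.toSpanSingleton R _ z)
  let a' : ModuleCat.of R R ⟶ L.X n := ModuleCat.ofHom (LinearMap.toSpanSingleton R _ a)
  have hz' : z' ≫ F.d (n + 1) (n + 1 + 1) = 0 := by
    ext; simpa [z'] using hz
  have ha' : a' ≫ L.d n (n + 1) = z' ≫ p.f (n + 1) := by
    ext; simpa [z', a'] using ha
  have hne : n ≠ n + 1 := by lia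
  let t := HomologicalComplex.mkHomFromSingle (c := ComplexShape.up ℤ) z' (fun k hk => by
    obtain rfl : n + 1 + 1 = k := hk
    exact hz')
  let b := HomologicalComplex.mkHomFromDouble (f := 𝟙 (ModuleCat.of R R))
    (show (ComplexShape.up ℤ).Rel n (n + 1) from rfl) hne a' (a' ≫ L.d n (n + 1)) (by simp)
    (by simp)
  have sq : CommSq t (sphereToDisc n) p b := ⟨by
    apply HomologicalComplex.from_single_hom_ext
    simp [t, b, sphereToDisc_f, ha']⟩
  have := hp (sphereToDisc n) ⟨n⟩
  let w := (HomologicalComplex.doubleXIso₀ (𝟙 (ModuleCat.of R R))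
    (show (ComplexShape.up ℤ).Rel n (n + 1) from rfl)).inv ≫ sq.lift.f n
  have hw₁ : w ≫ F.d n (n + 1) = z' := by
    have := congrArg (fun g => HomologicalComplex.Hom.f g (n + 1)) sq.fac_left
    simp only [HomologicalComplex.comp_f, sphereToDisc_f, t,
      HomologicalComplex.mkHomFromSingle_f, Category.assoc, Iso.cancel_iso_hom_left] at this
    rw [← this]
    simp only [w, Category.assoc, HomologicalComplex.Hom.comm,
      HomologicalComplex.double_d _ _ hne, Category.id_comp, Iso.inv_hom_id_assoc]
  have hw₂ : w ≫ p.f n = a' := by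
    have := congrArg (fun g => HomologicalComplex.Hom.f g n) sq.fac_right
    simp only [HomologicalComplex.comp_f, b, HomologicalComplex.mkHomFromDouble_f₀] at this
    simp [w, this]
  refine ⟨w (1 : R), ?_, ?_⟩
  · simpa [z'] using congrArg (fun g : ModuleCat.of R R ⟶ _ => g (1 : R)) hw₁
  · simpa [a'] using congrArg (fun g : ModuleCat.of R R ⟶ _ => g (1 : R)) hw₂

lemma rlp_cells_of_elements {F L : CochainComplex (ModuleCat.{u} R) ℤ} {p : F ⟶ L}
    (H : ∀ (n : ℤ) (z : F.X (n + 1)) (a : L.X n), F.d (n + 1) (n + 1 + 1) z = 0 →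
      L.d n (n + 1) a = p.f (n + 1) z → ∃ w : F.X n, F.d n (n + 1) w = z ∧ p.f n w = a) :
    (cells R).rlp p := by
  rintro _ _ _ ⟨n⟩
  have hne : n ≠ n + 1 := by lia
  refine ⟨fun {t b} sq => ?_⟩
  let z' : ModuleCat.of R R ⟶ F.X (n + 1) :=
    (HomologicalComplex.singleObjXSelf _ _ _).inv ≫ t.f (n + 1)
  let a' : ModuleCat.of R R ⟶ L.X n := (HomologicalComplex.doubleXIso₀ _ _).inv ≫ b.f n
  have hz' : z' ≫ F.d (n + 1) (n + 1 + 1) = 0 := by simp [z']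
  have ha' : a' ≫ L.d n (n + 1) = z' ≫ p.f (n + 1) := by
    have := congrArg (fun g => HomologicalComplex.Hom.f g (n + 1)) sq.w
    simp only [HomologicalComplex.comp_f, sphereToDisc_f, Category.assoc] at this
    simp [z', a', this, HomologicalComplex.double_d _ _ hne]
  obtain ⟨w, hw₁, hw₂⟩ := H n (z' (1 : R)) (a' (1 : R))
    (congrArg (fun g : ModuleCat.of R R ⟶ _ => g (1 : R)) hz')
    (congrArg (fun g : ModuleCat.of R R ⟶ _ => g (1 : R)) ha')
  let w' : ModuleCat.of R R ⟶ F.X n := ModuleCat.ofHom (LinearMap.toSpanSingleton R _ w)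
  have hw₁' : w' ≫ F.d n (n + 1) = z' := by ext; simpa [w'] using hw₁
  have hw₂' : w' ≫ p.f n = a' := by ext; simpa [w'] using hw₂
  refine ⟨⟨HomologicalComplex.mkHomFromDouble _ hne w' (w' ≫ F.d n (n + 1)) (by simp) (by simp),
    ?_, ?_⟩⟩
  · apply HomologicalComplex.from_single_hom_ext
    simp [sphereToDisc_f, hw₁', z']
  · apply HomologicalComplex.from_double_hom_ext
    · simp [hw₂', a']
    · simp only [HomologicalComplex.comp_f, HomologicalComplex.mkHomFromDouble_f₁, Category.assoc]
      rw [← HomologicalComplex.Hom.comm, reassoc_of% hw₂']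
      simp [a', HomologicalComplex.double_d _ _ hne]

lemma exact_elements {A : CochainComplex (ModuleCat.{u} R) ℤ} (hA : A.Acyclic) (n : ℤ)
    (z : A.X (n + 1)) (hz : A.d (n + 1) (n + 1 + 1) z = 0) : ∃ y, A.d n (n + 1) y = z := by
  have h := hA (n + 1)
  rw [HomologicalComplex.exactAt_iff' _ n (n + 1) (n + 1 + 1) (by simp) (by simp),
    ShortComplex.moduleCat_exact_iff] at h
  exact h z hz

lemma quasiIso_of_rlp_cells {F L : CochainComplex (ModuleCat.{u} R) ℤ} {p : F ⟶ L}
    (hp : (cells R).rlp p) : QuasiIso p := by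
  rw [quasiIso_iff]
  intro i
  rw [quasiIsoAt_iff_isIso_homologyMap]
  obtain ⟨n, rfl⟩ : ∃ n, i = n + 1 := ⟨i - 1, by lia⟩
  have : Mono (HomologicalComplex.homologyMap p (n + 1)) := by
    rw [HomologicalComplex.mono_homologyMap_iff_up_to_refinements p n (n + 1) (n + 1 + 1)
      (by simp) (by simp)]
    intro A x hx y hy
    have h (a : A) := rlp_cells hp n (x a) (y a)
      (congrArg (fun g : A ⟶ _ => g a) hx) (congrArg (fun g : A ⟶ _ => g a) hy).symm
    choose w hw _ using h
    refine ⟨ModuleCat.of R (A →₀ R), ModuleCat.ofHom (Finsupp.linearCombination R id),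
      (ModuleCat.epi_iff_surjective _).2 (Finsupp.linearCombination_id_surjective R A),
      ModuleCat.ofHom (Finsupp.linearCombination R w), ?_⟩
    ext a
    simp [hw]
  have : Epi (HomologicalComplex.homologyMap p (n + 1)) := by
    rw [HomologicalComplex.epi_homologyMap_iff_up_to_refinements p n (n + 1) (n + 1 + 1)
      (by simp) (by simp)]
    intro A y hy
    have h (a : A) := rlp_cells hp (n + 1) 0 (y a) (by simp)
      (by simpa using congrArg (fun g : A ⟶ _ => g a) hy)
    choose w hw hw' using h
    refine ⟨ModuleCat.of R (A →₀ R), ModuleCat.ofHom (Finsupp.linearCombination R id),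
      (ModuleCat.epi_iff_surjective _).2 (Finsupp.linearCombination_id_surjective R A),
      ModuleCat.ofHom (Finsupp.linearCombination R w), ?_, 0, ?_⟩
    · ext a
      simp [hw]
    · ext a
      simp [hw']
  exact isIso_of_mono_of_epi _

lemma acyclic_of_homotopy {A : CochainComplex (ModuleCat.{u} R) ℤ} (h : Homotopy (𝟙 A) 0) :
    A.Acyclic := by
  intro i
  rw [HomologicalComplex.exactAt_iff_isZero_homology, IsZero.iff_id_eq_zero,
    ← HomologicalComplex.homologyMap_id, h.homologyMap_eq, HomologicalComplex.homologyMap_zero]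

/-- The mapping cone of an identity morphism is contractible. -/
noncomputable def coneIdHomotopy (B : CochainComplex (ModuleCat.{u} R) ℤ) :
    Homotopy (𝟙 (CochainComplex.mappingCone (𝟙 B))) 0 :=
  CochainComplex.mappingCone.descHomotopy _ _ _ 0 (CochainComplex.mappingCone.inl _)
    (by simp) (by simp [CochainComplex.mappingCone.δ_inl])

lemma isKProjective_of_llp {F : CochainComplex (ModuleCat.{u} R) ℤ}
    (hF : (cells R).rlp.llp (0 : 0 ⟶ F)) : F.IsKProjective := by
  have key : ∀ (B : CochainComplex (ModuleCat.{u} R) ℤ) (_ : (B⟦(1 : ℤ)⟧).Acyclic)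
      (g : F ⟶ B⟦(1 : ℤ)⟧), Nonempty (Homotopy g 0) := by
    intro B hB g
    let X := CochainComplex.mappingCone (𝟙 B)
    let q : X ⟶ B⟦(1 : ℤ)⟧ := (CochainComplex.mappingCone.triangle (𝟙 B)).mor₃
    have hX : X.Acyclic := acyclic_of_homotopy (coneIdHomotopy B)
    have hq (n : ℤ) : Function.Surjective (q.f n) := by
      let α := (CochainComplex.mappingCone.inl (𝟙 B)).v (n + 1) n (by lia) ≫ q.f n
      have hα : α = -(B.shiftFunctorObjXIso 1 n (n + 1) rfl).inv :=
        CochainComplex.mappingCone.inl_v_triangle_mor₃_f (𝟙 B) (n + 1) n (by lia)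
      have : Epi α := by rw [hα]; infer_instance
      exact (ModuleCat.epi_iff_surjective _).1 (epi_of_epi_fac
        (f := (CochainComplex.mappingCone.inl (𝟙 B)).v (n + 1) n (by lia)) (g := q.f n)
        (h := α) rfl)
    have hq' : (cells R).rlp q := by
      apply rlp_cells_of_elements
      intro n z a hz ha
      obtain ⟨w, hw⟩ := exact_elements hX n z hz
      obtain ⟨m, rfl⟩ : ∃ m, n = m + 1 := ⟨n - 1, by lia⟩
      have comm (i j : ℤ) (v : X.X i) : q.f j (X.d i j v) = (B⟦(1 : ℤ)⟧).d i j (q.f i v) :=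
        congrArg (fun g : X.X i ⟶ (B⟦(1 : ℤ)⟧).X j => g v) (q.comm i j).symm
      obtain ⟨y, hy⟩ := exact_elements hB m (q.f (m + 1) w - a) (by
        rw [map_sub, ha, ← hw, comm, sub_self])
      obtain ⟨x, hx⟩ := hq m y
      refine ⟨w - X.d m (m + 1) x, ?_, ?_⟩
      · have : X.d (m + 1) (m + 1 + 1) (X.d m (m + 1) x) = 0 :=
          congrArg (fun g : X.X m ⟶ X.X (m + 1 + 1) => g x) (X.d_comp_d _ _ _)
        rw [map_sub, hw, this, sub_zero]
      · rw [map_sub, comm, hx, hy, sub_sub_cancel]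
    have sq : CommSq (0 : 0 ⟶ X) (0 : 0 ⟶ F) q g := ⟨by simp⟩
    have := hF _ hq'
    refine ⟨(Homotopy.ofEq ?_).trans ((((coneIdHomotopy B).compLeft sq.lift).compRight q).trans (.ofEq ?_))⟩
    · simp
    · simp
  refine ⟨fun {L} f hL => ?_⟩
  let e : L ≅ (L⟦(-1 : ℤ)⟧)⟦(1 : ℤ)⟧ := ((shiftFunctorCompIsoId (CochainComplex (ModuleCat.{u} R) ℤ) (-1 : ℤ) 1 (by simp)).app L).symm
  obtain ⟨h⟩ := key (L⟦(-1 : ℤ)⟧) (fun i => (hL i).of_iso e) (f ≫ e.hom)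
  refine ⟨(Homotopy.ofEq ?_).trans ((h.compRight e.inv).trans (.ofEq ?_))⟩
  · simp
  · simp

/-- Every complex of modules has a K-projective resolution. -/
theorem exists_kProjective_resolution (L : CochainComplex (ModuleCat.{u} R) ℤ) :
    ∃ (F : CochainComplex (ModuleCat.{u} R) ℤ) (f : F ⟶ L), F.IsKProjective ∧ QuasiIso f := by
  let d := MorphismProperty.factorizationData (cells R).rlp.llp (cells R).rlp (0 : 0 ⟶ L)
  refine ⟨d.Z, d.p, isKProjective_of_llp ?_, quasiIso_of_rlp_cells d.hp⟩
  have := d.hi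
  convert this
  exact (isZero_zero _).eq_of_src _ _
end Resolutions

section DerivedFunctors
variable {R S : Type u} [CommRing R] [CommRing S]

/-- A chosen K-projective resolution of a complex of `R`-modules. -/
noncomputable def kProjRes (L : CochainComplex (ModuleCat.{u} R) ℤ) :
    CochainComplex (ModuleCat.{u} R) ℤ :=
  (exists_kProjective_resolution L).choose

/-- The quasi-isomorphism from the chosen K-projective resolution of `L` to `L`. -/
noncomputable def kProjResHom (L : CochainComplex (ModuleCat.{u} R) ℤ) : kProjRes L ⟶ L :=
  (exists_kProjective_resolution L).choose_spec.choose

instance (L : CochainComplex (ModuleCat.{u} R) ℤ) : (kProjRes L).IsKProjective :=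
  (exists_kProjective_resolution L).choose_spec.choose_spec.1

instance (L : CochainComplex (ModuleCat.{u} R) ℤ) : QuasiIso (kProjResHom L) :=
  (exists_kProjective_resolution L).choose_spec.choose_spec.2

variable (φ : R →+* S)

instance (N : ModuleCat.{u} S) : SMulCommClass R S ((ModuleCat.restrictScalars φ).obj N) :=
  ModuleCat.sMulCommClass_mk φ N

/-- The map `g ⊗ f : N ⊗[R] L → N' ⊗[R] L'` induced by an `S`-linear map `g` and an
`R`-linear map `f`, as an `S`-linear map. -/
noncomputable def tensorMap {N N' : ModuleCat.{u} S} {L L' : ModuleCat.{u} R} (g : N ⟶ N')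
    (f : L ⟶ L') :
    TensorProduct R ((ModuleCat.restrictScalars φ).obj N) L →ₗ[S]
      TensorProduct R ((ModuleCat.restrictScalars φ).obj N') L' :=
  { toFun := TensorProduct.map ((ModuleCat.restrictScalars φ).map g).hom f.hom
    map_add' := fun x y => map_add _ x y
    map_smul' := fun s x => by
      induction x using TensorProduct.induction_on with
      | zero => rw [smul_zero, map_zero, smul_zero]
      | tmul n l =>
        exact congrArg (fun y : (ModuleCat.restrictScalars φ).obj N' =>
          TensorProduct.tmul R y (f.hom l)) (g.hom.map_smul s n)
      | add x y hx hy => rw [smul_add, map_add, hx, hy, map_add, smul_add] }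

@[simp]
lemma tensorMap_tmul {N N' : ModuleCat.{u} S} {L L' : ModuleCat.{u} R} (g : N ⟶ N')
    (f : L ⟶ L') (n : (ModuleCat.restrictScalars φ).obj N) (l : L) :
    tensorMap φ g f (TensorProduct.tmul R n l) =
      TensorProduct.tmul R ((ModuleCat.restrictScalars φ).map g n) (f l) := rfl

lemma tensorMap_ext {N : ModuleCat.{u} S} {L : ModuleCat.{u} R} {X : Type u} [AddCommGroup X]
    [Module S X] {f g : TensorProduct R ((ModuleCat.restrictScalars φ).obj N) L →ₗ[S] X}
    (h : ∀ (n : (ModuleCat.restrictScalars φ).obj N) (l : L),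
      f (TensorProduct.tmul R n l) = g (TensorProduct.tmul R n l)) : f = g := by
  ext x
  induction x using TensorProduct.induction_on with
  | zero => rw [map_zero, map_zero]
  | tmul n l => exact h n l
  | add x y hx hy => rw [map_add, map_add, hx, hy]

/-- The bifunctor `(L, N) ↦ N ⊗[R] L`, where `L` is an `R`-module, `N` is an `S`-module (viewed as
an `R`-module along `φ`), and `S` acts on the tensor product through `N`. -/
noncomputable def tensorFunctor : ModuleCat.{u} R ⥤ ModuleCat.{u} S ⥤ ModuleCat.{u} S where
  obj L :=
    { obj N := ModuleCat.of S (TensorProduct R ((ModuleCat.restrictScalars φ).obj N) L)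
      map g := ModuleCat.ofHom (tensorMap φ g (𝟙 L))
      map_id N := ModuleCat.hom_ext (tensorMap_ext φ fun _ _ => rfl)
      map_comp g g' := ModuleCat.hom_ext (tensorMap_ext φ fun _ _ => rfl) }
  map f :=
    { app N := ModuleCat.ofHom (tensorMap φ (𝟙 N) f)
      naturality N N' g := ModuleCat.hom_ext (tensorMap_ext φ fun _ _ => rfl) }
  map_id L := by
    apply NatTrans.ext
    funext N
    exact ModuleCat.hom_ext (tensorMap_ext φ fun _ _ => rfl)
  map_comp f f' := by
    apply NatTrans.ext
    funext N
    exact ModuleCat.hom_ext (tensorMap_ext φ fun _ _ => rfl)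

instance (L : ModuleCat.{u} R) : ((tensorFunctor φ).obj L).Additive where
  map_add {_ _ g g'} := ModuleCat.hom_ext (tensorMap_ext φ fun n l =>
    TensorProduct.add_tmul ((ModuleCat.restrictScalars φ).map g n)
      ((ModuleCat.restrictScalars φ).map g' n) l)

instance : (tensorFunctor φ).Additive where
  map_add {L L' f f'} := by
    apply NatTrans.ext
    funext N
    exact ModuleCat.hom_ext (tensorMap_ext φ fun n l => TensorProduct.tmul_add n (f l) (f' l))

/-- The (total) tensor product over `R` of a complex `L` of `R`-modules and a complex `N` of
`S`-modules, as a complex of `S`-modules. -/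
noncomputable def tensorComplex (L : CochainComplex (ModuleCat.{u} R) ℤ)
    (N : CochainComplex (ModuleCat.{u} S) ℤ) : CochainComplex (ModuleCat.{u} S) ℤ :=
  HomologicalComplex.mapBifunctor L N (tensorFunctor φ) (ComplexShape.up ℤ)

/-- A complex of `S`-modules, viewed as a complex of `R`-modules along `φ : R →+* S`. -/
noncomputable abbrev restrict (N : CochainComplex (ModuleCat.{u} S) ℤ) :
    CochainComplex (ModuleCat.{u} R) ℤ :=
  ((ModuleCat.restrictScalars φ).mapHomologicalComplex (ComplexShape.up ℤ)).obj N

/-- Homology in lower grading: `H_n(N) = H^{-n}(N)`. -/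
noncomputable abbrev lowerHomology (N : CochainComplex (ModuleCat.{u} S) ℤ) (n : ℤ) :
    ModuleCat.{u} S :=
  N.homology (-n)

/-- `Tor_n^R(L, N)`, an `S`-module through the action of `S` on the complex `N`. -/
noncomputable def relTor (n : ℤ) (L : CochainComplex (ModuleCat.{u} R) ℤ)
    (N : CochainComplex (ModuleCat.{u} S) ℤ) : ModuleCat.{u} S :=
  lowerHomology (tensorComplex φ (kProjRes L) N) n

/-- The functor which sends a complex of `S`-modules `N` to the complex `Σ^n N`, in the homotopy
category of complexes of `R`-modules. -/
noncomputable abbrev restrictShift (n : ℤ) :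
    CochainComplex (ModuleCat.{u} S) ℤ ⥤ HomotopyCategory (ModuleCat.{u} R) (ComplexShape.up ℤ) :=
  (ModuleCat.restrictScalars φ).mapHomologicalComplex (ComplexShape.up ℤ) ⋙
    HomotopyCategory.quotient _ _ ⋙ shiftFunctor _ n

/-- The action of `S` on `Σ^n N` in the homotopy category of complexes of `R`-modules. -/
noncomputable def scalarEnd (n : ℤ) (N : CochainComplex (ModuleCat.{u} S) ℤ) :
    S →+* End ((restrictShift φ n).obj N) where
  toFun s := (restrictShift φ n).map (s • 𝟙 N)
  map_one' := by rw [one_smul]; exact CategoryTheory.Functor.map_id _ _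
  map_mul' s t := by
    rw [End.mul_def, ← Functor.map_comp, Linear.smul_comp, Linear.comp_smul, Category.id_comp,
      smul_smul, mul_comm]
  map_zero' := by rw [zero_smul]; exact Functor.map_zero _ _ _
  map_add' s t := by rw [add_smul]; exact Functor.map_add _

/-- `Ext^n_R(L, N)`: the homotopy classes of `R`-linear chain maps from a K-projective resolution
of `L` to `Σ^n N`. It is an `S`-module through the action of `S` on the complex `N`. -/
noncomputable def relExt (n : ℤ) (L : CochainComplex (ModuleCat.{u} R) ℤ)
    (N : CochainComplex (ModuleCat.{u} S) ℤ) : ModuleCat.{u} S :=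
  letI : Module S ((HomotopyCategory.quotient _ _).obj (kProjRes L) ⟶ (restrictShift φ n).obj N) :=
    Module.compHom _ (scalarEnd φ n N)
  ModuleCat.of S ((HomotopyCategory.quotient _ _).obj (kProjRes L) ⟶ (restrictShift φ n).obj N)

end DerivedFunctors

section DerivedCategory
variable {S : Type u} [CommRing S]

/-- Two complexes of `S`-modules are isomorphic in the derived category of `S`. -/
def DerivedIso (M N : CochainComplex (ModuleCat.{u} S) ℤ) : Prop :=
  letI : HasDerivedCategory (ModuleCat.{u} S) := HasDerivedCategory.standard _
  Nonempty (DerivedCategory.Q.obj M ≅ DerivedCategory.Q.obj N)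

/-- The homology of a complex, as a complex with zero differential. -/
noncomputable def homologyComplex (M : CochainComplex (ModuleCat.{u} S) ℤ) :
    CochainComplex (ModuleCat.{u} S) ℤ where
  X n := M.homology n
  d _ _ := 0

/-- A complex is formal if it is isomorphic to its homology in the derived category. -/
def IsFormal (M : CochainComplex (ModuleCat.{u} S) ℤ) : Prop :=
  DerivedIso M (homologyComplex M)

/-- The class `D_+`: each `H_n(M)` is finitely generated, and `H_n(M) = 0` for `n ≪ 0`. -/
def IsDPlus (M : CochainComplex (ModuleCat.{u} S) ℤ) : Prop :=
  (∀ n, Module.Finite S (lowerHomology M n)) ∧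
    ∃ a : ℤ, ∀ n < a, Subsingleton (lowerHomology M n)

/-- The class `D_-`: each `H_n(M)` is finitely generated, and `H_n(M) = 0` for `n ≫ 0`. -/
def IsDMinus (M : CochainComplex (ModuleCat.{u} S) ℤ) : Prop :=
  (∀ n, Module.Finite S (lowerHomology M n)) ∧
    ∃ b : ℤ, ∀ n > b, Subsingleton (lowerHomology M n)

/-- The class `D_b`, the intersection of `D_+` and `D_-`. -/
def IsDBounded (M : CochainComplex (ModuleCat.{u} S) ℤ) : Prop :=
  IsDPlus M ∧ IsDMinus M

/-- A module viewed as a complex concentrated in degree `0`. -/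
noncomputable abbrev complexOfModule (N : ModuleCat.{u} S) :
    CochainComplex (ModuleCat.{u} S) ℤ :=
  (HomologicalComplex.single (ModuleCat.{u} S) (ComplexShape.up ℤ) 0).obj N

/-- The Koszul complex on a finite list of elements: the Koszul complex on the empty list is `S` in
degree `0`, and the Koszul complex on `x, x₁, …, xₙ` is the mapping cone of multiplication by `x`
on the Koszul complex on `x₁, …, xₙ`. -/
noncomputable def koszul : List S → CochainComplex (ModuleCat.{u} S) ℤ
  | [] => complexOfModule (ModuleCat.of S S)
  | x :: xs => CochainComplex.mappingCone (x • 𝟙 (koszul xs))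

/-- The Koszul complex `K[x; M] = K[x; S] ⊗_S M` on a list `x` with coefficients in a
complex `M`. -/
noncomputable def koszulOn (x : List S) (M : CochainComplex (ModuleCat.{u} S) ℤ) :
    CochainComplex (ModuleCat.{u} S) ℤ :=
  HomologicalComplex.tensorObj (koszul x) M

end DerivedCategory

section Growth

/-- The curvature `limsup_n (a_n)^{1/n}` of a sequence. -/
noncomputable def curvSeq (a : ℤ → ℕ∞) : ENNReal :=
  Filter.limsup (fun n : ℕ => ((a n : ℕ∞) : ENNReal) ^ (1 / (n : ℝ))) Filter.atTop

/-- The complexity of a sequence: the least natural number `d` such that, for some real number `c`,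
`a_n ≤ c n^{d-1}` holds for all `n ≫ 0` (and `∞` if there is no such `d`). -/
noncomputable def cxSeq (a : ℤ → ℕ∞) : ℕ∞ :=
  ⨅ d ∈ {d : ℕ | ∃ c : ℝ, ∀ᶠ n : ℕ in Filter.atTop,
    ((a n : ℕ∞) : EReal) ≤ ((c * (n : ℝ) ^ ((d : ℤ) - 1) : ℝ) : EReal)}, (d : ℕ∞)

end Growth

section LocalRings
variable {R S : Type u} [CommRing R] [IsLocalRing R] [CommRing S] [IsLocalRing S]

/-- The Loewy length of a complex `V`: the least `i` with `𝔫 ^ i V = 0`. -/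
noncomputable def loewyLength (V : CochainComplex (ModuleCat.{u} S) ℤ) : ℕ∞ :=
  ⨅ i ∈ {i : ℕ | ∀ s ∈ IsLocalRing.maximalIdeal S ^ i, ∀ (n : ℤ) (v : V.X n), s • v = 0}, (i : ℕ∞)

/-- The homotopical Loewy length of a complex `M`: the least Loewy length of a complex isomorphic
to `M` in the derived category. -/
noncomputable def homotopicalLoewyLength (M : CochainComplex (ModuleCat.{u} S) ℤ) : ℕ∞ :=
  ⨅ V ∈ {V : CochainComplex (ModuleCat.{u} S) ℤ | DerivedIso M V}, loewyLength V

/-- `x` is a minimal generating set of the maximal ideal of `S`. -/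
def IsMinimalGenerating (x : List S) : Prop :=
  Ideal.ofList x = IsLocalRing.maximalIdeal S ∧
    x.length = (IsLocalRing.maximalIdeal S).spanFinrank

/-- The ideal `𝔫 / 𝔪S` of `S / 𝔪S`. -/
noncomputable def closedFiberIdeal (φ : R →+* S) :
    Ideal (S ⧸ (IsLocalRing.maximalIdeal R).map φ) :=
  (IsLocalRing.maximalIdeal S).map (Ideal.Quotient.mk ((IsLocalRing.maximalIdeal R).map φ))

/-- The embedding dimension of a local homomorphism `φ`: the minimal number of generators of the
maximal ideal `𝔫 / 𝔪S` of `S / 𝔪S`. -/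
noncomputable def edim (φ : R →+* S) : ℕ :=
  (closedFiberIdeal φ).spanFinrank

/-- `y` is a minimal set of generators of `𝔫` modulo `𝔪S`: it has `edim φ` elements and its image
in `S / 𝔪S` generates `𝔫 / 𝔪S`. -/
def IsMinimalGeneratingModulo (φ : R →+* S) (y : List S) : Prop :=
  (Ideal.ofList y).map (Ideal.Quotient.mk ((IsLocalRing.maximalIdeal R).map φ)) =
      closedFiberIdeal φ ∧
    y.length = edim φ

variable (S) in
/-- The residue field of `S`, as an `S`-module in degree `0`. -/
noncomputable abbrev residueComplex : CochainComplex (ModuleCat.{u} S) ℤ :=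
  complexOfModule (ModuleCat.of S (IsLocalRing.ResidueField S))

/-- The Betti numbers `rank_l Tor_n^R(k, K[y; M])` of `M` over `φ`. The `S`-module
`Tor_n^R(k, K[y; M])` is a vector space over the residue field `l` of `S`, so that its rank
over `l` is its length over `S`. -/
noncomputable def betti (φ : R →+* S) (y : List S) (M : CochainComplex (ModuleCat.{u} S) ℤ)
    (n : ℤ) : ℕ∞ :=
  Module.length S (relTor φ n (residueComplex R) (koszulOn y M))

/-- The Bass numbers `rank_l Ext^{n - edim φ}_R(k, K[y; M])` of `M` over `φ`. -/
noncomputable def bass (φ : R →+* S) (y : List S) (M : CochainComplex (ModuleCat.{u} S) ℤ)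
    (n : ℤ) : ℕ∞ :=
  Module.length S (relExt φ (n - edim φ) (residueComplex R) (koszulOn y M))

variable (R) in
/-- The Betti numbers of the residue field `k` of `R`. -/
noncomputable def bettiResidueField : ℤ → ℕ∞ :=
  betti (RingHom.id R) [] (residueComplex R)

/-- The `S`-module `H` is annihilated by the maximal ideal of `S`. -/
abbrev IsResidueModule (H : ModuleCat.{u} S) : Prop :=
  Module.IsTorsionBySet S H (IsLocalRing.maximalIdeal S)

/-- An `S`-module annihilated by the maximal ideal, as a vector space over the residue field. -/
noncomputable def toResidue (H : ModuleCat.{u} S) (h : IsResidueModule H) :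
    ModuleCat.{u} (IsLocalRing.ResidueField S) :=
  letI : Module (IsLocalRing.ResidueField S) H := h.module
  ModuleCat.of (IsLocalRing.ResidueField S) H

end LocalRings

end DerivedKoszul

open DerivedKoszul

set_option linter.unusedSectionVars false

/-! Write `K` for the Koszul complex on generators `x` of 𝔫. The whole proof rests on one good model
`W` of `K^M`. The elements of `x` act on `K` null-homotopically, so 𝔫 annihilates the homology of
`K`. Since `K` is bounded with finitely generated components, the Artin–Rees lemma yields an acyclic
subcomplex whose quotient is annihilated by a power of 𝔫 (`exists_quasiIso_isKilledBy_pow`). Thus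
`c` is finite and `K ≃ V` with `𝔫^c V = 0`. If `P` is a K-projective resolution of `M`, then `K^M ≃
P ⊗_S V = W`; this complex is annihilated by `𝔫^c`, hence by `𝔪S`
(`exists_derivedIso_koszulOn_isKilledBy`).

Over `R` the complex `W` consists of `k`-vector spaces, so it splits and is homotopy equivalent to
its homology; this is (1). For (2), let `P` now be a K-projective resolution of `L`. As 𝔪
annihilates `W`, one has `P ⊗_R W = (P/𝔪P) ⊗_R W`. The complex `P/𝔪P` splits too, so it may be
replaced by its homology, which has zero differential and a `k`-basis; hence `P ⊗_R W` is,
`S`-linearly and up to homotopy, a direct sum of shifts of `W` (`nonempty_homology_tensor_equiv`).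
The basis does not depend on `W`, and for `W = k` it computes `Tor^R(L, k)`; the formula in (2)
follows. Dually, homotopy classes of maps from `P` to `W` form a product of copies of the homology
of `W` indexed by the same basis (`nonempty_homotopyClasses_equiv`).

For `L = k` these formulas compare the lengths of `Tor^R(k, K^M)` and `Ext_R(k, K^M)` with the Betti
numbers of `k`: from below as soon as `H(K^M) ≠ 0`, which is Nakayama's lemma when `M` has finitely
generated homology and is not acyclic, and from above when `H(K^M)` has finite total length.

Betti and Bass numbers over `φ` use `K[y; M]` rather than `K^M`. Let `Z` generate 𝔪; then `φ(Z)` and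
`y` together generate 𝔫. Forming the cone of an element that acts as zero replaces the length
sequence `a_n` by `a_n + a_{n+1}`. This applies to `φ(Z)`, because 𝔪 annihilates `k`, and to any
element of 𝔫 once a Koszul complex on generators of 𝔫 has been formed. Computing the Koszul complex
on `x`, `φ(Z)`, `y` in two orders therefore relates the two length sequences by iterates of that
operation (`IsLengthFunction.exists_shiftSum_eq`). Curvature and complexity do not increase under
passing to a sequence bounded by a multiple of a finite sum of shifts (`Dominated.curvSeq_le`,
`Dominated.cxSeq_le`), which gives (3), (4) and (5). -/

namespace DerivedKoszul

/-! ### Homology of complexes of modules in terms of elements -/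

section HomologyElements
variable {S : Type u} [CommRing S]

lemma hom_comm_apply {C D : CochainComplex (ModuleCat.{u} S) ℤ} (f : C ⟶ D) (i j : ℤ)
    (x : C.X i) : f.f j (C.d i j x) = D.d i j (f.f i x) :=
  congrArg (fun g : C.X i ⟶ D.X j => g x) (f.comm i j).symm

lemma d_d_apply (C : CochainComplex (ModuleCat.{u} S) ℤ) (i j k : ℤ) (x : C.X i) :
    C.d j k (C.d i j x) = 0 :=
  congrArg (fun g : C.X i ⟶ C.X k => g x) (C.d_comp_d i j k)

/-- The map from cycles, as a morphism of modules. -/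
noncomputable def kerToCycles (C : CochainComplex (ModuleCat.{u} S) ℤ) (n : ℤ) :
    ModuleCat.of S (LinearMap.ker (C.d n (n + 1)).hom) ⟶ C.cycles n :=
  C.liftCycles (ModuleCat.ofHom (LinearMap.ker (C.d n (n + 1)).hom).subtype) (n + 1) (by simp)
    (by ext x; exact x.2)

lemma iCycles_kerToCycles (C : CochainComplex (ModuleCat.{u} S) ℤ) (n : ℤ)
    (z : LinearMap.ker (C.d n (n + 1)).hom) : C.iCycles n (kerToCycles C n z) = z.1 :=
  congrArg (fun g : ModuleCat.of S (LinearMap.ker (C.d n (n + 1)).hom) ⟶ C.X n => g z)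
    (C.liftCycles_i (ModuleCat.ofHom (LinearMap.ker (C.d n (n + 1)).hom).subtype) (n + 1) (by simp)
    (by ext x; exact x.2))

lemma iCycles_injective (C : CochainComplex (ModuleCat.{u} S) ℤ) (n : ℤ) :
    Function.Injective (C.iCycles n) :=
  (ModuleCat.mono_iff_injective _).1 inferInstance

lemma kerToCycles_surjective (C : CochainComplex (ModuleCat.{u} S) ℤ) (n : ℤ) :
    Function.Surjective (kerToCycles C n) := fun x =>
  ⟨⟨C.iCycles n x, congrArg (fun g : C.cycles n ⟶ C.X (n + 1) => g x) (C.iCycles_d n (n + 1))⟩,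
    iCycles_injective C n (iCycles_kerToCycles C n _)⟩

/-- The homology class of a cycle. -/
noncomputable def homologyClass (C : CochainComplex (ModuleCat.{u} S) ℤ) (n : ℤ) :
    LinearMap.ker (C.d n (n + 1)).hom →ₗ[S] C.homology n :=
  (kerToCycles C n ≫ C.homologyπ n).hom

lemma homologyClass_surjective (C : CochainComplex (ModuleCat.{u} S) ℤ) (n : ℤ) :
    Function.Surjective (homologyClass C n) :=
  ((ModuleCat.epi_iff_surjective (C.homologyπ n)).1 inferInstance).comp
    (kerToCycles_surjective C n)

/-- Homology is the cokernel of the map from the preceding term to the cycles. The preceding degree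
is a free variable `m` with `m + 1 = n`, so that the criterion applies to `n - 1, n` and to `n, n +
1` alike, without transport between equal degrees. -/
lemma homologyClass_eq_zero_iff (C : CochainComplex (ModuleCat.{u} S) ℤ) (m n : ℤ) (h : m + 1 = n)
    (z : LinearMap.ker (C.d n (n + 1)).hom) :
    homologyClass C n z = 0 ↔ ∃ y, C.d m n y = z.1 := by
  have hm : (ComplexShape.up ℤ).prev n = m := by subst h; simp
  have hex := ShortComplex.exact_of_g_is_cokernel
    (ShortComplex.mk (C.toCycles m n) (C.homologyπ n) (by simp)) (C.homologyIsCokernel m n hm)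
  rw [ShortComplex.moduleCat_exact_iff] at hex
  have hto (y : C.X m) : C.iCycles n (C.toCycles m n y) = C.d m n y :=
    congrArg (fun g : C.X m ⟶ C.X n => g y) (C.toCycles_i m n)
  constructor
  · intro h0
    obtain ⟨y, hy⟩ := hex (kerToCycles C n z) h0
    refine ⟨y, ?_⟩
    rw [← hto]
    exact (congrArg (C.iCycles n) hy).trans (iCycles_kerToCycles C n z)
  · rintro ⟨y, hy⟩
    have : kerToCycles C n z = C.toCycles m n y := iCycles_injective C n
      ((iCycles_kerToCycles C n z).trans (hy.symm.trans (hto y).symm))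
    change C.homologyπ n (kerToCycles C n z) = 0
    rw [this]
    exact congrArg (fun g : C.X m ⟶ C.homology n => g y) (C.toCycles_comp_homologyπ m n)

lemma homologyMap_homologyClass {C D : CochainComplex (ModuleCat.{u} S) ℤ} (f : C ⟶ D) (n : ℤ)
    (z : LinearMap.ker (C.d n (n + 1)).hom) (hz : f.f n z.1 ∈ LinearMap.ker (D.d n (n + 1)).hom) :
    HomologicalComplex.homologyMap f n (homologyClass C n z) = homologyClass D n ⟨f.f n z.1, hz⟩ := by
  have h₁ : HomologicalComplex.homologyMap f n (C.homologyπ n (kerToCycles C n z)) =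
      D.homologyπ n (HomologicalComplex.cyclesMap f n (kerToCycles C n z)) :=
    congrArg (fun g : C.cycles n ⟶ D.homology n => g (kerToCycles C n z))
      (HomologicalComplex.homologyπ_naturality f n)
  have h₂ : HomologicalComplex.cyclesMap f n (kerToCycles C n z) =
      kerToCycles D n ⟨f.f n z.1, hz⟩ := by
    apply iCycles_injective
    rw [iCycles_kerToCycles]
    refine (congrArg (fun g : C.cycles n ⟶ D.X n => g (kerToCycles C n z))
      (HomologicalComplex.cyclesMap_i f n)).trans ?_
    exact congrArg (f.f n) (iCycles_kerToCycles C n z)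
  change HomologicalComplex.homologyMap f n (C.homologyπ n (kerToCycles C n z)) = _
  rw [h₁, h₂]
  rfl

lemma map_mem_ker {C D : CochainComplex (ModuleCat.{u} S) ℤ} (f : C ⟶ D) (n : ℤ)
    (z : LinearMap.ker (C.d n (n + 1)).hom) : f.f n z.1 ∈ LinearMap.ker (D.d n (n + 1)).hom := by
  rw [LinearMap.mem_ker]
  refine (hom_comm_apply f n (n + 1) z.1).symm.trans ?_
  rw [show C.d n (n + 1) z.1 = 0 from z.2, map_zero]

/-- An elementwise criterion for a morphism of complexes to be a quasi-isomorphism. -/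
lemma quasiIso_of_elements {C D : CochainComplex (ModuleCat.{u} S) ℤ} (f : C ⟶ D)
    (inj : ∀ (m n : ℤ) (_ : m + 1 = n) (z : C.X n) (y : D.X m), C.d n (n + 1) z = 0 →
      D.d m n y = f.f n z → ∃ w, C.d m n w = z)
    (surj : ∀ (m n : ℤ) (_ : m + 1 = n) (y : D.X n), D.d n (n + 1) y = 0 →
      ∃ (z : C.X n) (t : D.X m), C.d n (n + 1) z = 0 ∧ f.f n z = y + D.d m n t) :
    QuasiIso f := by
  rw [quasiIso_iff]
  intro n
  rw [quasiIsoAt_iff_isIso_homologyMap, ConcreteCategory.isIso_iff_bijective]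
  have h : n - 1 + 1 = n := by lia
  constructor
  · rw [injective_iff_map_eq_zero]
    intro x hx
    obtain ⟨z, rfl⟩ := homologyClass_surjective C n x
    rw [homologyMap_homologyClass f n z (map_mem_ker f n z),
      homologyClass_eq_zero_iff D _ n h] at hx
    obtain ⟨y, hy⟩ := hx
    rw [homologyClass_eq_zero_iff C _ n h]
    exact inj _ n h z.1 y z.2 hy
  · intro x
    obtain ⟨y, rfl⟩ := homologyClass_surjective D n x
    obtain ⟨z, t, hz, ht⟩ := surj _ n h y.1 y.2
    refine ⟨homologyClass C n ⟨z, hz⟩, ?_⟩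
    rw [homologyMap_homologyClass f n ⟨z, hz⟩ (map_mem_ker f n ⟨z, hz⟩), ← sub_eq_zero, ← map_sub,
      homologyClass_eq_zero_iff D _ n h]
    exact ⟨t, by simp [ht]⟩

lemma acyclic_of_elements {C : CochainComplex (ModuleCat.{u} S) ℤ}
    (h : ∀ (m n : ℤ) (_ : m + 1 = n) (z : C.X n), C.d n (n + 1) z = 0 → ∃ w, C.d m n w = z) :
    C.Acyclic := by
  intro n
  rw [HomologicalComplex.exactAt_iff' _ (n - 1) n (n + 1) (by simp) (by simp),
    ShortComplex.moduleCat_exact_iff]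
  exact h (n - 1) n (by lia)

lemma acyclic_iff_subsingleton {C : CochainComplex (ModuleCat.{u} S) ℤ} :
    C.Acyclic ↔ ∀ n, Subsingleton (C.homology n) := by
  refine forall_congr' fun n => ?_
  rw [HomologicalComplex.exactAt_iff_isZero_homology]
  exact ModuleCat.isZero_iff_subsingleton

/-- A quasi-isomorphism induces an isomorphism on homology. -/
noncomputable def homologyEquiv {C D : CochainComplex (ModuleCat.{u} S) ℤ} (f : C ⟶ D) [QuasiIso f]
    (n : ℤ) : C.homology n ≃ₗ[S] D.homology n :=
  (asIso (HomologicalComplex.homologyMap f n)).toLinearEquiv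

lemma smul_hom_f_apply {C : CochainComplex (ModuleCat.{u} S) ℤ} (s : S) (n : ℤ) (x : C.X n) :
    (s • 𝟙 C : C ⟶ C).f n x = s • x := rfl

end HomologyElements

/-! ### Complexes of vector spaces over the residue field split -/

section ResidueModules
variable {R : Type u} [CommRing R] [IsLocalRing R]

/-- Both modules are vector spaces over `R/𝔪`: the image of `f` is a direct summand of `B`, and `f`
has a section over its image. The map `g` is the projection followed by the section. It supplies
contracting homotopies for differentials as well as linear choices of representatives of homology
classes. -/
lemma exists_pseudoInverse {A B : Type u} [AddCommGroup A] [Module R A] [AddCommGroup B]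
    [Module R B] (hA : Module.IsTorsionBySet R A (IsLocalRing.maximalIdeal R))
    (hB : Module.IsTorsionBySet R B (IsLocalRing.maximalIdeal R)) (f : A →ₗ[R] B) :
    ∃ g : B →ₗ[R] A, ∀ a, f (g (f a)) = f a := by
  let _ : Field (R ⧸ IsLocalRing.maximalIdeal R) := Ideal.Quotient.field _
  let := hA.module
  let := hB.module
  have : IsScalarTower R (R ⧸ IsLocalRing.maximalIdeal R) A := hA.isScalarTower
  have : IsScalarTower R (R ⧸ IsLocalRing.maximalIdeal R) B := hB.isScalarTower
  let f' : A →ₗ[R ⧸ IsLocalRing.maximalIdeal R] B :=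
    { f with
      map_smul' := by
        rintro ⟨r⟩ a
        exact f.map_smul r a }
  obtain ⟨p, hp⟩ := LinearMap.exists_leftInverse_of_injective (LinearMap.range f').subtype
    (Submodule.ker_subtype _)
  obtain ⟨q, hq⟩ := f'.rangeRestrict.exists_rightInverse_of_surjective f'.range_rangeRestrict
  refine ⟨(q ∘ₗ p).restrictScalars R, fun a => ?_⟩
  have h₁ : p (f' a) = f'.rangeRestrict a := LinearMap.congr_fun hp (f'.rangeRestrict a)
  have h₂ : f' (q (f'.rangeRestrict a)) = f' a :=
    congrArg Subtype.val (LinearMap.congr_fun hq (f'.rangeRestrict a))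
  change f' (q (p (f' a))) = f' a
  rw [h₁, h₂]

lemma exists_basis_of_isTorsionBySet {A : Type u} [AddCommGroup A] [Module R A]
    (hA : Module.IsTorsionBySet R A (IsLocalRing.maximalIdeal R)) :
    ∃ I : Type u, Nonempty (A ≃ₗ[R] (I →₀ IsLocalRing.ResidueField R)) := by
  let _ : Module (IsLocalRing.ResidueField R) A := hA.module
  have : IsScalarTower R (IsLocalRing.ResidueField R) A := hA.isScalarTower
  exact ⟨_, ⟨(Module.Basis.ofVectorSpace (IsLocalRing.ResidueField R) A).repr.restrictScalars R⟩⟩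

/-- A complex is annihilated by an ideal. -/
def IsKilledBy (X : CochainComplex (ModuleCat.{u} R) ℤ) (I : Ideal R) : Prop :=
  ∀ s ∈ I, ∀ (n : ℤ) (x : X.X n), s • x = 0

lemma IsKilledBy.isTorsionBySet {X : CochainComplex (ModuleCat.{u} R) ℤ} {I : Ideal R}
    (h : IsKilledBy X I) (n : ℤ) : Module.IsTorsionBySet R (X.X n) I :=
  fun x a => h a a.2 n x

lemma IsKilledBy.homology {X : CochainComplex (ModuleCat.{u} R) ℤ} {I : Ideal R}
    (h : IsKilledBy X I) (n : ℤ) : Module.IsTorsionBySet R (X.homology n) I := by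
  intro x a
  obtain ⟨z, rfl⟩ := homologyClass_surjective X n x
  rw [← map_smul, show (a : R) • z = 0 from Subtype.ext (h a a.2 n z.1), map_zero]

lemma IsKilledBy.homologyComplex {X : CochainComplex (ModuleCat.{u} R) ℤ} {I : Ideal R}
    (h : IsKilledBy X I) : IsKilledBy (homologyComplex X) I :=
  fun s hs n x => by
    have t := h.homology n
    exact @t x ⟨s, hs⟩

/-- A complex annihilated by the maximal ideal is homotopy equivalent to its homology. -/
theorem nonempty_homotopyEquiv_homologyComplex {X : CochainComplex (ModuleCat.{u} R) ℤ}
    (hX : IsKilledBy X (IsLocalRing.maximalIdeal R)) :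
    Nonempty (HomotopyEquiv X (homologyComplex X)) := by
  have hT (n : ℤ) := hX.isTorsionBySet n
  have hH (n : ℤ) := hX.homology n
  -- The maps `h i j` from degree `j` to degree `i` satisfy `d h d = d`; consequently `1 - h d` is a
  -- projection onto the cycles. This projection is `q` below.
  have h₁ (i j : ℤ) := exists_pseudoInverse (hT i) (hT j) (X.d i j).hom
  choose h hh using h₁
  have hK (n : ℤ) : Module.IsTorsionBySet R (LinearMap.ker (X.d n (n + 1)).hom)
      (IsLocalRing.maximalIdeal R) := fun x a => Subtype.ext (hX a a.2 n x.1)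
  have h₂ (n : ℤ) := exists_pseudoInverse (hK n) (hH n) (homologyClass X n)
  choose σ hσ using h₂
  have hσ' (n : ℤ) (x : X.homology n) : homologyClass X n (σ n x) = x := by
    obtain ⟨z, rfl⟩ := homologyClass_surjective X n x
    exact hσ n z
  let q (n : ℤ) : X.X n →ₗ[R] LinearMap.ker (X.d n (n + 1)).hom :=
    LinearMap.codRestrict _ (LinearMap.id - h n (n + 1) ∘ₗ (X.d n (n + 1)).hom) (fun x => by
      rw [LinearMap.mem_ker, LinearMap.sub_apply, map_sub]
      exact sub_eq_zero.2 (hh n (n + 1) x).symm)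
  let r : X ⟶ homologyComplex X :=
    { f n := ModuleCat.ofHom (homologyClass X n ∘ₗ q n)
      comm' i j hij := by
        obtain rfl : i + 1 = j := hij
        ext x
        change 0 = homologyClass X (i + 1) (q (i + 1) (X.d i (i + 1) x))
        symm
        rw [homologyClass_eq_zero_iff X i (i + 1) rfl]
        refine ⟨x, ?_⟩
        change _ = X.d i (i + 1) x - h _ _ (X.d _ _ (X.d i (i + 1) x))
        rw [d_d_apply, map_zero, sub_zero] }
  let s : homologyComplex X ⟶ X :=
    { f n := ModuleCat.ofHom ((LinearMap.ker (X.d n (n + 1)).hom).subtype ∘ₗ σ n)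
      comm' i j hij := by
        obtain rfl : i + 1 = j := hij
        ext x
        change X.d _ _ (σ i x).1 = (σ (i + 1) 0).1
        rw [map_zero]
        exact (σ i x).2 }
  have hqz (n : ℤ) (z : LinearMap.ker (X.d n (n + 1)).hom) : q n z.1 = z := by
    apply Subtype.ext
    change z.1 - h _ _ (X.d n (n + 1) z.1) = z.1
    rw [show X.d n (n + 1) z.1 = 0 from z.2, map_zero, sub_zero]
  -- The homotopy projects to a cycle, subtracts the chosen representative of its class, and applies
  -- `h` to the boundary that is left.
  let H (i j : ℤ) : X.X i ⟶ X.X j := if j + 1 = i then ModuleCat.ofHom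
    (h j i ∘ₗ ((LinearMap.ker (X.d i (i + 1)).hom).subtype ∘ₗ
      (LinearMap.id - σ i ∘ₗ homologyClass X i) ∘ₗ q i)) else 0
  have hH₀ (j i : ℤ) (hji : j + 1 = i) (x : X.X i) :
      H i j x = h j i ((q i x).1 - (σ i (homologyClass X i (q i x))).1) := by
    simp only [H, if_pos hji]
    rfl
  refine ⟨{ hom := r, inv := s, homotopyHomInvId := ?_, homotopyInvHomId := Homotopy.ofEq ?_ }⟩
  · refine Homotopy.symm ⟨H, fun i j hij => if_neg hij, fun i => ?_⟩
    rw [dNext_eq H (show (ComplexShape.up ℤ).Rel i (i + 1) from rfl),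
      prevD_eq H (show (ComplexShape.up ℤ).Rel (i - 1) i from by simp)]
    ext x
    change x = H (i + 1) i (X.d i (i + 1) x) + X.d (i - 1) i (H i (i - 1) x) +
      (σ i (homologyClass X i (q i x))).1
    rw [hH₀ i (i + 1) rfl, hH₀ (i - 1) i (by lia)]
    -- On a boundary `d x` the projection `q` is the identity and the class vanishes, so the
    -- homotopy reduces to `h`. The other term is `q x - σ[q x]` because `d h d = d`, and `q x = x -
    -- h d x` makes the sum telescope.
    have e₁ : homologyClass X (i + 1) (q (i + 1) (X.d i (i + 1) x)) = 0 := by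
      rw [hqz (i + 1) ⟨X.d i (i + 1) x, d_d_apply X _ _ _ x⟩,
        homologyClass_eq_zero_iff X i (i + 1) rfl]
      exact ⟨x, rfl⟩
    obtain ⟨y, hy⟩ : ∃ y, X.d (i - 1) i y = (q i x - σ i (homologyClass X i (q i x))).1 := by
      rw [← homologyClass_eq_zero_iff X (i - 1) i (by lia), map_sub, hσ', sub_self]
    rw [e₁, map_zero, hqz (i + 1) ⟨X.d i (i + 1) x, d_d_apply X _ _ _ x⟩]
    have e₂ : X.d (i - 1) i (h (i - 1) i ((q i x).1 - (σ i (homologyClass X i (q i x))).1)) =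
        (q i x).1 - (σ i (homologyClass X i (q i x))).1 :=
      (congrArg (fun v => X.d (i - 1) i (h (i - 1) i v)) hy).symm.trans ((hh _ _ y).trans hy)
    rw [e₂]
    have e₃ : (q i x).1 = x - h i (i + 1) (X.d i (i + 1) x) := rfl
    rw [e₃]
    simp only [ZeroMemClass.coe_zero, sub_zero]
    abel
  · ext n x
    change homologyClass X n (q n (σ n x).1) = x
    rw [hqz]
    exact hσ' n x

end ResidueModules

/-! ### Total complexes of additive bifunctors commute with mapping cones -/

section BifunctorCone
variable {R S T : Type u} [CommRing R] [CommRing S] [CommRing T]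
  (F : ModuleCat.{u} R ⥤ ModuleCat.{u} S ⥤ ModuleCat.{u} T) [F.Additive]
  [∀ X, (F.obj X).Additive]

/-- The total complex associated to a bifunctor. -/
noncomputable abbrev total (K : CochainComplex (ModuleCat.{u} R) ℤ)
    (M : CochainComplex (ModuleCat.{u} S) ℤ) : CochainComplex (ModuleCat.{u} T) ℤ :=
  HomologicalComplex.mapBifunctor K M F (ComplexShape.up ℤ)

noncomputable abbrev totalMap {K K' : CochainComplex (ModuleCat.{u} R) ℤ}
    {M M' : CochainComplex (ModuleCat.{u} S) ℤ} (f : K ⟶ K') (g : M ⟶ M') :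
    total F K M ⟶ total F K' M' :=
  HomologicalComplex.mapBifunctorMap f g F (ComplexShape.up ℤ)

noncomputable abbrev ιTotal (K : CochainComplex (ModuleCat.{u} R) ℤ)
    (M : CochainComplex (ModuleCat.{u} S) ℤ) (i j n : ℤ) (h : i + j = n) :
    (F.obj (K.X i)).obj (M.X j) ⟶ (total F K M).X n :=
  HomologicalComplex.ιMapBifunctor K M F (ComplexShape.up ℤ) i j n h

lemma totalMap_comp {K K' K'' : CochainComplex (ModuleCat.{u} R) ℤ}
    {M M' M'' : CochainComplex (ModuleCat.{u} S) ℤ} (f : K ⟶ K') (g : M ⟶ M') (f' : K' ⟶ K'')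
    (g' : M' ⟶ M'') : totalMap F (f ≫ f') (g ≫ g') = totalMap F f g ≫ totalMap F f' g' := by
  ext n : 1
  apply HomologicalComplex.mapBifunctor.hom_ext
  intro i j h
  simp

lemma totalMap_id (K : CochainComplex (ModuleCat.{u} R) ℤ)
    (M : CochainComplex (ModuleCat.{u} S) ℤ) : totalMap F (𝟙 K) (𝟙 M) = 𝟙 _ := by
  ext n : 1
  apply HomologicalComplex.mapBifunctor.hom_ext
  intro i j h
  simp

lemma totalMap_zero_left {K L : CochainComplex (ModuleCat.{u} R) ℤ}
    {M M' : CochainComplex (ModuleCat.{u} S) ℤ} (g : M ⟶ M') :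
    totalMap F (0 : K ⟶ L) g = 0 := by
  ext n : 1
  apply HomologicalComplex.mapBifunctor.hom_ext
  intro i j h
  rw [HomologicalComplex.ι_mapBifunctorMap, HomologicalComplex.zero_f, Functor.map_zero]
  exact (zero_comp (f := (F.obj (L.X i)).map (g.f j) ≫ ιTotal F L M' i j n h)).trans
    (comp_zero (f := ιTotal F K M i j n h)).symm

lemma totalMap_zero_right {K L : CochainComplex (ModuleCat.{u} R) ℤ}
    {M M' : CochainComplex (ModuleCat.{u} S) ℤ} (f : K ⟶ L) :
    totalMap F f (0 : M ⟶ M') = 0 := by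
  ext n : 1
  apply HomologicalComplex.mapBifunctor.hom_ext
  intro i j h
  rw [HomologicalComplex.ι_mapBifunctorMap, HomologicalComplex.zero_f, Functor.map_zero]
  rw [zero_comp, comp_zero]
  exact (comp_zero (f := ιTotal F K M i j n h)).symm

variable {K L : CochainComplex (ModuleCat.{u} R) ℤ} (f : K ⟶ L)
  (M : CochainComplex (ModuleCat.{u} S) ℤ)

section ConeMaps
variable {A : Type u} [CommRing A] {X Y : CochainComplex (ModuleCat.{u} A) ℤ} (g : X ⟶ Y)

open HomologicalComplex

/-- The inclusion of the first summand of a mapping cone. -/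
noncomputable def coneInl (n m : ℤ) (h : n + 1 = m) :
    X.X m ⟶ (CochainComplex.mappingCone g).X n := homotopyCofiber.inlX g m n h

/-- The inclusion of the second summand of a mapping cone. -/
noncomputable def coneInr (n : ℤ) : Y.X n ⟶ (CochainComplex.mappingCone g).X n :=
  homotopyCofiber.inrX g n

/-- The projection to the first summand of a mapping cone. -/
noncomputable def coneFst (n m : ℤ) (h : n + 1 = m) :
    (CochainComplex.mappingCone g).X n ⟶ X.X m := homotopyCofiber.fstX g n m h

/-- The projection to the second summand of a mapping cone. -/
noncomputable def coneSnd (n : ℤ) : (CochainComplex.mappingCone g).X n ⟶ Y.X n :=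
  homotopyCofiber.sndX g n

@[simp] lemma coneInl_fst (n m : ℤ) (h : n + 1 = m) : coneInl g n m h ≫ coneFst g n m h = 𝟙 _ :=
  homotopyCofiber.inlX_fstX g m n h

@[simp] lemma coneInl_snd (n m : ℤ) (h : n + 1 = m) : coneInl g n m h ≫ coneSnd g n = 0 :=
  homotopyCofiber.inlX_sndX g m n h

@[simp] lemma coneInr_fst (n m : ℤ) (h : n + 1 = m) : coneInr g n ≫ coneFst g n m h = 0 :=
  homotopyCofiber.inrX_fstX g n m h

@[simp] lemma coneInr_snd (n : ℤ) : coneInr g n ≫ coneSnd g n = 𝟙 _ :=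
  homotopyCofiber.inrX_sndX g n

lemma cone_ext_from {Z : ModuleCat.{u} A} (n m : ℤ) (h : n + 1 = m)
    {a b : (CochainComplex.mappingCone g).X n ⟶ Z} (h₁ : coneInl g n m h ≫ a = coneInl g n m h ≫ b)
    (h₂ : coneInr g n ≫ a = coneInr g n ≫ b) : a = b :=
  homotopyCofiber.ext_from_X g m n h h₁ h₂

lemma cone_total (n m : ℤ) (h : n + 1 = m) :
    coneFst g n m h ≫ coneInl g n m h + coneSnd g n ≫ coneInr g n = 𝟙 _ := by
  apply cone_ext_from g n m h
  · rw [Preadditive.comp_add, ← Category.assoc, coneInl_fst, ← Category.assoc, coneInl_snd]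
    simp
  · rw [Preadditive.comp_add, ← Category.assoc, coneInr_fst, ← Category.assoc, coneInr_snd]
    simp

lemma coneInl_d (n m k : ℤ) (h : n + 1 = m) (h' : m + 1 = k) :
    coneInl g n m h ≫ (CochainComplex.mappingCone g).d n m =
      -X.d m k ≫ coneInl g m k h' + g.f m ≫ coneInr g m :=
  homotopyCofiber.inlX_d g n m k h h'

lemma coneInr_d (n m : ℤ) :
    coneInr g n ≫ (CochainComplex.mappingCone g).d n m = Y.d n m ≫ coneInr g m :=
  homotopyCofiber.inrX_d g n m

end ConeMaps

open HomologicalComplex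

/-- The canonical null-homotopy of `f` followed by the inclusion of its target in the cone, carried
over by the bifunctor. It is the datum required to define a morphism out of the cone of `f ⊗ M`. -/
noncomputable def totalInrHomotopy :
    Homotopy (totalMap F f (𝟙 M) ≫ totalMap F (CochainComplex.mappingCone.inr f) (𝟙 M)) 0 :=
  (Homotopy.ofEq (by rw [← totalMap_comp, Category.id_comp]; rfl)).trans
      ((mapBifunctorMapHomotopy₁ (homotopyCofiber.inrCompHomotopy f
        (fun j => ⟨j - 1, by simp⟩)) (𝟙 M) F (ComplexShape.up ℤ)).trans
      (Homotopy.ofEq (totalMap_zero_left F _)))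

/-- The comparison from the cone of `f ⊗ M` to the tensor product of the cone of `f` with `M`. -/
noncomputable def coneTotalHom : CochainComplex.mappingCone (totalMap F f (𝟙 M)) ⟶
    total F (CochainComplex.mappingCone f) M :=
  homotopyCofiber.desc _ (totalMap F (CochainComplex.mappingCone.inr f) (𝟙 M))
    (totalInrHomotopy F f M)

/-- Each component of a cone is a direct sum, so the inverse can be assembled from the two
projections degree by degree. Compatibility with the differentials need not be checked: a morphism
of complexes that is invertible in each degree is an isomorphism. -/
noncomputable def coneTotalInv (n : ℤ) : (total F (CochainComplex.mappingCone f) M).X n ⟶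
    (CochainComplex.mappingCone (totalMap F f (𝟙 M))).X n :=
  mapBifunctorDesc (fun i j (h : i + j = n) =>
    (F.map (coneFst f i (i + 1) rfl)).app (M.X j) ≫
      ιTotal F K M (i + 1) j (n + 1) (by lia) ≫ coneInl (totalMap F f (𝟙 M)) n (n + 1) rfl +
    (F.map (coneSnd f i)).app (M.X j) ≫
      ιTotal F L M i j n h ≫ coneInr (totalMap F f (𝟙 M)) n)

lemma ι_coneTotalInv (i j n : ℤ) (h : i + j = n) :
    ιTotal F (CochainComplex.mappingCone f) M i j n h ≫ coneTotalInv F f M n =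
    (F.map (coneFst f i (i + 1) rfl)).app (M.X j) ≫
      ιTotal F K M (i + 1) j (n + 1) (by lia) ≫ coneInl (totalMap F f (𝟙 M)) n (n + 1) rfl +
    (F.map (coneSnd f i)).app (M.X j) ≫
      ιTotal F L M i j n h ≫ coneInr (totalMap F f (𝟙 M)) n :=
  ι_mapBifunctorDesc _ _ _ _

lemma ι_coneInl_coneTotalHom (i j n m : ℤ) (h : i + 1 + j = m) (hn : n + 1 = m) :
    ιTotal F K M (i + 1) j m h ≫ coneInl (totalMap F f (𝟙 M)) n m hn ≫ (coneTotalHom F f M).f n =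
    (F.map (coneInl f i (i + 1) rfl)).app (M.X j) ≫
      ιTotal F (CochainComplex.mappingCone f) M i j n (by lia) := by
  have h₁ := homotopyCofiber.inlX_desc_f (totalMap F f (𝟙 M))
    (totalMap F (CochainComplex.mappingCone.inr f) (𝟙 M)) (totalInrHomotopy F f M) m n hn
  refine (congrArg (fun g => ιTotal F K M (i + 1) j m h ≫ g)
    (h₁.trans ((zero_add _).trans (add_zero _)))).trans ?_
  have h₂ := mapBifunctorMapHomotopy.ιMapBifunctor_hom₁ (homotopyCofiber.inrCompHomotopy f
        (fun j => ⟨j - 1, by simp⟩)) (𝟙 M) F (ComplexShape.up ℤ) i (i + 1) j m n h (by simp)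
  refine h₂.trans ?_
  rw [ιMapBifunctorOrZero_eq _ _ _ _ _ _ _ (show i + j = n by lia),
    homotopyCofiber.inrCompHomotopy_hom _ _ _ _ rfl]
  -- The sign attached to the first variable of the total complex is `1`, so no sign enters the
  -- comparison.
  refine (one_smul ℤˣ _).trans ?_
  refine congrArg (fun g => (F.map (coneInl f i (i + 1) rfl)).app (M.X j) ≫ g) ?_
  refine (congrArg (fun g => g ≫ ιTotal F (CochainComplex.mappingCone f) M i j n (by lia))
    ((F.obj ((CochainComplex.mappingCone f).X i)).map_id (M.X j))).trans ?_
  exact Category.id_comp _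

lemma ι_coneInr_coneTotalHom (i j n : ℤ) (h : i + j = n) :
    ιTotal F L M i j n h ≫ coneInr (totalMap F f (𝟙 M)) n ≫ (coneTotalHom F f M).f n =
    (F.map (coneInr f i)).app (M.X j) ≫
      ιTotal F (CochainComplex.mappingCone f) M i j n h := by
  have h₁ := homotopyCofiber.inrX_desc_f (totalMap F f (𝟙 M))
    (totalMap F (CochainComplex.mappingCone.inr f) (𝟙 M)) (totalInrHomotopy F f M) n
  refine (congrArg (fun g => ιTotal F L M i j n h ≫ g) h₁).trans ?_
  refine (ι_mapBifunctorMap _ _ _ _ _ _ _ _).trans ?_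
  refine congrArg (fun g => (F.map (coneInr f i)).app (M.X j) ≫ g) ?_
  refine (congrArg (fun g => g ≫ ιTotal F (CochainComplex.mappingCone f) M i j n h)
    ((F.obj ((CochainComplex.mappingCone f).X i)).map_id (M.X j))).trans ?_
  exact Category.id_comp _

lemma map_app_comp {X Y Z : ModuleCat.{u} R} (a : X ⟶ Y) (b : Y ⟶ Z) (N : ModuleCat.{u} S)
    {A : ModuleCat.{u} T} (c : (F.obj Z).obj N ⟶ A) :
    (F.map a).app N ≫ (F.map b).app N ≫ c = (F.map (a ≫ b)).app N ≫ c := by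
  rw [F.map_comp, NatTrans.comp_app, Category.assoc]

lemma coneTotalInv_hom (n : ℤ) :
    coneTotalInv F f M n ≫ (coneTotalHom F f M).f n = 𝟙 _ := by
  apply mapBifunctor.hom_ext
  intro i j h
  rw [Category.comp_id, ← Category.assoc, ι_coneTotalInv, Preadditive.add_comp]
  simp only [Category.assoc]
  rw [ι_coneInl_coneTotalHom, ι_coneInr_coneTotalHom, ← Category.assoc, ← Category.assoc,
    ← Preadditive.add_comp]
  rw [← NatTrans.comp_app, ← NatTrans.comp_app, ← Functor.map_comp, ← Functor.map_comp,
    ← NatTrans.app_add, ← F.map_add, cone_total, F.map_id, NatTrans.id_app, Category.id_comp]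

lemma coneTotalHom_inv (n : ℤ) :
    (coneTotalHom F f M).f n ≫ coneTotalInv F f M n = 𝟙 _ := by
  apply cone_ext_from _ n (n + 1) rfl
  · apply mapBifunctor.hom_ext
    intro i j h
    obtain ⟨i, rfl⟩ : ∃ i', i = i' + 1 := ⟨i - 1, by lia⟩
    have h₁ := congrArg (fun g => g ≫ coneTotalInv F f M n)
      (ι_coneInl_coneTotalHom F f M i j n (n + 1) h rfl)
    simp only [Category.assoc] at h₁
    refine h₁.trans ?_
    rw [ι_coneTotalInv, Preadditive.comp_add, map_app_comp, map_app_comp,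
      coneInl_fst, coneInl_snd, F.map_id, F.map_zero, NatTrans.id_app, Category.id_comp]
    refine (congrArg (_ + ·) (zero_comp (f := ιTotal F L M i j n (by lia) ≫
      coneInr (totalMap F f (𝟙 M)) n))).trans ?_
    rw [add_zero, Category.comp_id]
  · apply mapBifunctor.hom_ext
    intro i j (h : i + j = n)
    have h₁ := congrArg (fun g => g ≫ coneTotalInv F f M n)
      (ι_coneInr_coneTotalHom F f M i j n h)
    simp only [Category.assoc] at h₁
    refine h₁.trans ?_
    rw [ι_coneTotalInv, Preadditive.comp_add, map_app_comp, map_app_comp,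
      coneInr_fst, coneInr_snd, F.map_id, F.map_zero, NatTrans.id_app, Category.id_comp]
    refine (congrArg (· + _) (zero_comp (f := ιTotal F K M (i + 1) j (n + 1) (by lia) ≫
      coneInl (totalMap F f (𝟙 M)) n (n + 1) rfl))).trans ?_
    rw [zero_add, Category.comp_id]

/-- Tensor products preserve mapping cones in the first variable. -/
noncomputable def coneTotalIso : CochainComplex.mappingCone (totalMap F f (𝟙 M)) ≅
    total F (CochainComplex.mappingCone f) M :=
  haveI : IsIso (coneTotalHom F f M) := by
    have (n : ℤ) : IsIso ((coneTotalHom F f M).f n) :=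
      ⟨coneTotalInv F f M n, coneTotalHom_inv F f M n, coneTotalInv_hom F f M n⟩
    exact HomologicalComplex.Hom.isIso_of_components _
  asIso (coneTotalHom F f M)

end BifunctorCone

/-! ### Cones in the second variable, the total differential, and modules in degree zero -/

section BifunctorMore
variable {R S T : Type u} [CommRing R] [CommRing S] [CommRing T]

open HomologicalComplex

/-- Isomorphic morphisms have isomorphic cones. -/
noncomputable def coneIsoOfIso {X Y X' Y' : CochainComplex (ModuleCat.{u} R) ℤ} (g : X ⟶ Y)
    (g' : X' ⟶ Y') (e : X ≅ X') (e' : Y ≅ Y') (h : e.hom ≫ g' = g ≫ e'.hom) :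
    CochainComplex.mappingCone g ≅ CochainComplex.mappingCone g' :=
  homotopyCofiber.mapArrowIso g g' (fun j => ⟨j - 1, by simp⟩) (Arrow.isoMk e e' h)

variable (F : ModuleCat.{u} R ⥤ ModuleCat.{u} S ⥤ ModuleCat.{u} T) [F.Additive]
  [∀ X, (F.obj X).Additive]

instance : F.flip.Additive where
  map_add {_ _ _ _} := by
    apply NatTrans.ext
    funext Z
    exact (F.obj Z).map_add

instance (X : ModuleCat.{u} S) : (F.flip.obj X).Additive where
  map_add {a b f g} := by
    change (F.map (f + g)).app X = (F.map f).app X + (F.map g).app X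
    rw [F.map_add]
    rfl

/-- Tensor products preserve mapping cones in the second variable. -/
noncomputable def coneTotalIso₂ (K : CochainComplex (ModuleCat.{u} R) ℤ)
    {M N : CochainComplex (ModuleCat.{u} S) ℤ} (g : M ⟶ N) :
    CochainComplex.mappingCone (totalMap F (𝟙 K) g) ≅
    total F K (CochainComplex.mappingCone g) :=
  -- The flip isomorphisms of total complexes are natural, and exchange the second variable with the
  -- first.
  coneIsoOfIso _ _ (mapBifunctorFlipIso K M F (ComplexShape.up ℤ)).symm
    (mapBifunctorFlipIso K N F (ComplexShape.up ℤ)).symm (by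
      rw [Iso.symm_hom, Iso.symm_hom, Iso.inv_comp_eq, ← Category.assoc, Iso.eq_comp_inv]
      exact mapBifunctorFlipIso_hom_naturality _ _ _ _) ≪≫
  coneTotalIso F.flip g K ≪≫
  mapBifunctorFlipIso K (CochainComplex.mappingCone g) F (ComplexShape.up ℤ)

/-- The sign `(-1)^i` sits on the differential of the second factor. The signs in the complex of
characters and in the inclusions of shifts are governed by this convention. -/
lemma ι_total_d (K : CochainComplex (ModuleCat.{u} R) ℤ) (M : CochainComplex (ModuleCat.{u} S) ℤ)
    (i j n : ℤ) (h : i + j = n) :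
    ιTotal F K M i j n h ≫ (total F K M).d n (n + 1) =
      (F.map (K.d i (i + 1))).app (M.X j) ≫ ιTotal F K M (i + 1) j (n + 1) (by lia) +
      i.negOnePow • ((F.obj (K.X i)).map (M.d j (j + 1)) ≫
        ιTotal F K M i (j + 1) (n + 1) (by lia)) := by
  refine (congrArg (fun g => ιTotal F K M i j n h ≫ g) (mapBifunctor.d_eq K M F _ _ _)).trans ?_
  rw [Preadditive.comp_add]
  refine congrArg₂ (· + ·) ?_ ?_
  · refine (mapBifunctor.ι_D₁ K M F (ComplexShape.up ℤ) n (n + 1) i j h).trans ?_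
    refine (mapBifunctor.d₁_eq K M F (ComplexShape.up ℤ) (i₁ := i) (i₁' := i + 1) rfl j (n + 1)
      (show i + 1 + j = n + 1 by lia)).trans ?_
    exact one_smul ℤˣ _
  · refine (mapBifunctor.ι_D₂ K M F (ComplexShape.up ℤ) n (n + 1) i j h).trans ?_
    exact mapBifunctor.d₂_eq K M F (ComplexShape.up ℤ) i (i₂ := j) (i₂' := j + 1) rfl (n + 1)
      (show i + (j + 1) = n + 1 by lia)

section Single
variable (A : ModuleCat.{u} R) (M : CochainComplex (ModuleCat.{u} S) ℤ)

/-- The inclusion of `A ⊗ M_n` in the tensor product of `A`, viewed as a complex, and `M`. -/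
noncomputable def singleTotalX (n : ℤ) : (F.obj A).obj (M.X n) ⟶
    (total F ((HomologicalComplex.single _ (ComplexShape.up ℤ) 0).obj A) M).X n :=
  (F.map (singleObjXSelf (ComplexShape.up ℤ) 0 A).inv).app (M.X n) ≫
    ιTotal F _ M 0 n n (zero_add n)

lemma singleTotalX_d (n : ℤ) : singleTotalX F A M n ≫
    (total F ((HomologicalComplex.single _ (ComplexShape.up ℤ) 0).obj A) M).d n (n + 1) =
      (F.obj A).map (M.d n (n + 1)) ≫ singleTotalX F A M (n + 1) := by
  have h₁ : ((HomologicalComplex.single _ (ComplexShape.up ℤ) 0).obj A).d 0 (0 + 1) = 0 := by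
    simp
  rw [singleTotalX, singleTotalX, Category.assoc, ι_total_d, h₁, F.map_zero]
  rw [Int.negOnePow_zero, one_smul,
    (F.map (singleObjXSelf (ComplexShape.up ℤ) 0 A).inv).naturality_assoc]
  refine congrArg (fun g => (F.map (singleObjXSelf (ComplexShape.up ℤ) 0 A).inv).app (M.X n) ≫ g)
    ?_
  exact (congrArg (· + _) zero_comp).trans (zero_add _)

/-- Only the summand with `i = 0` is nonzero; there `j = n` holds up to a propositional equality,
which is absorbed by `eqToHom`. -/
noncomputable def singleTotalInv
    (n : ℤ) : (total F ((HomologicalComplex.single _ (ComplexShape.up ℤ) 0).obj A) M).X n ⟶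
      (F.obj A).obj (M.X n) :=
  mapBifunctorDesc (fun i j (h : i + j = n) =>
    if hi : i = 0 then (F.map (singleObjXIsoOfEq (ComplexShape.up ℤ) 0 A i hi).hom).app (M.X j) ≫
      eqToHom (by rw [show j = n by lia]) else 0)

lemma ι_singleTotalInv (n : ℤ) : ιTotal F _ M 0 n n (zero_add n) ≫ singleTotalInv F A M n =
    (F.map (singleObjXSelf (ComplexShape.up ℤ) 0 A).hom).app (M.X n) := by
  refine (ι_mapBifunctorDesc _ _ _ _).trans ?_
  rw [dif_pos rfl]
  exact Category.comp_id _

lemma singleTotalX_inv (n : ℤ) : singleTotalX F A M n ≫ singleTotalInv F A M n = 𝟙 _ := by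
  rw [singleTotalX, Category.assoc, ι_singleTotalInv, ← NatTrans.comp_app, ← F.map_comp,
    Iso.inv_hom_id, F.map_id, NatTrans.id_app]

lemma singleTotalInv_X (n : ℤ) : singleTotalInv F A M n ≫ singleTotalX F A M n = 𝟙 _ := by
  apply mapBifunctor.hom_ext
  intro i j (h : i + j = n)
  by_cases hi : i = 0
  · subst hi
    obtain rfl : j = n := by lia
    refine (Category.assoc _ _ _).symm.trans ?_
    rw [ι_singleTotalInv, singleTotalX, ← Category.assoc, ← NatTrans.comp_app, ← F.map_comp,
      Iso.hom_inv_id, F.map_id, NatTrans.id_app, Category.id_comp, Category.comp_id]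
  · have hz : IsZero ((F.obj (((HomologicalComplex.single _ (ComplexShape.up ℤ) 0).obj A).X i)).obj
        (M.X j)) := by
      have := (isZero_single_obj_X (ComplexShape.up ℤ) 0 A i hi)
      rw [IsZero.iff_id_eq_zero] at this ⊢
      rw [← NatTrans.id_app, ← F.map_id, this, F.map_zero]
      rfl
    exact hz.eq_of_src _ _

/-- The map identifying `A ⊗ M` with the tensor product of `A`, viewed as a complex, and `M`. -/
noncomputable def singleTotalHom :
    ((F.obj A).mapHomologicalComplex (ComplexShape.up ℤ)).obj M ⟶
      total F ((HomologicalComplex.single _ (ComplexShape.up ℤ) 0).obj A) M where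
  f n := singleTotalX F A M n
  comm' i j hij := by
    obtain rfl : i + 1 = j := hij
    exact singleTotalX_d F A M i

/-- The tensor product with a module, viewed as a complex, is computed degreewise. -/
noncomputable def singleTotalIso :
    ((F.obj A).mapHomologicalComplex (ComplexShape.up ℤ)).obj M ≅
      total F ((HomologicalComplex.single _ (ComplexShape.up ℤ) 0).obj A) M :=
  haveI : IsIso (singleTotalHom F A M) := by
    have (n : ℤ) : IsIso ((singleTotalHom F A M).f n) :=
      ⟨singleTotalInv F A M n, singleTotalX_inv F A M n, singleTotalInv_X F A M n⟩
    exact HomologicalComplex.Hom.isIso_of_components _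
  asIso (singleTotalHom F A M)

end Single

end BifunctorMore

/-! ### K-projective complexes are K-flat, by duality with characters -/

section KFlat
variable {R S : Type u} [CommRing R] [CommRing S] (φ : R →+* S)

open HomologicalComplex TensorProduct

/-- The inclusions of the summands of a tensor product of complexes. -/
noncomputable def ιTensor (P : CochainComplex (ModuleCat.{u} R) ℤ)
    (A : CochainComplex (ModuleCat.{u} S) ℤ) (i j n : ℤ) (h : i + j = n) :
    ((ModuleCat.restrictScalars φ).obj (A.X j) ⊗[R] P.X i) →ₗ[S] (tensorComplex φ P A).X n :=
  (ιTotal (tensorFunctor φ) P A i j n h).hom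

lemma d_ιTensor (P : CochainComplex (ModuleCat.{u} R) ℤ)
    (A : CochainComplex (ModuleCat.{u} S) ℤ) (i j n : ℤ) (h : i + j = n)
    (a : (ModuleCat.restrictScalars φ).obj (A.X j)) (p : P.X i) :
    (tensorComplex φ P A).d n (n + 1) (ιTensor φ P A i j n h (a ⊗ₜ p)) =
      ιTensor φ P A (i + 1) j (n + 1) (by lia) (a ⊗ₜ P.d i (i + 1) p) +
      i.negOnePow • ιTensor φ P A i (j + 1) (n + 1) (by lia)
        ((show (ModuleCat.restrictScalars φ).obj (A.X (j + 1)) from A.d j (j + 1) a) ⊗ₜ p) :=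
  congrArg (fun g : ((tensorFunctor φ).obj (P.X i)).obj (A.X j) ⟶
    (tensorComplex φ P A).X (n + 1) => g (a ⊗ₜ p)) (ι_total_d (tensorFunctor φ) P A i j n h)

lemma tensorComplex_ext {P : CochainComplex (ModuleCat.{u} R) ℤ}
    {A : CochainComplex (ModuleCat.{u} S) ℤ} {n : ℤ} {X : Type u} [AddCommGroup X] [Module S X]
    {f g : (tensorComplex φ P A).X n →ₗ[S] X}
    (H : ∀ (i j : ℤ) (h : i + j = n) (a : (ModuleCat.restrictScalars φ).obj (A.X j)) (p : P.X i),
      f (ιTensor φ P A i j n h (a ⊗ₜ p)) = g (ιTensor φ P A i j n h (a ⊗ₜ p))) : f = g := by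
  have : ModuleCat.ofHom f = ModuleCat.ofHom g := by
    apply mapBifunctor.hom_ext
    intro i j h
    exact ModuleCat.hom_ext (tensorMap_ext φ fun a p => H i j h a p)
  exact congrArg ModuleCat.Hom.hom this

/-- Construction of linear maps from a tensor product of complexes. -/
noncomputable def tensorComplexDesc {P : CochainComplex (ModuleCat.{u} R) ℤ}
    {A : CochainComplex (ModuleCat.{u} S) ℤ} {n : ℤ} {X : Type u} [AddCommGroup X] [Module S X]
    (f : ∀ (i j : ℤ) (_ : i + j = n),
      ((ModuleCat.restrictScalars φ).obj (A.X j) ⊗[R] P.X i) →ₗ[S] X) :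
    (tensorComplex φ P A).X n →ₗ[S] X :=
  (mapBifunctorDesc (F := tensorFunctor φ) (K₁ := P) (K₂ := A) (c := ComplexShape.up ℤ) (j := n)
    (A := ModuleCat.of S X) (fun i j h => ModuleCat.ofHom (f i j h))).hom

lemma tensorComplexDesc_ι {P : CochainComplex (ModuleCat.{u} R) ℤ}
    {A : CochainComplex (ModuleCat.{u} S) ℤ} {n : ℤ} {X : Type u} [AddCommGroup X] [Module S X]
    (f : ∀ (i j : ℤ) (_ : i + j = n),
      ((ModuleCat.restrictScalars φ).obj (A.X j) ⊗[R] P.X i) →ₗ[S] X) (i j : ℤ) (h : i + j = n)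
    (x : (ModuleCat.restrictScalars φ).obj (A.X j) ⊗[R] P.X i) :
    tensorComplexDesc φ f (ιTensor φ P A i j n h x) = f i j h x :=
  congrArg (fun g : ((tensorFunctor φ).obj (P.X i)).obj (A.X j) ⟶ ModuleCat.of S X => g x)
    (ι_mapBifunctorDesc (F := tensorFunctor φ) (K₁ := P) (K₂ := A) (c := ComplexShape.up ℤ) (j := n)
      (A := ModuleCat.of S X) (fun i j h => ModuleCat.ofHom (f i j h)) i j h)

/-- The linear map to the character module of the ring that corresponds to a character. -/
noncomputable def characterLift {N : Type u} [AddCommGroup N] [Module S N]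
    (ν : CharacterModule N) : N →ₗ[S] CharacterModule S where
  toFun x := ν.comp ((LinearMap.toSpanSingleton S N x).toAddMonoidHom)
  map_add' x y := by
    ext s
    change ν (s • (x + y)) = ν (s • x) + ν (s • y)
    rw [smul_add, map_add]
  map_smul' t x := by
    ext s
    change ν (s • t • x) = ν ((t • s) • x)
    rw [smul_smul, smul_eq_mul, mul_comm]

lemma characterLift_one {N : Type u} [AddCommGroup N] [Module S N]
    (ν : CharacterModule N) (x : N) : characterLift (S := S) ν x (1 : S) = ν x := by
  change ν ((1 : S) • x) = ν x
  rw [one_smul]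

/-- The components of a family of characters. -/
noncomputable def characterEval' {A : ℤ → ModuleCat.{u} R} {n i : ℤ}
    (c : ∀ j : {j // i + j = n}, CharacterModule (A j)) (j : ℤ) (h : i + j = n) :
    CharacterModule (A j) := c ⟨j, h⟩

/-- The complex of characters of a complex. -/
noncomputable def characterComplex (A : CochainComplex (ModuleCat.{u} R) ℤ) (n : ℤ) :
    CochainComplex (ModuleCat.{u} R) ℤ where
  -- The index type has the single element `n - i`. Writing it as a product lets the degree `j` be
  -- any integer with a proof of `i + j = n`.
  X i := ModuleCat.of R (∀ j : {j // i + j = n}, CharacterModule (A.X j))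
  d i i' := ModuleCat.ofHom (LinearMap.pi fun j' : {j // i' + j = n} =>
    -- This sign makes a character that vanishes on the boundaries of a tensor product correspond to
    -- a chain map; see `tensorCharacter_d`.
    ((i'.negOnePow : ℤ) : R) • CharacterModule.dual (A.d j' (n - i)).hom ∘ₗ
      LinearMap.proj (φ := fun j : {j // i + j = n} => CharacterModule (A.X j)) ⟨n - i, by lia⟩)
  shape i i' h := by
    apply ModuleCat.hom_ext
    refine LinearMap.ext fun c => funext fun j' => CharacterModule.ext _ fun a => ?_
    have : A.d j' (n - i) = 0 := A.shape _ _ (fun h' => h (by have := j'.2; simp at h' ⊢; lia))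
    change characterEval' c _ _ (A.d j' (n - i) (((i'.negOnePow : ℤ) : R) • a)) = 0
    rw [this]
    exact map_zero _
  d_comp_d' i j k _ _ := by
    apply ModuleCat.hom_ext
    refine LinearMap.ext fun c => funext fun j' => CharacterModule.ext _ fun a => ?_
    change characterEval' c _ _ (A.d (n - j) (n - i) (((j.negOnePow : ℤ) : R) •
      A.d j' (n - j) (((k.negOnePow : ℤ) : R) • a))) = 0
    rw [map_smul, d_d_apply, smul_zero, map_zero]

/-- The components of an element of the complex of characters. -/
noncomputable def characterEval {A : CochainComplex (ModuleCat.{u} R) ℤ} {n i : ℤ}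
    (c : (characterComplex A n).X i) (j : ℤ) (h : i + j = n) : CharacterModule (A.X j) :=
  (show ∀ j : {j // i + j = n}, CharacterModule (A.X j) from c) ⟨j, h⟩

lemma characterComplex_ext {A : CochainComplex (ModuleCat.{u} R) ℤ} {n i : ℤ}
    {c c' : (characterComplex A n).X i}
    (H : ∀ (j : ℤ) (h : i + j = n) (a : A.X j), characterEval c j h a = characterEval c' j h a) :
    c = c' :=
  funext fun j => CharacterModule.ext _ fun a => H j.1 j.2 a

lemma characterComplex_d (A : CochainComplex (ModuleCat.{u} R) ℤ) (n i i' j j' : ℤ)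
    (h : i + j = n) (h' : i' + j' = n) (c : (characterComplex A n).X i) (a : A.X j') :
    characterEval ((characterComplex A n).d i i' c) j' h' a =
      characterEval c j h (A.d j' j (((i'.negOnePow : ℤ) : R) • a)) := by
  obtain rfl : j = n - i := by lia
  rfl

/-- The group of values of characters is injective. A cocycle `c` vanishes on boundaries, which are
all the cycles, so it factors through the image of the next differential; the resulting character on
the image extends to the whole module. -/
lemma characterComplex_acyclic {A : CochainComplex (ModuleCat.{u} R) ℤ} (hA : A.Acyclic) (n : ℤ) :
    (characterComplex A n).Acyclic := by
  apply acyclic_of_elements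
  intro i i' hi c hc
  have h₁ : i + (n - i) = n := by lia
  have h₂ : i' + (n - i') = n := by lia
  have h₃ : (i' + 1) + (n - i' - 1) = n := by lia
  let c' : CharacterModule (A.X (n - i')) := characterEval c _ h₂
  have hc' (x : A.X (n - i')) (hx : A.d (n - i') (n - i) x = 0) : c' x = 0 := by
    obtain ⟨y, rfl⟩ : ∃ y, A.d (n - i' - 1) (n - i') y = x := by
      have hn : n - i = n - i' - 1 + 1 + 1 := by lia
      have hm : n - i' = n - i' - 1 + 1 := by lia
      have := exact_elements hA (n - i' - 1)
      rw [← hn, ← hm] at this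
      exact this x hx
    have := characterComplex_d A n i' (i' + 1) _ _ h₂ h₃ c
      (((((i' + 1).negOnePow : ℤ) : R)) • y)
    rw [hc, smul_smul] at this
    have hs : (((i' + 1).negOnePow : ℤ) : R) * (((i' + 1).negOnePow : ℤ) : R) = 1 := by
      rw [← Int.cast_mul, ← Units.val_mul, Int.units_mul_self]; simp
    rw [hs, one_smul] at this
    exact this.symm
  let f := (A.d (n - i') (n - i)).hom
  let q : A.X (n - i') ⧸ LinearMap.ker f →ₗ[R] A.X (n - i) := (LinearMap.ker f).liftQ f le_rfl
  have hq : Function.Injective q := LinearMap.ker_eq_bot.1 (Submodule.ker_liftQ_eq_bot _ _ _ le_rfl)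
  let c'' : CharacterModule (A.X (n - i') ⧸ LinearMap.ker f) :=
    QuotientAddGroup.lift (LinearMap.ker f).toAddSubgroup c' (fun x hx => hc' x hx)
  obtain ⟨e, he⟩ := CharacterModule.dual_surjective_of_injective q hq c''
  have he' (x : A.X (n - i')) : e (A.d (n - i') (n - i) x) = c' x :=
    DFunLike.congr_fun he (Submodule.Quotient.mk x)
  have hs : ((i'.negOnePow : ℤ) : R) * ((i'.negOnePow : ℤ) : R) = 1 := by
    rw [← Int.cast_mul, ← Units.val_mul, Int.units_mul_self]; simp
  let w : (characterComplex A n).X i := fun j : {j // i + j = n} => (((i'.negOnePow : ℤ) : R) •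
    (show CharacterModule (A.X j) from (show n - i = (j : ℤ) by have := j.2; lia) ▸ e))
  refine ⟨w, characterComplex_ext fun j' hj' a => ?_⟩
  obtain rfl : j' = n - i' := by lia
  rw [characterComplex_d A n i i' _ _ h₁ h₂]
  change e (((i'.negOnePow : ℤ) : R) • A.d _ _ (((i'.negOnePow : ℤ) : R) • a)) = _
  have hd : A.d (n - i') (n - i) (((i'.negOnePow : ℤ) : R) • a) =
      ((i'.negOnePow : ℤ) : R) • A.d (n - i') (n - i) a := map_smul (A.d _ _).hom _ _
  rw [hd, smul_smul, hs, one_smul, he']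

/-- The components of a character on a tensor product of complexes. -/
noncomputable def tensorCharacter {P : CochainComplex (ModuleCat.{u} R) ℤ}
    {A : CochainComplex (ModuleCat.{u} S) ℤ} {n : ℤ}
    (l : CharacterModule ((tensorComplex φ P A).X n)) (i j : ℤ) (h : i + j = n) :
    P.X i →ₗ[R] CharacterModule ((ModuleCat.restrictScalars φ).obj (A.X j)) where
  toFun p :=
    { toFun a := l (ιTensor φ P A i j n h (a ⊗ₜ p))
      map_zero' := by rw [TensorProduct.zero_tmul, map_zero, map_zero]
      map_add' a b := by rw [TensorProduct.add_tmul, map_add, map_add] }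
  map_add' p q := CharacterModule.ext _ fun a => by
    change l (ιTensor φ P A i j n h (a ⊗ₜ (p + q))) = l _ + l _
    rw [TensorProduct.tmul_add, map_add, map_add]
  map_smul' r p := CharacterModule.ext _ fun a => by
    change l (ιTensor φ P A i j n h (a ⊗ₜ (r • p))) = l (ιTensor φ P A i j n h ((r • a) ⊗ₜ p))
    rw [TensorProduct.smul_tmul]

/-- The vanishing of `l` on the boundary of `a ⊗ p` equates, up to sign, its values on `a ⊗ dp` and
`da ⊗ p`. This is the condition for the maps `tensorCharacter` to commute with differentials; the
parity of `i` decides the sign. -/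
lemma tensorCharacter_d {P : CochainComplex (ModuleCat.{u} R) ℤ}
    {A : CochainComplex (ModuleCat.{u} S) ℤ} {n m : ℤ} (hnm : n + 1 = m)
    (l : CharacterModule ((tensorComplex φ P A).X m))
    (hl : ∀ w, l ((tensorComplex φ P A).d n m w) = 0) (i j : ℤ) (h : i + 1 + j = m) (p : P.X i)
    (a : (ModuleCat.restrictScalars φ).obj (A.X j)) :
    tensorCharacter φ l i (j + 1) (by lia) p ((ModuleCat.restrictScalars φ).map (A.d j (j + 1))
      ((((i + 1).negOnePow : ℤ) : R) • a)) =
    tensorCharacter φ l (i + 1) j h (P.d i (i + 1) p) a := by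
  subst hnm
  have h₂ := hl (ιTensor φ P A i j n (by lia) (a ⊗ₜ p))
  have h₃ := (congrArg l (d_ιTensor φ P A i j n (by lia) a p)).symm.trans h₂
  rw [map_add, add_eq_zero_iff_neg_eq] at h₃
  rw [map_smul]
  change l (ιTensor φ P A i (j + 1) (n + 1) _ (((((i + 1).negOnePow : ℤ) : R) •
    (ModuleCat.restrictScalars φ).map (A.d j (j + 1)) a) ⊗ₜ p)) =
    l (ιTensor φ P A (i + 1) j (n + 1) _ (a ⊗ₜ P.d i (i + 1) p))
  rw [eq_comm, ← neg_inj, h₃]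
  rcases Int.even_or_odd i with hi | hi
  · rw [Int.negOnePow_even i hi, one_smul, Int.negOnePow_odd (i + 1) hi.add_one]
    simp only [Units.val_neg, Units.val_one, Int.cast_neg, Int.cast_one, neg_smul, one_smul,
      TensorProduct.neg_tmul, map_neg, neg_neg]
    rfl
  · rw [Int.negOnePow_odd i hi, Units.neg_smul, one_smul, Int.negOnePow_even (i + 1) hi.add_one]
    simp only [Units.val_one, Int.cast_one, one_smul, map_neg, neg_inj]
    rfl

/-- An `S`-linear map to the characters of `S` is determined by its values followed by evaluation at
`1`: evaluation at `s` is evaluation at `1` after multiplying by `s`, and this factor can be moved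
into `a`. -/
lemma tensorComplex_character_ext {P : CochainComplex (ModuleCat.{u} R) ℤ}
    {A : CochainComplex (ModuleCat.{u} S) ℤ} {n : ℤ}
    {f g : (tensorComplex φ P A).X n →ₗ[S] CharacterModule S}
    (H : ∀ (i j : ℤ) (h : i + j = n) (a : (ModuleCat.restrictScalars φ).obj (A.X j)) (p : P.X i),
      f (ιTensor φ P A i j n h (a ⊗ₜ p)) (1 : S) = g (ιTensor φ P A i j n h (a ⊗ₜ p)) (1 : S)) :
    f = g := by
  apply tensorComplex_ext
  intro i j h a p
  refine CharacterModule.ext _ fun s => ?_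
  have e (c : CharacterModule S) : c s = (s • c) (1 : S) := by
    rw [CharacterModule.smul_apply, smul_eq_mul, mul_one]
  have e' : s • (a ⊗ₜ[R] p) = (show (ModuleCat.restrictScalars φ).obj (A.X j) from
    s • (show A.X j from a)) ⊗ₜ[R] p := rfl
  have ef : s • ιTensor φ P A i j n h (a ⊗ₜ p) = ιTensor φ P A i j n h
      ((show (ModuleCat.restrictScalars φ).obj (A.X j) from s • (show A.X j from a)) ⊗ₜ p) :=
    ((ιTensor φ P A i j n h).map_smul s _).symm
  rw [e, e (g _), ← map_smul f, ← map_smul g, ef]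
  exact H i j h _ p

/-- The character on a tensor product of modules that corresponds to a linear map. -/
noncomputable def characterOfHom {P : CochainComplex (ModuleCat.{u} R) ℤ}
    {A : CochainComplex (ModuleCat.{u} R) ℤ} {n i i' j : ℤ} (f : P.X i ⟶ (characterComplex A n).X i')
    (h : i' + j = n) : CharacterModule (A.X j ⊗[R] P.X i) :=
  CharacterModule.congr (TensorProduct.comm R (P.X i) (A.X j))
    (CharacterModule.uncurry ((LinearMap.proj (φ := fun j : {j // i' + j = n} =>
      CharacterModule (A.X j)) ⟨j, h⟩ ∘ₗ f.hom)))

/-- The linear map from a tensor product of complexes to the character module of the ring that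
corresponds to a family of linear maps to the complex of characters. -/
noncomputable def characterUncurry {P : CochainComplex (ModuleCat.{u} R) ℤ}
    {A : CochainComplex (ModuleCat.{u} S) ℤ} {m n : ℤ} (hmn : m + 1 = n)
    (s : ∀ i i', P.X i ⟶ (characterComplex (restrict φ A) m).X i') :
    (tensorComplex φ P A).X n →ₗ[S] CharacterModule S :=
  tensorComplexDesc φ fun i j h =>
    characterLift (characterOfHom (s i (i - 1)) (A := restrict φ A) (j := j) (by lia))

lemma characterUncurry_apply {P : CochainComplex (ModuleCat.{u} R) ℤ}
    {A : CochainComplex (ModuleCat.{u} S) ℤ} {m n : ℤ} (hmn : m + 1 = n)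
    (s : ∀ i i', P.X i ⟶ (characterComplex (restrict φ A) m).X i') (i j i' : ℤ) (hi : i' + 1 = i)
    (h : i + j = n) (h' : i' + j = m) (a : (ModuleCat.restrictScalars φ).obj (A.X j)) (p : P.X i) :
    characterUncurry φ hmn s (ιTensor φ P A i j n h (a ⊗ₜ p)) (1 : S) =
      characterEval (A := restrict φ A) (s i i' p) j h' a := by
  obtain rfl : i' = i - 1 := by lia
  exact (congrArg (fun c : CharacterModule S => c (1 : S)) (tensorComplexDesc_ι φ _ i j h _)).trans
    (characterLift_one _ _)

/-- The two terms of the differential of `a ⊗ p` become the two terms of a homotopy formula for `s`.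
-/
lemma characterUncurry_d {P : CochainComplex (ModuleCat.{u} R) ℤ}
    {A : CochainComplex (ModuleCat.{u} S) ℤ} {m n : ℤ} (hmn : m + 1 = n)
    (s : ∀ i i', P.X i ⟶ (characterComplex (restrict φ A) m).X i') (i i' j j' : ℤ)
    (hi : i' + 1 = i) (hj : j + 1 = j') (h : i + j = m) (h' : i' + j' = m)
    (a : (ModuleCat.restrictScalars φ).obj (A.X j)) (p : P.X i) :
    characterUncurry φ hmn s ((tensorComplex φ P A).d m n (ιTensor φ P A i j m h (a ⊗ₜ p))) (1 : S) =
      characterEval (A := restrict φ A) (s (i + 1) i (P.d i (i + 1) p)) j h a +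
      characterEval (A := restrict φ A) (s i i' p) j' h'
          ((restrict φ A).d j j' (((i.negOnePow : ℤ) : R) • a)) := by
  subst hmn hj
  have h₁ : i + 1 + j = m + 1 := by lia
  have h₂ : i + (j + 1) = m + 1 := by lia
  refine (congrArg (fun t => characterUncurry φ rfl s t (1 : S)) (d_ιTensor φ P A i j m h a p)).trans ?_
  rw [map_add]
  refine congrArg₂ (· + ·) (characterUncurry_apply φ rfl s _ _ _ rfl h₁ h _ _) ?_
  have h₃ := characterUncurry_apply φ rfl s i (j + 1) i' hi h₂ h'
    (show (ModuleCat.restrictScalars φ).obj (A.X (j + 1)) from A.d j (j + 1) a) p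
  rcases Int.even_or_odd i with hi | hi
  · rw [Int.negOnePow_even i hi, one_smul, Units.val_one, Int.cast_one, one_smul]
    exact h₃
  · rw [Int.negOnePow_odd i hi, Units.neg_smul, one_smul, Units.val_neg, Units.val_one,
      Int.cast_neg, Int.cast_one, neg_smul, one_smul, map_neg (characterUncurry φ rfl s)]
    have h₄ : characterEval (A := restrict φ A) (s i i' p) (j + 1) h'
        ((restrict φ A).d j (j + 1) (-(show (restrict φ A).X j from a))) =
        -characterEval (A := restrict φ A) (s i i' p) (j + 1) h'
        ((restrict φ A).d j (j + 1) (show (restrict φ A).X j from a)) := by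
      rw [map_neg, map_neg]
    exact (congrArg Neg.neg h₃).trans h₄.symm

/-- K-projective complexes are K-flat. -/
theorem tensorComplex_acyclic (P : CochainComplex (ModuleCat.{u} R) ℤ) [P.IsKProjective]
    {A : CochainComplex (ModuleCat.{u} S) ℤ} (hA : A.Acyclic) :
    (tensorComplex φ P A).Acyclic := by
  apply acyclic_of_elements
  intro m n hmn z hz
  subst hmn
  -- A cycle `z` that is not a boundary is detected by a character `l` vanishing on boundaries. Such
  -- a character is a chain map from `P` to the character complex of `A`, which is acyclic. As `P`
  -- is K-projective, the chain map is null-homotopic, and this will force `l z = 0`.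
  by_contra! hne
  let B := LinearMap.range ((tensorComplex φ P A).d m (m + 1)).hom
  have hzB : (B.mkQ z : _ ⧸ B) ≠ 0 := fun h => by
    obtain ⟨w, hw⟩ := (Submodule.Quotient.mk_eq_zero B).1 h
    exact hne w hw
  obtain ⟨c, hc⟩ := CharacterModule.exists_character_apply_ne_zero_of_ne_zero hzB
  let l : CharacterModule ((tensorComplex φ P A).X (m + 1)) := c.comp B.mkQ.toAddMonoidHom
  have hl (w : (tensorComplex φ P A).X m) : l ((tensorComplex φ P A).d m (m + 1) w) = 0 := by
    change c (B.mkQ _) = 0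
    rw [show B.mkQ ((tensorComplex φ P A).d m (m + 1) w) = 0 from
      (Submodule.Quotient.mk_eq_zero B).2 ⟨w, rfl⟩, map_zero]
  let A' := restrict φ A
  have hA' : A'.Acyclic := by
    apply acyclic_of_elements
    intro m n hmn z hz
    subst hmn
    exact exact_elements hA m z hz
  let g : P ⟶ characterComplex A' (m + 1) :=
    { f i := ModuleCat.ofHom (LinearMap.pi fun j : {j // i + j = m + 1} =>
        tensorCharacter φ l i j j.2)
      comm' i i' hi := by
        obtain rfl : i + 1 = i' := hi
        apply ModuleCat.hom_ext
        refine LinearMap.ext fun p => characterComplex_ext fun j h a => ?_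
        have h₁ := characterComplex_d A' (m + 1) i (i + 1) (j + 1) j (by lia) h
          (show (characterComplex A' (m + 1)).X i from
            LinearMap.pi (fun j : {j // i + j = m + 1} => tensorCharacter φ l i j j.2) p) a
        refine h₁.trans ?_
        exact tensorCharacter_d φ rfl l hl i j h p a }
  obtain ⟨H⟩ := CochainComplex.IsKProjective.nonempty_homotopy_zero g
    (characterComplex_acyclic hA' (m + 1))
  -- The null-homotopy exhibits `l` as a map that factors through the differential out of degree `m
  -- + 1`. Maps out of the tensor product are constructed `S`-linearly, so `l` is replaced here by
  -- the corresponding `S`-linear map to the characters of `S`.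
  have hμd : characterUncurry φ rfl H.hom ∘ₗ ((tensorComplex φ P A).d (m + 1) (m + 1 + 1)).hom =
      characterLift l := by
    apply tensorComplex_character_ext
    intro i j h a p
    rw [characterLift_one]
    have h' : i - 1 + (j + 1) = m + 1 := by lia
    refine (characterUncurry_d φ rfl H.hom i (i - 1) j (j + 1) (by lia) rfl h h' a p).trans ?_
    have h₁ := H.comm i
    rw [dNext_eq H.hom (show (ComplexShape.up ℤ).Rel i (i + 1) from rfl),
      prevD_eq H.hom (show (ComplexShape.up ℤ).Rel (i - 1) i from by simp), zero_f, add_zero] at h₁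
    have h₂ := congrArg (fun t : P.X i ⟶ (characterComplex A' (m + 1)).X i =>
      characterEval (t p) j h a) h₁
    refine Eq.trans ?_ h₂.symm
    exact congrArg (characterEval (H.hom (i + 1) i (P.d i (i + 1) p)) j h a + ·)
      (characterComplex_d A' (m + 1) (i - 1) i (j + 1) j h' h _ a).symm
  apply hc
  have := congrArg (fun f => f z (1 : S)) hμd
  rw [characterLift_one] at this
  refine this.symm.trans ?_
  change characterUncurry φ rfl H.hom ((tensorComplex φ P A).d (m + 1) (m + 1 + 1) z) (1 : S) = 0
  rw [hz, map_zero]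
  rfl

end KFlat

/-! ### The homology sequence of a mapping cone -/

section ConeHomology
variable {S : Type u} [CommRing S]

open HomologicalComplex

/-- Construction of linear maps from homology. -/
noncomputable def homologyDesc (C : CochainComplex (ModuleCat.{u} S) ℤ) (n : ℤ) {X : Type u}
    [AddCommGroup X] [Module S X] (f : LinearMap.ker (C.d n (n + 1)).hom →ₗ[S] X)
    (hf : ∀ z, homologyClass C n z = 0 → f z = 0) : C.homology n →ₗ[S] X :=
  (LinearMap.ker (homologyClass C n)).liftQ f hf ∘ₗ
    ((homologyClass C n).quotKerEquivOfSurjective (homologyClass_surjective C n)).symm.toLinearMap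

lemma homologyDesc_class (C : CochainComplex (ModuleCat.{u} S) ℤ) (n : ℤ) {X : Type u}
    [AddCommGroup X] [Module S X] (f : LinearMap.ker (C.d n (n + 1)).hom →ₗ[S] X)
    (hf : ∀ z, homologyClass C n z = 0 → f z = 0) (z) :
    homologyDesc C n f hf (homologyClass C n z) = f z := by
  have : ((homologyClass C n).quotKerEquivOfSurjective (homologyClass_surjective C n)).symm
      (homologyClass C n z) = Submodule.Quotient.mk z := by
    rw [LinearEquiv.symm_apply_eq]; rfl
  rw [homologyDesc, LinearMap.comp_apply]
  exact (congrArg _ this).trans (Submodule.liftQ_apply _ _ _)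

variable {X Y : CochainComplex (ModuleCat.{u} S) ℤ} (g : X ⟶ Y)

/-- Elements of a mapping cone. -/
noncomputable def coneMk (n m : ℤ) (h : n + 1 = m) (x : X.X m) (y : Y.X n) :
    (CochainComplex.mappingCone g).X n :=
  coneInl g n m h x + coneInr g n y

@[simp] lemma coneFst_mk (n m : ℤ) (h : n + 1 = m) (x : X.X m) (y : Y.X n) :
    coneFst g n m h (coneMk g n m h x y) = x := by
  have h₁ := congrArg (fun f : X.X m ⟶ X.X m => f x) (coneInl_fst g n m h)
  have h₂ := congrArg (fun f : Y.X n ⟶ X.X m => f y) (coneInr_fst g n m h)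
  exact ((coneFst g n m h).hom.map_add _ _).trans ((congrArg₂ (· + ·) h₁ h₂).trans (add_zero x))

@[simp] lemma coneSnd_mk (n m : ℤ) (h : n + 1 = m) (x : X.X m) (y : Y.X n) :
    coneSnd g n (coneMk g n m h x y) = y := by
  have h₁ := congrArg (fun f : X.X m ⟶ Y.X n => f x) (coneInl_snd g n m h)
  have h₂ := congrArg (fun f : Y.X n ⟶ Y.X n => f y) (coneInr_snd g n)
  exact ((coneSnd g n).hom.map_add _ _).trans ((congrArg₂ (· + ·) h₁ h₂).trans (zero_add y))

lemma coneMk_fst_snd (n m : ℤ) (h : n + 1 = m) (v : (CochainComplex.mappingCone g).X n) :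
    coneMk g n m h (coneFst g n m h v) (coneSnd g n v) = v :=
  congrArg (fun f : (CochainComplex.mappingCone g).X n ⟶ _ => f v) (cone_total g n m h)

lemma exists_coneMk (n m : ℤ) (h : n + 1 = m) (v : (CochainComplex.mappingCone g).X n) :
    ∃ x y, v = coneMk g n m h x y := ⟨_, _, (coneMk_fst_snd g n m h v).symm⟩

lemma coneMk_inj (n m : ℤ) (h : n + 1 = m) {x x' : X.X m} {y y' : Y.X n} :
    coneMk g n m h x y = coneMk g n m h x' y' ↔ x = x' ∧ y = y' := by
  refine ⟨fun e => ⟨?_, ?_⟩, fun ⟨a, b⟩ => a ▸ b ▸ rfl⟩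
  · have := congrArg (coneFst g n m h) e
    rwa [coneFst_mk, coneFst_mk] at this
  · have := congrArg (coneSnd g n) e
    rwa [coneSnd_mk, coneSnd_mk] at this

lemma coneMk_zero (n m : ℤ) (h : n + 1 = m) : coneMk g n m h 0 0 = 0 := by
  rw [coneMk, map_zero, map_zero, add_zero]

lemma coneMk_eq_zero (n m : ℤ) (h : n + 1 = m) {x : X.X m} {y : Y.X n} :
    coneMk g n m h x y = 0 ↔ x = 0 ∧ y = 0 := by
  rw [← coneMk_zero g n m h, coneMk_inj]

lemma coneMk_d (n m k : ℤ) (h : n + 1 = m) (h' : m + 1 = k) (x : X.X m) (y : Y.X n) :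
    (CochainComplex.mappingCone g).d n m (coneMk g n m h x y) =
      coneMk g m k h' (-X.d m k x) (g.f m x + Y.d n m y) := by
  have h₁ := congrArg (fun f : X.X m ⟶ (CochainComplex.mappingCone g).X m => f x)
    (coneInl_d g n m k h h')
  have h₂ := congrArg (fun f : Y.X n ⟶ (CochainComplex.mappingCone g).X m => f y) (coneInr_d g n m)
  have h₁' : (CochainComplex.mappingCone g).d n m (coneInl g n m h x) =
    -coneInl g m k h' (X.d m k x) + coneInr g m (g.f m x) := h₁
  have h₂' : (CochainComplex.mappingCone g).d n m (coneInr g n y) = coneInr g m (Y.d n m y) := h₂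
  rw [coneMk, coneMk, map_add, h₁', h₂', map_neg, map_add, add_assoc]

lemma inr_f_apply (n m : ℤ) (h : n + 1 = m) (y : Y.X n) :
    (CochainComplex.mappingCone.inr g).f n y = coneMk g n m h 0 y := by
  rw [coneMk, map_zero, zero_add]
  rfl

lemma coneFst_d (n m k : ℤ) (h : n + 1 = m) (h' : m + 1 = k)
    (v : (CochainComplex.mappingCone g).X n) :
    coneFst g m k h' ((CochainComplex.mappingCone g).d n m v) = -X.d m k (coneFst g n m h v) := by
  obtain ⟨x, y, rfl⟩ := exists_coneMk g n m h v
  rw [coneMk_d g n m k h h', coneFst_mk, coneFst_mk]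

/-- The connecting map in the homology sequence of a mapping cone. -/
noncomputable def coneδ (n m : ℤ) (h : n + 1 = m) :
    (CochainComplex.mappingCone g).homology n →ₗ[S] X.homology m :=
  homologyDesc _ n (homologyClass X m ∘ₗ
    ((coneFst g n m h).hom ∘ₗ (LinearMap.ker ((CochainComplex.mappingCone g).d n (n + 1)).hom).subtype
      ).codRestrict (LinearMap.ker (X.d m (m + 1)).hom) (fun v => by
        subst h
        have := coneFst_d g n (n + 1) (n + 1 + 1) rfl rfl v.1
        rw [show (CochainComplex.mappingCone g).d n (n + 1) v.1 = 0 from v.2, map_zero,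
          eq_comm, neg_eq_zero] at this
        exact this)) (fun z hz => by
    obtain ⟨y, hy⟩ := (homologyClass_eq_zero_iff _ (n - 1) n (by lia) z).1 hz
    refine (homologyClass_eq_zero_iff _ n m h _).2 ⟨-coneFst g (n - 1) n (by lia) y, ?_⟩
    rw [map_neg, ← coneFst_d g (n - 1) n m (by lia) h, hy]
    rfl)

lemma coneδ_class (n m : ℤ) (h : n + 1 = m)
    (z : LinearMap.ker ((CochainComplex.mappingCone g).d n (n + 1)).hom)
    (x : LinearMap.ker (X.d m (m + 1)).hom) (hx : coneFst g n m h z.1 = x.1) :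
    coneδ g n m h (homologyClass _ n z) = homologyClass X m x := by
  refine (homologyDesc_class _ _ _ _ _).trans ?_
  exact congrArg (homologyClass X m) (Subtype.ext hx)

/-- A cycle of the cone is a pair `(x, y)` with `dx = 0` and `g x = -dy`. A cycle `x` thus extends
to a cycle of the cone precisely when `g x` is a boundary. -/
lemma range_coneδ (n m : ℤ) (h : n + 1 = m) : LinearMap.range (coneδ g n m h) =
    LinearMap.ker (HomologicalComplex.homologyMap g m).hom := by
  subst h
  ext v
  obtain ⟨x, rfl⟩ := homologyClass_surjective X (n + 1) v
  have hk : (HomologicalComplex.homologyMap g (n + 1)).hom (homologyClass X (n + 1) x) = 0 ↔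
      ∃ y, Y.d n (n + 1) y = g.f (n + 1) x.1 := by
    refine Iff.trans (Eq.congr_left (homologyMap_homologyClass g (n + 1) x (map_mem_ker g _ x))) ?_
    exact homologyClass_eq_zero_iff Y n (n + 1) rfl _
  rw [LinearMap.mem_ker, hk]
  constructor
  · rintro ⟨w, hw⟩
    obtain ⟨z, rfl⟩ := homologyClass_surjective _ n w
    obtain ⟨x', y', hz⟩ := exists_coneMk g n (n + 1) rfl z.1
    have hd := (congrArg ((CochainComplex.mappingCone g).d n (n + 1)) hz).symm.trans z.2
    rw [coneMk_d g n (n + 1) (n + 1 + 1) rfl rfl, coneMk_eq_zero, neg_eq_zero] at hd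
    rw [coneδ_class g n (n + 1) rfl z ⟨x', hd.1⟩ (by rw [hz, coneFst_mk]), ← sub_eq_zero, ← map_sub,
      homologyClass_eq_zero_iff X n (n + 1) rfl] at hw
    obtain ⟨u, hu⟩ := hw
    have hu' : X.d n (n + 1) u = x' - x.1 := hu
    refine ⟨-y' - g.f n u, ?_⟩
    have h₁ : g.f (n + 1) x.1 = g.f (n + 1) x' - g.f (n + 1) (X.d n (n + 1) u) := by
      rw [hu', map_sub, sub_sub_cancel]
    rw [h₁, hom_comm_apply, map_sub, map_neg, ← eq_neg_iff_add_eq_zero.2 hd.2]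
  · rintro ⟨y, hy⟩
    have hz : (CochainComplex.mappingCone g).d n (n + 1) (coneMk g n (n + 1) rfl x.1 (-y)) = 0 := by
      rw [coneMk_d g n (n + 1) (n + 1 + 1) rfl rfl, coneMk_eq_zero, neg_eq_zero, map_neg, hy]
      exact ⟨x.2, add_neg_cancel _⟩
    exact ⟨homologyClass _ n ⟨_, hz⟩, coneδ_class g n (n + 1) rfl _ x (coneFst_mk _ _ _ _ _ _)⟩

/-- If the first entry of a cycle `(x, y)` is a boundary `du`, adding the boundary of `(u, 0)` turns
it into `(0, y + g u)`, which comes from the target of `g`. -/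
lemma ker_coneδ (n m : ℤ) (h : n + 1 = m) : LinearMap.ker (coneδ g n m h) =
    LinearMap.range (HomologicalComplex.homologyMap (CochainComplex.mappingCone.inr g) n).hom := by
  subst h
  ext v
  obtain ⟨z, rfl⟩ := homologyClass_surjective _ n v
  obtain ⟨x, y, hz⟩ := exists_coneMk g n (n + 1) rfl z.1
  have hd := (congrArg ((CochainComplex.mappingCone g).d n (n + 1)) hz).symm.trans z.2
  rw [coneMk_d g n (n + 1) (n + 1 + 1) rfl rfl, coneMk_eq_zero, neg_eq_zero] at hd
  rw [LinearMap.mem_ker, coneδ_class g n (n + 1) rfl z ⟨x, hd.1⟩ (by rw [hz, coneFst_mk]),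
    homologyClass_eq_zero_iff X n (n + 1) rfl]
  constructor
  · rintro ⟨u, hu⟩
    have hu' : X.d n (n + 1) u = x := hu
    have hc : Y.d n (n + 1) (y + g.f n u) = 0 := by
      rw [map_add, ← hom_comm_apply, hu']; exact (add_comm _ _).trans hd.2
    refine ⟨homologyClass Y n ⟨_, hc⟩, ?_⟩
    refine (homologyMap_homologyClass (CochainComplex.mappingCone.inr g) n ⟨_, hc⟩
      (map_mem_ker _ _ ⟨_, hc⟩)).trans ?_
    rw [← sub_eq_zero, ← map_sub, homologyClass_eq_zero_iff _ (n - 1) n (by lia)]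
    refine ⟨coneMk g (n - 1) n (by lia) u 0, ?_⟩
    rw [coneMk_d g (n - 1) n (n + 1) (by lia) rfl, map_zero, add_zero, hu']
    refine Eq.trans ?_ (congrArg₂ (· - ·) (inr_f_apply g n (n + 1) rfl _).symm hz.symm)
    rw [coneMk, coneMk, coneMk, map_neg, map_zero, map_add]
    abel
  · rintro ⟨w, hw⟩
    obtain ⟨t, rfl⟩ := homologyClass_surjective Y n w
    have hw' := (homologyMap_homologyClass (CochainComplex.mappingCone.inr g) n t
      (map_mem_ker _ _ t)).symm.trans hw
    rw [← sub_eq_zero, ← map_sub, homologyClass_eq_zero_iff _ (n - 1) n (by lia)] at hw'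
    obtain ⟨q, hq⟩ := hw'
    obtain ⟨a, b, rfl⟩ := exists_coneMk g (n - 1) n (by lia) q
    have hq' := (coneMk_d g (n - 1) n (n + 1) (by lia) rfl a b).symm.trans hq
    have := congrArg (coneFst g n (n + 1) rfl) hq'
    refine ⟨a, ?_⟩
    rw [coneFst_mk] at this
    have e : coneFst g n (n + 1) rfl ((CochainComplex.mappingCone.inr g).f n t.1 - z.1) = -x := by
      rw [map_sub, inr_f_apply g n (n + 1) rfl, hz, coneFst_mk, coneFst_mk, zero_sub]
    exact neg_injective (this.trans e)

lemma ker_homologyMap_inr (n : ℤ) :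
    LinearMap.ker (HomologicalComplex.homologyMap (CochainComplex.mappingCone.inr g) n).hom =
      LinearMap.range (HomologicalComplex.homologyMap g n).hom := by
  ext v
  obtain ⟨y, rfl⟩ := homologyClass_surjective _ n v
  have hk : (HomologicalComplex.homologyMap (CochainComplex.mappingCone.inr g) n).hom
      (homologyClass Y n y) = 0 ↔ ∃ q, (CochainComplex.mappingCone g).d (n - 1) n q =
        coneMk g n (n + 1) rfl 0 y.1 := by
    refine Iff.trans (Eq.congr_left (homologyMap_homologyClass _ n y (map_mem_ker _ _ y))) ?_
    rw [homologyClass_eq_zero_iff _ (n - 1) n (by lia), ← inr_f_apply]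
  rw [LinearMap.mem_ker, hk]
  constructor
  · rintro ⟨q, hq⟩
    obtain ⟨a, b, rfl⟩ := exists_coneMk g (n - 1) n (by lia) q
    rw [coneMk_d g (n - 1) n (n + 1) (by lia) rfl, coneMk_inj, neg_eq_zero] at hq
    refine ⟨homologyClass X n ⟨a, hq.1⟩, ?_⟩
    refine (homologyMap_homologyClass g n ⟨a, hq.1⟩ (map_mem_ker _ _ ⟨a, hq.1⟩)).trans ?_
    rw [← sub_eq_zero, ← map_sub, homologyClass_eq_zero_iff _ (n - 1) n (by lia)]
    refine ⟨-b, ?_⟩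
    rw [map_neg, neg_eq_iff_eq_neg]
    change Y.d (n - 1) n b = -(g.f n a - y.1)
    rw [← hq.2]
    abel
  · rintro ⟨w, hw⟩
    obtain ⟨x, rfl⟩ := homologyClass_surjective X n w
    have hw' := (homologyMap_homologyClass g n x (map_mem_ker _ _ x)).symm.trans hw
    rw [← sub_eq_zero, ← map_sub, homologyClass_eq_zero_iff _ (n - 1) n (by lia)] at hw'
    obtain ⟨b, hb⟩ := hw'
    have hb' : Y.d (n - 1) n b = g.f n x.1 - y.1 := hb
    refine ⟨coneMk g (n - 1) n (by lia) x.1 (-b), ?_⟩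
    rw [coneMk_d g (n - 1) n (n + 1) (by lia) rfl, coneMk_inj, neg_eq_zero, map_neg, hb']
    exact ⟨x.2, by abel⟩

/-- Exactness of the homology sequence: the homology of the cone is squeezed between cokernels and
kernels of the maps induced by `g`. -/
lemma acyclic_cone_iff : (CochainComplex.mappingCone g).Acyclic ↔ QuasiIso g := by
  rw [acyclic_iff_subsingleton]
  constructor
  · intro h
    rw [quasiIso_iff]
    intro n
    rw [quasiIsoAt_iff_isIso_homologyMap, ConcreteCategory.isIso_iff_bijective]
    have h₁ := h n
    have h₂ := h (n - 1)
    constructor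
    · change Function.Injective (HomologicalComplex.homologyMap g n).hom
      rw [← LinearMap.ker_eq_bot]
      rw [← range_coneδ g (n - 1) n (by lia), LinearMap.range_eq_bot]
      exact Subsingleton.elim _ _
    · change Function.Surjective (HomologicalComplex.homologyMap g n).hom
      rw [← LinearMap.range_eq_top]
      rw [← ker_homologyMap_inr, LinearMap.ker_eq_top]
      exact Subsingleton.elim _ _
  · intro h n
    have hb (m : ℤ) : Function.Bijective (HomologicalComplex.homologyMap g m).hom :=
      (ConcreteCategory.isIso_iff_bijective (HomologicalComplex.homologyMap g m)).1 inferInstance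
    have h₁ : LinearMap.range (coneδ g n (n + 1) rfl) = ⊥ := by
      rw [range_coneδ]; exact LinearMap.ker_eq_bot.2 (hb (n + 1)).1
    have h₂ : LinearMap.ker (coneδ g n (n + 1) rfl) = ⊤ :=
      LinearMap.ker_eq_top.2 (LinearMap.range_eq_bot.1 h₁)
    have h₃ : LinearMap.ker (HomologicalComplex.homologyMap
        (CochainComplex.mappingCone.inr g) n).hom = ⊤ := by
      rw [ker_homologyMap_inr]; exact LinearMap.range_eq_top.2 (hb n).2
    rw [ker_coneδ, LinearMap.ker_eq_top.1 h₃, LinearMap.range_zero] at h₂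
    exact (Submodule.subsingleton_iff S).1 (subsingleton_of_bot_eq_top h₂)

/-- The length of the homology of the cone of a morphism that induces zero in homology. -/
lemma length_homology_cone (n m : ℤ) (h : n + 1 = m)
    (h₁ : HomologicalComplex.homologyMap g n = 0) (h₂ : HomologicalComplex.homologyMap g m = 0) :
    Module.length S ((CochainComplex.mappingCone g).homology n) =
      Module.length S (Y.homology n) + Module.length S (X.homology m) := by
  refine Module.length_eq_add_of_exact
    (HomologicalComplex.homologyMap (CochainComplex.mappingCone.inr g) n).hom (coneδ g n m h) ?_ ?_ ?_
  · rw [← LinearMap.ker_eq_bot, ker_homologyMap_inr, h₁]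
    exact LinearMap.range_zero
  · rw [← LinearMap.range_eq_top, range_coneδ, h₂]
    exact LinearMap.ker_zero
  · exact LinearMap.exact_iff.2 (ker_coneδ g n m h)

end ConeHomology

/-! ### Tensor products with K-projective complexes and quasi-isomorphisms -/

section TensorQuasiIso
variable {R S : Type u} [CommRing R] [CommRing S] (φ : R →+* S)

/-- The morphism of tensor products of complexes induced by morphisms of complexes. -/
noncomputable abbrev tensorComplexMap {P P' : CochainComplex (ModuleCat.{u} R) ℤ}
    {N N' : CochainComplex (ModuleCat.{u} S) ℤ} (f : P ⟶ P') (g : N ⟶ N') :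
    tensorComplex φ P N ⟶ tensorComplex φ P' N' :=
  totalMap (tensorFunctor φ) f g

lemma acyclic_of_iso {C D : CochainComplex (ModuleCat.{u} S) ℤ} (e : C ≅ D) (h : C.Acyclic) :
    D.Acyclic := fun i => (h i).of_iso e

/-- Tensor products with K-projective complexes preserve quasi-isomorphisms. -/
lemma quasiIso_tensorComplexMap (P : CochainComplex (ModuleCat.{u} R) ℤ) [P.IsKProjective]
    {N N' : CochainComplex (ModuleCat.{u} S) ℤ} (g : N ⟶ N') [QuasiIso g] :
    QuasiIso (tensorComplexMap φ (𝟙 P) g) := by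
  rw [← acyclic_cone_iff]
  exact acyclic_of_iso (coneTotalIso₂ (tensorFunctor φ) P g).symm
    (tensorComplex_acyclic φ P ((acyclic_cone_iff g).2 inferInstance))

end TensorQuasiIso

/-! ### Koszul complexes as iterated cones, and null-homotopic multiplications -/

section IteratedKoszul
variable {S : Type u} [CommRing S]

open HomologicalComplex

/-- The components of a mapping cone are direct sums. -/
noncomputable def coneEquiv {X Y : CochainComplex (ModuleCat.{u} S) ℤ} (g : X ⟶ Y) (n m : ℤ)
    (h : n + 1 = m) : (X.X m × Y.X n) ≃ₗ[S] (CochainComplex.mappingCone g).X n where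
  toFun v := coneMk g n m h v.1 v.2
  map_add' v w := by
    simp only [coneMk, Prod.fst_add, Prod.snd_add, map_add]
    abel
  map_smul' s v := by
    simp only [coneMk, Prod.smul_fst, Prod.smul_snd, map_smul, smul_add, RingHom.id_apply]
  invFun v := (coneFst g n m h v, coneSnd g n v)
  left_inv v := by simp
  right_inv v := coneMk_fst_snd g n m h v

/-- The iterated mapping cone of multiplications on a complex. -/
noncomputable def iteratedKoszul :
    List S → CochainComplex (ModuleCat.{u} S) ℤ → CochainComplex (ModuleCat.{u} S) ℤ
  | [], N => N
  | x :: xs, N => CochainComplex.mappingCone (x • 𝟙 (iteratedKoszul xs N))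

lemma koszul_eq_iteratedKoszul (xs : List S) :
    koszul xs = iteratedKoszul xs (complexOfModule (ModuleCat.of S S)) := by
  induction xs with
  | nil => rfl
  | cons x xs ih =>
    exact congrArg (fun C : CochainComplex (ModuleCat.{u} S) ℤ =>
      CochainComplex.mappingCone (x • 𝟙 C)) ih

lemma iteratedKoszul_append (xs ys : List S) (N : CochainComplex (ModuleCat.{u} S) ℤ) :
    iteratedKoszul (xs ++ ys) N = iteratedKoszul xs (iteratedKoszul ys N) := by
  induction xs with
  | nil => rfl
  | cons x xs ih =>
    exact congrArg (fun C : CochainComplex (ModuleCat.{u} S) ℤ =>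
      CochainComplex.mappingCone (x • 𝟙 C)) ih

lemma subsingleton_koszul_X (xs : List S) (n : ℤ) (hn : 0 < n ∨ n < -(xs.length : ℤ)) :
    Subsingleton ((koszul xs).X n) := by
  induction xs generalizing n with
  | nil =>
    refine ModuleCat.isZero_iff_subsingleton.1 (isZero_single_obj_X _ _ _ _ ?_)
    simp only [List.length_nil, Nat.cast_zero, neg_zero] at hn
    lia
  | cons x xs ih =>
    rw [List.length_cons, Nat.cast_add, Nat.cast_one] at hn
    have h₁ := ih (n + 1) (by lia)
    have h₂ := ih n (by lia)
    exact (coneEquiv (x • 𝟙 (koszul xs)) n (n + 1) rfl).symm.toEquiv.subsingleton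

lemma finite_koszul_X (xs : List S) (n : ℤ) : Module.Finite S ((koszul xs).X n) := by
  induction xs generalizing n with
  | nil =>
    by_cases hn : n = 0
    · exact Module.Finite.equiv (singleObjXIsoOfEq (ComplexShape.up ℤ) 0
        (ModuleCat.of S S) n hn).symm.toLinearEquiv
    · have := subsingleton_koszul_X ([] : List S) n (by simp; lia)
      infer_instance
  | cons x xs ih =>
    have h₁ := ih (n + 1)
    have h₂ := ih n
    exact Module.Finite.equiv (coneEquiv (x • 𝟙 (koszul xs)) n (n + 1) rfl)

lemma projective_koszul_X (xs : List S) (n : ℤ) : Module.Projective S ((koszul xs).X n) := by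
  induction xs generalizing n with
  | nil =>
    by_cases hn : n = 0
    · exact Module.Projective.of_equiv (singleObjXIsoOfEq (ComplexShape.up ℤ) 0
        (ModuleCat.of S S) n hn).symm.toLinearEquiv
    · have := subsingleton_koszul_X ([] : List S) n (by simp; lia)
      infer_instance
  | cons x xs ih =>
    have h₁ := ih (n + 1)
    have h₂ := ih n
    exact Module.Projective.of_equiv (coneEquiv (x • 𝟙 (koszul xs)) n (n + 1) rfl)

/-- A bounded above complex of projective modules is K-projective. Isomorphisms in the derived
category out of a Koszul complex are therefore represented by quasi-isomorphisms without resolving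
it first. -/
instance (xs : List S) : (koszul xs).IsKProjective := by
  have : (koszul xs).IsStrictlyLE 0 := by
    rw [CochainComplex.isStrictlyLE_iff]
    exact fun i hi => ModuleCat.isZero_iff_subsingleton.2 (subsingleton_koszul_X xs i (Or.inl hi))
  have (n : ℤ) : Projective ((koszul xs).X n) := by
    have := projective_koszul_X xs n
    exact ModuleCat.projective_of_categoryTheory_projective _
  exact CochainComplex.isKProjective_of_projective _ 0

/-- A homotopy to zero from a family of linear maps. -/
lemma nonempty_homotopy_zero_of_elements {C D : CochainComplex (ModuleCat.{u} S) ℤ} (f : C ⟶ D)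
    (H : ∀ n m : ℤ, m + 1 = n → (C.X n →ₗ[S] D.X m))
    (hH : ∀ (m n k : ℤ) (h : m + 1 = n) (h' : n + 1 = k) (x : C.X n),
      f.f n x = H k n h' (C.d n k x) + D.d m n (H n m h x)) : Nonempty (Homotopy f 0) := by
  classical
  refine ⟨{ hom := fun i j => if h : j + 1 = i then ModuleCat.ofHom (H i j h) else 0
            zero := fun i j h => dif_neg h
            comm := fun n => ?_ }⟩
  rw [dNext_eq _ (show (ComplexShape.up ℤ).Rel n (n + 1) from rfl),
    prevD_eq _ (show (ComplexShape.up ℤ).Rel (n - 1) n from by simp), zero_f, add_zero,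
    dif_pos rfl, dif_pos (by lia)]
  ext x
  exact hH (n - 1) n (n + 1) (by lia) rfl x

lemma homotopy_zero_elements {C D : CochainComplex (ModuleCat.{u} S) ℤ} {f : C ⟶ D}
    (H : Homotopy f 0) (m n k : ℤ) (h : m + 1 = n) (h' : n + 1 = k) (x : C.X n) :
      f.f n x = H.hom k n (C.d n k x) + D.d m n (H.hom n m x) := by
  have := H.comm n
  rw [dNext_eq _ (show (ComplexShape.up ℤ).Rel n k from h'),
    prevD_eq _ (show (ComplexShape.up ℤ).Rel m n from h), zero_f, add_zero] at this
  exact congrArg (fun g : C.X n ⟶ D.X n => g x) this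

/-- The ideal of those elements that act as zero on a complex, up to homotopy. -/
def nullIdeal (N : CochainComplex (ModuleCat.{u} S) ℤ) : Ideal S where
  carrier := {s | Nonempty (Homotopy (s • 𝟙 N) 0)}
  zero_mem' := ⟨Homotopy.ofEq (zero_smul _ _)⟩
  add_mem' := by
    rintro s t ⟨h⟩ ⟨h'⟩
    exact ⟨(Homotopy.ofEq (add_smul _ _ _)).trans ((h.add h').trans (.ofEq (add_zero 0)))⟩
  smul_mem' := by
    rintro s t ⟨h⟩
    exact ⟨(Homotopy.ofEq (mul_smul _ _ _)).trans ((h.smul s).trans (.ofEq (smul_zero s)))⟩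

/-- The null-homotopy sends `(a, b)` to `(b, 0)`. -/
lemma mem_nullIdeal_cone (x : S) (N : CochainComplex (ModuleCat.{u} S) ℤ) :
    x ∈ nullIdeal (CochainComplex.mappingCone (x • 𝟙 N)) := by
  refine nonempty_homotopy_zero_of_elements _ (fun n m h =>
    (coneEquiv (x • 𝟙 N) m n h).toLinearMap ∘ₗ LinearMap.inl S _ _ ∘ₗ (coneSnd (x • 𝟙 N) n).hom) ?_
  intro m n k h h' v
  obtain ⟨a, b, rfl⟩ := exists_coneMk (x • 𝟙 N) n k h' v
  change x • coneMk (x • 𝟙 N) n k h' a b = coneMk (x • 𝟙 N) n k h' (coneSnd (x • 𝟙 N) k _) 0 +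
    (CochainComplex.mappingCone (x • 𝟙 N)).d m n (coneMk (x • 𝟙 N) m n h
      (coneSnd (x • 𝟙 N) n (coneMk (x • 𝟙 N) n k h' a b)) 0)
  rw [coneMk_d (x • 𝟙 N) n k (k + 1) h' rfl, coneSnd_mk, coneSnd_mk, coneMk_d (x • 𝟙 N) m n k h h',
    smul_hom_f_apply, smul_hom_f_apply, map_zero, add_zero]
  simp only [coneMk, map_add, map_zero, map_neg, map_smul, smul_add]
  abel

/-- A null-homotopy `H` on `N` induces `(a, b) ↦ (-H a, H b)` on the cone; the sign compensates for
that of the differential on the shifted summand. The off-diagonal terms cancel because `H` commutes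
with `x`. -/
lemma nullIdeal_le_cone (x : S) (N : CochainComplex (ModuleCat.{u} S) ℤ) :
    nullIdeal N ≤ nullIdeal (CochainComplex.mappingCone (x • 𝟙 N)) := by
  rintro s ⟨H⟩
  refine nonempty_homotopy_zero_of_elements _ (fun n m h =>
    (coneEquiv (x • 𝟙 N) m n h).toLinearMap ∘ₗ (LinearMap.prodMap (-(H.hom (n + 1) n).hom)
      (H.hom n m).hom) ∘ₗ (coneEquiv (x • 𝟙 N) n (n + 1) rfl).symm.toLinearMap) ?_
  intro m n k h h' v
  subst h'
  obtain ⟨a, b, rfl⟩ := exists_coneMk (x • 𝟙 N) n (n + 1) rfl v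
  have h₁ := homotopy_zero_elements H n (n + 1) (n + 1 + 1) rfl rfl a
  have h₂ := homotopy_zero_elements H m n (n + 1) h rfl b
  rw [smul_hom_f_apply] at h₁ h₂
  change s • coneMk (x • 𝟙 N) n (n + 1) rfl a b = coneMk (x • 𝟙 N) n (n + 1) rfl
    (-(H.hom (n + 1 + 1) (n + 1) (coneFst (x • 𝟙 N) (n + 1) (n + 1 + 1) rfl _)))
    (H.hom (n + 1) n (coneSnd (x • 𝟙 N) (n + 1) _)) +
    (CochainComplex.mappingCone (x • 𝟙 N)).d m n (coneMk (x • 𝟙 N) m n h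
      (-(H.hom (n + 1) n (coneFst (x • 𝟙 N) n (n + 1) rfl (coneMk (x • 𝟙 N) n (n + 1) rfl a b))))
      (H.hom n m (coneSnd (x • 𝟙 N) n (coneMk (x • 𝟙 N) n (n + 1) rfl a b))))
  rw [coneMk_d (x • 𝟙 N) n (n + 1) (n + 1 + 1) rfl rfl, coneSnd_mk, coneSnd_mk, coneFst_mk,
    coneFst_mk, coneMk_d (x • 𝟙 N) m n (n + 1) h rfl, smul_hom_f_apply, smul_hom_f_apply]
  have e₁ : s • coneMk (x • 𝟙 N) n (n + 1) rfl a b =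
    coneMk (x • 𝟙 N) n (n + 1) rfl (s • a) (s • b) := by simp only [coneMk, map_smul, smul_add]
  rw [e₁, h₁, h₂]
  simp only [coneMk, map_add, map_neg, map_smul, smul_neg, neg_neg]
  abel

/-- Each element of the list acquires a null-homotopy when its own cone is formed, and the later
cones preserve it. This is why ideals annihilate the homology of Koszul complexes on their
generators. -/
lemma ofList_le_nullIdeal (xs : List S) (N : CochainComplex (ModuleCat.{u} S) ℤ) :
    Ideal.ofList xs ≤ nullIdeal (iteratedKoszul xs N) := by
  induction xs with
  | nil => rw [Ideal.ofList_nil]; exact bot_le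
  | cons x xs ih =>
    rw [Ideal.ofList_cons, sup_le_iff, Ideal.span_singleton_le_iff_mem]
    exact ⟨mem_nullIdeal_cone x _, ih.trans (nullIdeal_le_cone x _)⟩

/-- Elements which are homotopic to zero annihilate homology. -/
lemma smul_homology_eq_zero {N : CochainComplex (ModuleCat.{u} S) ℤ} {s : S} (hs : s ∈ nullIdeal N)
    (n : ℤ) (v : N.homology n) : s • v = 0 := by
  obtain ⟨H⟩ := hs
  obtain ⟨z, rfl⟩ := homologyClass_surjective N n v
  rw [← map_smul, homologyClass_eq_zero_iff N (n - 1) n (by lia)]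
  refine ⟨H.hom n (n - 1) z.1, ?_⟩
  have := homotopy_zero_elements H (n - 1) n (n + 1) (by lia) rfl z.1
  rw [show N.d n (n + 1) z.1 = 0 from z.2, map_zero, zero_add] at this
  exact this.symm

/-- Iterated cones of isomorphic complexes are isomorphic. -/
noncomputable def iteratedKoszulIso {N N' : CochainComplex (ModuleCat.{u} S) ℤ} (e : N ≅ N') :
    ∀ xs : List S, iteratedKoszul xs N ≅ iteratedKoszul xs N'
  | [] => e
  | x :: xs => coneIsoOfIso _ _ (iteratedKoszulIso e xs) (iteratedKoszulIso e xs) (by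
      rw [Linear.comp_smul, Linear.smul_comp, Category.comp_id, Category.id_comp])

end IteratedKoszul

/-! ### Tensor products with Koszul complexes are iterated cones -/

section TotalKoszul
variable {R S T : Type u} [CommRing R] [CommRing S] [CommRing T]

open HomologicalComplex

/-- Bifunctors which are linear in the first variable, elementwise. -/
lemma totalMap_smul_left (F : ModuleCat.{u} S ⥤ ModuleCat.{u} R ⥤ ModuleCat.{u} S) [F.Additive]
    [∀ X, (F.obj X).Additive]
    (hF : ∀ (s : S) (A : ModuleCat.{u} S) (B : ModuleCat.{u} R), (F.map (s • 𝟙 A)).app B = s • 𝟙 _)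
    (s : S) (K : CochainComplex (ModuleCat.{u} S) ℤ) (M : CochainComplex (ModuleCat.{u} R) ℤ) :
    totalMap F (s • 𝟙 K) (𝟙 M) = s • 𝟙 (total F K M) := by
  ext n : 1
  apply mapBifunctor.hom_ext
  intro i j h
  refine (ι_mapBifunctorMap _ _ _ _ _ _ _ _).trans ?_
  have h₁ : (F.map ((s • 𝟙 K : K ⟶ K).f i)).app (M.X j) = s • 𝟙 _ := hF s _ _
  have h₂ : (s • 𝟙 (total F K M) : total F K M ⟶ total F K M).f n = s • 𝟙 _ := rfl
  rw [h₁, h₂, HomologicalComplex.id_f, CategoryTheory.Functor.map_id, Category.id_comp, Linear.smul_comp, Linear.comp_smul,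
    Category.id_comp]
  exact congrArg (s • ·) (Category.comp_id _).symm

lemma totalMap_smul_right (F : ModuleCat.{u} R ⥤ ModuleCat.{u} S ⥤ ModuleCat.{u} S) [F.Additive]
    [∀ X, (F.obj X).Additive]
    (hF : ∀ (s : S) (A : ModuleCat.{u} R) (B : ModuleCat.{u} S), (F.obj A).map (s • 𝟙 B) = s • 𝟙 _)
    (s : S) (K : CochainComplex (ModuleCat.{u} R) ℤ) (M : CochainComplex (ModuleCat.{u} S) ℤ) :
    totalMap F (𝟙 K) (s • 𝟙 M) = s • 𝟙 (total F K M) := by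
  ext n : 1
  apply mapBifunctor.hom_ext
  intro i j h
  refine (ι_mapBifunctorMap _ _ _ _ _ _ _ _).trans ?_
  have h₁ : (F.obj (K.X i)).map ((s • 𝟙 M : M ⟶ M).f j) = s • 𝟙 _ := hF s _ _
  have h₂ : (s • 𝟙 (total F K M) : total F K M ⟶ total F K M).f n = s • 𝟙 _ := rfl
  rw [h₁, h₂, HomologicalComplex.id_f, CategoryTheory.Functor.map_id, NatTrans.id_app, Category.id_comp, Linear.smul_comp,
    Linear.comp_smul, Category.id_comp]
  exact congrArg (s • ·) (Category.comp_id _).symm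

/-- Iterated cones commute with tensor products, in the first variable. -/
noncomputable def iteratedKoszulTotalIso
    (F : ModuleCat.{u} S ⥤ ModuleCat.{u} R ⥤ ModuleCat.{u} S) [F.Additive]
    [∀ X, (F.obj X).Additive]
    (hF : ∀ (s : S) (A : ModuleCat.{u} S) (B : ModuleCat.{u} R), (F.map (s • 𝟙 A)).app B = s • 𝟙 _)
    (K : CochainComplex (ModuleCat.{u} S) ℤ) (M : CochainComplex (ModuleCat.{u} R) ℤ) :
    ∀ xs : List S, iteratedKoszul xs (total F K M) ≅ total F (iteratedKoszul xs K) M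
  | [] => Iso.refl _
  | x :: xs => coneIsoOfIso _ _ (iteratedKoszulTotalIso F hF K M xs)
      (iteratedKoszulTotalIso F hF K M xs) (by
        rw [totalMap_smul_left F hF, Linear.comp_smul, Linear.smul_comp, Category.comp_id,
          Category.id_comp]) ≪≫
      coneTotalIso F (x • 𝟙 (iteratedKoszul xs K)) M

/-- Iterated cones commute with tensor products, in the second variable. -/
noncomputable def iteratedKoszulTotalIso₂
    (F : ModuleCat.{u} R ⥤ ModuleCat.{u} S ⥤ ModuleCat.{u} S) [F.Additive]
    [∀ X, (F.obj X).Additive]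
    (hF : ∀ (s : S) (A : ModuleCat.{u} R) (B : ModuleCat.{u} S), (F.obj A).map (s • 𝟙 B) = s • 𝟙 _)
    (K : CochainComplex (ModuleCat.{u} R) ℤ) (M : CochainComplex (ModuleCat.{u} S) ℤ) :
    ∀ xs : List S, iteratedKoszul xs (total F K M) ≅ total F K (iteratedKoszul xs M)
  | [] => Iso.refl _
  | x :: xs => coneIsoOfIso _ _ (iteratedKoszulTotalIso₂ F hF K M xs)
      (iteratedKoszulTotalIso₂ F hF K M xs) (by
        rw [totalMap_smul_right F hF, Linear.comp_smul, Linear.smul_comp, Category.comp_id,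
          Category.id_comp]) ≪≫
      coneTotalIso₂ F K (x • 𝟙 (iteratedKoszul xs M))

lemma tensorFunctor_map_smul (φ : R →+* S) (s : S) (A : ModuleCat.{u} R) (B : ModuleCat.{u} S) :
    ((tensorFunctor φ).obj A).map (s • 𝟙 B) = s • 𝟙 _ :=
  ModuleCat.hom_ext (tensorMap_ext φ fun _ _ => rfl)

lemma tensorFunctor_id_map_smul (s : S) (A B : ModuleCat.{u} S) :
    ((tensorFunctor (RingHom.id S)).map (s • 𝟙 A)).app B = s • 𝟙 _ :=
  ModuleCat.hom_ext (tensorMap_ext (RingHom.id S) fun b a =>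
    (TensorProduct.tmul_smul s b a))

lemma curriedTensor_map_smul (s : S) (A B : ModuleCat.{u} S) :
    ((MonoidalCategory.curriedTensor (ModuleCat.{u} S)).map (s • 𝟙 A)).app B = s • 𝟙 _ :=
  ModuleCat.hom_ext (TensorProduct.ext' fun a b => TensorProduct.smul_tmul' s a b)

/-- The tensor product with the ring, viewed as a complex, is the identity. -/
noncomputable def totalUnitIso (F : ModuleCat.{u} R ⥤ ModuleCat.{u} S ⥤ ModuleCat.{u} S)
    [F.Additive] [∀ X, (F.obj X).Additive] (A : ModuleCat.{u} R)
    (e : F.obj A ≅ 𝟭 _) (M : CochainComplex (ModuleCat.{u} S) ℤ) :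
    total F (complexOfModule A) M ≅ M :=
  (singleTotalIso F A M).symm ≪≫ (NatIso.mapHomologicalComplex e (ComplexShape.up ℤ)).app M ≪≫
    (Functor.mapHomologicalComplexIdIso (ModuleCat.{u} S) (ComplexShape.up ℤ)).app M

/-- The tensor product of the ring, viewed as an `R`-module, with a module. -/
noncomputable def tensorFunctorUnitIso (φ : R →+* S) :
    (tensorFunctor φ).obj (ModuleCat.of R R) ≅ 𝟭 _ :=
  NatIso.ofComponents (fun N => LinearEquiv.toModuleIso
    { toFun := TensorProduct.rid R ((ModuleCat.restrictScalars φ).obj N)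
      map_add' := map_add _
      map_smul' := fun s x => by
        induction x using TensorProduct.induction_on with
        | zero => rw [smul_zero, map_zero]; exact (smul_zero (A := N) s).symm
        | tmul n r =>
          exact smul_comm (N := S) (α := (ModuleCat.restrictScalars φ).obj N) r s n
        | add x y hx hy =>
          rw [smul_add, map_add, hx, hy, map_add]; exact (smul_add s _ _).symm
      invFun := (TensorProduct.rid R ((ModuleCat.restrictScalars φ).obj N)).symm
      left_inv := (TensorProduct.rid R ((ModuleCat.restrictScalars φ).obj N)).left_inv
      right_inv := (TensorProduct.rid R ((ModuleCat.restrictScalars φ).obj N)).right_inv })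
    (fun g => ModuleCat.hom_ext (tensorMap_ext φ fun n r =>
      (((ModuleCat.restrictScalars φ).map g).hom.map_smul r n).symm))

/-- The Koszul complex with coefficients in a complex is an iterated mapping cone. -/
noncomputable def koszulOnIso (xs : List S) (M : CochainComplex (ModuleCat.{u} S) ℤ) :
    koszulOn xs M ≅ iteratedKoszul xs M :=
  eqToIso (congrArg (fun K => total (MonoidalCategory.curriedTensor (ModuleCat.{u} S)) K M)
    (koszul_eq_iteratedKoszul xs)) ≪≫
  (iteratedKoszulTotalIso (MonoidalCategory.curriedTensor (ModuleCat.{u} S)) curriedTensor_map_smul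
    (complexOfModule (ModuleCat.of S S)) M xs).symm ≪≫
  iteratedKoszulIso (totalUnitIso _ (ModuleCat.of S S)
    (MonoidalCategory.leftUnitorNatIso (ModuleCat.{u} S)) M) xs

/-- The tensor product of the Koszul complex with a complex is an iterated mapping cone. -/
noncomputable def tensorKoszulIso (xs : List S) (M : CochainComplex (ModuleCat.{u} S) ℤ) :
    tensorComplex (RingHom.id S) (koszul xs) M ≅ iteratedKoszul xs M :=
  eqToIso (congrArg (fun K => total (tensorFunctor (RingHom.id S)) K M)
    (koszul_eq_iteratedKoszul xs)) ≪≫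
  (iteratedKoszulTotalIso (tensorFunctor (RingHom.id S)) tensorFunctor_id_map_smul
    (complexOfModule (ModuleCat.of S S)) M xs).symm ≪≫
  iteratedKoszulIso (totalUnitIso _ (ModuleCat.of S S) (tensorFunctorUnitIso _) M) xs

/-- The tensor product over the ring of a module with the ring. -/
noncomputable def tensorFunctorFlipUnitIso :
    (tensorFunctor (RingHom.id S)).flip.obj (ModuleCat.of S S) ≅ 𝟭 _ :=
  NatIso.ofComponents (fun N => LinearEquiv.toModuleIso
    (X₁ := TensorProduct S S N) (TensorProduct.lid S N))
    (fun g => ModuleCat.hom_ext (tensorMap_ext (RingHom.id S) fun n r =>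
      (g.hom.map_smul n r).symm))

/-- The tensor product of a complex with the Koszul complex is an iterated mapping cone. -/
noncomputable def tensorKoszulIso₂ (xs : List S) (M : CochainComplex (ModuleCat.{u} S) ℤ) :
    tensorComplex (RingHom.id S) M (koszul xs) ≅ iteratedKoszul xs M :=
  eqToIso (congrArg (fun K => total (tensorFunctor (RingHom.id S)) M K)
    (koszul_eq_iteratedKoszul xs)) ≪≫
  (iteratedKoszulTotalIso₂ (tensorFunctor (RingHom.id S)) (tensorFunctor_map_smul _)
    M (complexOfModule (ModuleCat.of S S)) xs).symm ≪≫
  iteratedKoszulIso ((mapBifunctorFlipIso M (complexOfModule (ModuleCat.of S S))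
    (tensorFunctor (RingHom.id S)) (ComplexShape.up ℤ)).symm ≪≫
    totalUnitIso (tensorFunctor (RingHom.id S)).flip (ModuleCat.of S S)
      tensorFunctorFlipUnitIso M) xs

/-- Iterated cones commute with tensor products of complexes. -/
noncomputable def tensorComplexIteratedKoszulIso (φ : R →+* S)
    (P : CochainComplex (ModuleCat.{u} R) ℤ) (N : CochainComplex (ModuleCat.{u} S) ℤ)
    (xs : List S) :
    iteratedKoszul xs (tensorComplex φ P N) ≅ tensorComplex φ P (iteratedKoszul xs N) :=
  iteratedKoszulTotalIso₂ (tensorFunctor φ) (tensorFunctor_map_smul φ) P N xs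

/-- Iterated cones commute with each other. -/
noncomputable def iteratedKoszulComm (xs ys : List S) (N : CochainComplex (ModuleCat.{u} S) ℤ) :
    iteratedKoszul xs (iteratedKoszul ys N) ≅ iteratedKoszul ys (iteratedKoszul xs N) :=
  -- Realize the cones on `xs` by a tensor factor in the first variable. Those on `ys` are then
  -- formed in the second variable, and can be pulled out.
  (tensorKoszulIso xs _).symm ≪≫
  (tensorComplexIteratedKoszulIso (RingHom.id S) (koszul xs) N ys).symm ≪≫
  iteratedKoszulIso (tensorKoszulIso xs N) ys

end TotalKoszul

/-! ### Quotients by acyclic subcomplexes -/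

section QuotientComplexes
variable {S : Type u} [CommRing S]

/-- The quotient of a complex by a family of submodules which is stable under the differential. -/
noncomputable def quotientComplex (C : CochainComplex (ModuleCat.{u} S) ℤ)
    (U : ∀ n, Submodule S (C.X n)) (hU : ∀ i j, U i ≤ (U j).comap (C.d i j).hom) :
    CochainComplex (ModuleCat.{u} S) ℤ where
  X n := ModuleCat.of S (C.X n ⧸ U n)
  d i j := ModuleCat.ofHom ((U i).mapQ (U j) (C.d i j).hom (hU i j))
  shape i j h := by
    apply ModuleCat.hom_ext
    refine Submodule.linearMap_qext _ (LinearMap.ext fun x => ?_)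
    change (U j).mkQ (C.d i j x) = 0
    rw [C.shape i j h]
    exact map_zero _
  d_comp_d' i j k _ _ := by
    apply ModuleCat.hom_ext
    refine Submodule.linearMap_qext _ (LinearMap.ext fun x => ?_)
    change (U k).mkQ (C.d j k (C.d i j x)) = 0
    rw [d_d_apply, map_zero]

/-- The projection to a quotient complex. -/
noncomputable def quotientComplexHom (C : CochainComplex (ModuleCat.{u} S) ℤ)
    (U : ∀ n, Submodule S (C.X n)) (hU : ∀ i j, U i ≤ (U j).comap (C.d i j).hom) :
    C ⟶ quotientComplex C U hU where
  f n := ModuleCat.ofHom (U n).mkQ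
  comm' _ _ _ := rfl

/-- Hypothesis `h` is the acyclicity of the subcomplex `U`. Both cycles and bounding elements of the
quotient lift to `C` after a correction by an element of `U`. -/
lemma quasiIso_quotientComplexHom (C : CochainComplex (ModuleCat.{u} S) ℤ)
    (U : ∀ n, Submodule S (C.X n)) (hU : ∀ i j, U i ≤ (U j).comap (C.d i j).hom)
    (h : ∀ (m n : ℤ) (_ : m + 1 = n) (x : C.X n), x ∈ U n → C.d n (n + 1) x = 0 →
      ∃ y ∈ U m, C.d m n y = x) : QuasiIso (quotientComplexHom C U hU) := by
  apply quasiIso_of_elements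
  · intro m n hmn z y hz hy
    obtain ⟨y, rfl⟩ := (U m).mkQ_surjective y
    have hy' : (U n).mkQ (C.d m n y) = (U n).mkQ z := hy
    have h₁ : z - C.d m n y ∈ U n := by
      rw [← Submodule.Quotient.mk_eq_zero, ← Submodule.mkQ_apply, map_sub, hy', sub_self]
    obtain ⟨u, -, hu⟩ := h m n hmn _ h₁ (by rw [map_sub, hz, d_d_apply, sub_zero])
    exact ⟨y + u, by rw [map_add, hu, add_sub_cancel]⟩
  · intro m n hmn y hy
    obtain ⟨y, rfl⟩ := (U n).mkQ_surjective y
    have hy' : C.d n (n + 1) y ∈ U (n + 1) := (Submodule.Quotient.mk_eq_zero _).1 hy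
    obtain ⟨u, hu, hu'⟩ := h n (n + 1) rfl _ hy' (d_d_apply _ _ _ _ _)
    refine ⟨y - u, 0, by rw [map_sub, hu', sub_self], ?_⟩
    have e : (U n).mkQ (y - u) = (U n).mkQ y := by
      rw [map_sub, show (U n).mkQ u = 0 from (Submodule.Quotient.mk_eq_zero _).2 hu, sub_zero]
    rw [map_zero]
    exact e.trans (add_zero (show (quotientComplex C U hU).X n from (U n).mkQ y)).symm

end QuotientComplexes

/-! ### Finiteness of the Loewy length through the Artin–Rees lemma -/

section LoewyFinite
variable {S : Type u} [CommRing S] [IsNoetherianRing S]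

/-- This is the Artin–Rees lemma, in a form where any larger constant works too, so that one
constant can serve finitely many degrees. -/
lemma exists_pow_smul_inf_le {A : Type u} [AddCommGroup A] [Module S A] [Module.Finite S A]
    (I : Ideal S) (N : Submodule S A) :
    ∃ k : ℕ, ∀ k' ≥ k, ∀ n : ℕ, I ^ (n + k') • (⊤ : Submodule S A) ⊓ N ≤ I ^ n • N := by
  obtain ⟨k, hk⟩ := I.exists_pow_inf_eq_pow_smul N
  refine ⟨k, fun k' hk' n => ?_⟩
  rw [hk (n + k') (by lia)]
  exact Submodule.smul_mono (Ideal.pow_le_pow_right (by lia)) inf_le_right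

/-- A bounded complex of finitely generated modules whose homology is annihilated by `I` is
quasi-isomorphic to a complex annihilated by a power of `I`. -/
theorem exists_quasiIso_isKilledBy_pow (C : CochainComplex (ModuleCat.{u} S) ℤ)
    (hf : ∀ n, Module.Finite S (C.X n)) (a b : ℤ)
    (hC : ∀ n, n < a ∨ b < n → Subsingleton (C.X n)) (I : Ideal S)
    (hI : ∀ (m n : ℤ) (_ : m + 1 = n) (z : C.X n), C.d n (n + 1) z = 0 → ∀ s ∈ I,
      ∃ y, C.d m n y = s • z) :
    ∃ (k : ℕ) (V : CochainComplex (ModuleCat.{u} S) ℤ) (f : C ⟶ V), QuasiIso f ∧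
      IsKilledBy V (I ^ k) := by
  let Z (n : ℤ) : Submodule S (C.X n) := LinearMap.ker (C.d n (n + 1)).hom
  have hN (n : ℤ) := exists_pow_smul_inf_le I (Z n)
  choose N₀ hN₀ using hN
  -- One Artin–Rees constant for the cycles in all the degrees in which `C` may be nonzero.
  let N : ℕ := (Finset.Icc a b).sup N₀
  have hAR (n : ℤ) (k : ℕ) : I ^ (k + N) • (⊤ : Submodule S (C.X n)) ⊓ Z n ≤ I ^ k • Z n := by
    by_cases h : n < a ∨ b < n
    · have := hC n h
      intro x _
      rw [Subsingleton.elim x 0]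
      exact Submodule.zero_mem _
    · exact hN₀ n N (Finset.le_sup (f := N₀) (Finset.mem_Icc.2 ⟨by lia, by lia⟩)) k
  -- The exponent vanishes below degree `a` and increases by `N + 1` in each step from there on: `N`
  -- is the loss in the Artin–Rees lemma, and the extra one is used because `I`, rather than the
  -- unit ideal, multiplies cycles into boundaries.
  let e (n : ℤ) : ℕ := (n - a + 1).toNat * (N + 1)
  let P (n : ℤ) : Submodule S (C.X n) := I ^ e n • ⊤
  -- Adding `d P` to `P` gives a subcomplex without any condition on the exponents.
  let U (n : ℤ) : Submodule S (C.X n) := (P (n - 1)).map (C.d (n - 1) n).hom ⊔ P n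
  have hPU (n : ℤ) : P n ≤ U n := le_sup_right
  have hdU (i j : ℤ) (hij : i + 1 = j) : U i ≤ (U j).comap (C.d i j).hom := by
    obtain rfl : i = j - 1 := by lia
    rw [sup_le_iff]
    constructor
    · rintro _ ⟨x, -, rfl⟩
      rw [Submodule.mem_comap, d_d_apply C]
      exact Submodule.zero_mem _
    · exact Submodule.map_le_iff_le_comap.1 le_sup_left
  have hU (i j : ℤ) : U i ≤ (U j).comap (C.d i j).hom := by
    by_cases hij : i + 1 = j
    · exact hdU i j hij
    · intro x _
      rw [Submodule.mem_comap, C.shape i j hij]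
      exact Submodule.zero_mem _
  refine ⟨e b, quotientComplex C U hU, quotientComplexHom C U hU,
    quasiIso_quotientComplexHom C U hU ?_, ?_⟩
  · intro m n hmn x hx hdx
    obtain rfl : m = n - 1 := by lia
    by_cases hn : n < a
    · have := hC n (Or.inl hn)
      exact ⟨0, Submodule.zero_mem _, Subsingleton.elim _ _⟩
    obtain ⟨_, ⟨y, hy, rfl⟩, v, hv, rfl⟩ := Submodule.mem_sup.1 hx
    have hdv : v ∈ Z n := by
      have h₁ : C.d n (n + 1) (C.d (n - 1) n y + v) = 0 := hdx
      rw [map_add, d_d_apply, zero_add] at h₁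
      exact h₁
    have he : e n = e (n - 1) + 1 + N := by
      have : (n - a + 1).toNat = (n - 1 - a + 1).toNat + 1 := by lia
      simp only [e, this]
      ring
    -- The cycle `v` lies in `I^(e(n-1)+1) Z`. One factor `I` turns cycles into boundaries, and the
    -- remaining factors move inside the differential, so `v` is the boundary of an element of `P (n
    -- - 1)`.
    have hv' : v ∈ I ^ (e (n - 1) + 1) • Z n := hAR n _ ⟨by rw [← he]; exact hv, hdv⟩
    have hle : I • Z n ≤ LinearMap.range (C.d (n - 1) n).hom :=
      Submodule.smul_le.2 fun s hs z hz => hI (n - 1) n (by lia) z hz s hs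
    have hv'' : v ∈ (P (n - 1)).map (C.d (n - 1) n).hom := by
      rw [Submodule.map_smul'', Submodule.map_top]
      rw [pow_succ, mul_smul] at hv'
      exact Submodule.smul_mono le_rfl hle hv'
    obtain ⟨w, hw, rfl⟩ := hv''
    exact ⟨y + w, Submodule.add_mem _ (hPU _ hy) (hPU _ hw), map_add _ _ _⟩
  · intro s hs n x
    obtain ⟨x, rfl⟩ := (U n).mkQ_surjective x
    by_cases hn : b < n
    · have := hC n (Or.inr hn)
      exact (Submodule.Quotient.mk_eq_zero (U n)).2 (show s • x ∈ U n by
        rw [Subsingleton.elim (s • x) 0]; exact Submodule.zero_mem _)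
    · have hs' : s ∈ I ^ e n := Ideal.pow_le_pow_right (Nat.mul_le_mul_right _ (by lia)) hs
      exact (Submodule.Quotient.mk_eq_zero (U n)).2 (hPU n (Submodule.smul_mem_smul hs' trivial))

end LoewyFinite

/-! ### Isomorphisms in the derived category represented by quasi-isomorphisms -/

section DerivedIsos
variable {R S : Type u} [CommRing R] [CommRing S]

lemma DerivedIso.symm {M N : CochainComplex (ModuleCat.{u} S) ℤ} (h : DerivedIso M N) :
    DerivedIso N M := by
  let _ : HasDerivedCategory (ModuleCat.{u} S) := HasDerivedCategory.standard _
  obtain ⟨e⟩ := h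
  exact ⟨e.symm⟩

lemma DerivedIso.trans {M N L : CochainComplex (ModuleCat.{u} S) ℤ} (h : DerivedIso M N)
    (h' : DerivedIso N L) : DerivedIso M L := by
  let _ : HasDerivedCategory (ModuleCat.{u} S) := HasDerivedCategory.standard _
  obtain ⟨e⟩ := h
  obtain ⟨e'⟩ := h'
  exact ⟨e ≪≫ e'⟩

lemma derivedIso_of_quasiIso {M N : CochainComplex (ModuleCat.{u} S) ℤ} (f : M ⟶ N) [QuasiIso f] :
    DerivedIso M N := by
  let _ : HasDerivedCategory (ModuleCat.{u} S) := HasDerivedCategory.standard _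
  exact ⟨asIso (DerivedCategory.Q.map f)⟩

lemma derivedIso_of_iso {M N : CochainComplex (ModuleCat.{u} S) ℤ} (e : M ≅ N) :
    DerivedIso M N :=
  derivedIso_of_quasiIso e.hom

lemma derivedIso_of_homotopyEquiv {M N : CochainComplex (ModuleCat.{u} S) ℤ}
    (e : HomotopyEquiv M N) : DerivedIso M N :=
  derivedIso_of_quasiIso e.hom

/-- Isomorphisms in the derived category from K-projective complexes lift to
quasi-isomorphisms. -/
lemma DerivedIso.exists_quasiIso {P N : CochainComplex (ModuleCat.{u} S) ℤ} [P.IsKProjective]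
    (h : DerivedIso P N) : ∃ f : P ⟶ N, QuasiIso f := by
  let _ : HasDerivedCategory (ModuleCat.{u} S) := HasDerivedCategory.standard _
  obtain ⟨e⟩ := h
  obtain ⟨g, hg⟩ := (CochainComplex.IsKProjective.Qh_map_bijective P
    ((HomotopyCategory.quotient _ _).obj N)).surjective e.hom
  obtain ⟨f, rfl⟩ := (HomotopyCategory.quotient _ _).map_surjective g
  refine ⟨f, ?_⟩
  rw [← DerivedCategory.isIso_Q_map_iff_quasiIso]
  have : DerivedCategory.Q.map f = e.hom := hg
  rw [this]
  infer_instance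

/-- Every isomorphism in the derived category is thus witnessed by two quasi-isomorphisms out of the
chosen resolution of `M`. The invariance statements for homology, restriction of scalars, Tor and
Ext are reduced to quasi-isomorphisms in this way. -/
lemma DerivedIso.exists_quasiIso_kProjRes {M N : CochainComplex (ModuleCat.{u} S) ℤ}
    (h : DerivedIso M N) : ∃ f : kProjRes M ⟶ N, QuasiIso f :=
  ((derivedIso_of_quasiIso (kProjResHom M)).trans h).exists_quasiIso

lemma DerivedIso.nonempty_homologyEquiv {M N : CochainComplex (ModuleCat.{u} S) ℤ}
    (h : DerivedIso M N) (n : ℤ) : Nonempty (M.homology n ≃ₗ[S] N.homology n) := by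
  obtain ⟨f, _⟩ := h.exists_quasiIso_kProjRes
  exact ⟨(homologyEquiv (kProjResHom M) n).symm ≪≫ₗ homologyEquiv f n⟩

lemma derivedIso_homologyComplex {M N : CochainComplex (ModuleCat.{u} S) ℤ}
    (e : ∀ n, M.homology n ≃ₗ[S] N.homology n) :
    DerivedIso (homologyComplex M) (homologyComplex N) := by
  let f : homologyComplex M ⟶ homologyComplex N :=
    { f n := ModuleCat.ofHom (e n).toLinearMap
      comm' i j _ := comp_zero.trans zero_comp.symm }
  let g : homologyComplex N ⟶ homologyComplex M :=
    { f n := ModuleCat.ofHom (e n).symm.toLinearMap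
      comm' i j _ := comp_zero.trans zero_comp.symm }
  refine derivedIso_of_iso ⟨f, g, ?_, ?_⟩
  · ext n x
    exact (e n).symm_apply_apply x
  · ext n x
    exact (e n).apply_symm_apply x

lemma DerivedIso.isFormal {M N : CochainComplex (ModuleCat.{u} S) ℤ} (h : DerivedIso M N)
    (hN : IsFormal N) : IsFormal M := by
  let e n := (h.nonempty_homologyEquiv n).some
  exact (h.trans hN).trans (derivedIso_homologyComplex e).symm

instance quasiIso_restrict (φ : R →+* S) {M N : CochainComplex (ModuleCat.{u} S) ℤ} (f : M ⟶ N)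
    [hf : QuasiIso f] : QuasiIso
      (((ModuleCat.restrictScalars φ).mapHomologicalComplex (ComplexShape.up ℤ)).map f) :=
  inferInstance

end DerivedIsos

/-! ### Complexes annihilated by an ideal and models of Koszul complexes -/

section KilledTensor
variable {R S : Type u} [CommRing R] [CommRing S] (φ : R →+* S)

lemma IsKilledBy.tensor {A : CochainComplex (ModuleCat.{u} S) ℤ} {I : Ideal S}
    (hA : IsKilledBy A I) (P : CochainComplex (ModuleCat.{u} R) ℤ) :
    IsKilledBy (tensorComplex φ P A) I := by
  intro s hs n x
  have : (s • LinearMap.id : (tensorComplex φ P A).X n →ₗ[S] (tensorComplex φ P A).X n) = 0 := by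
    apply tensorComplex_ext
    intro i j h a p
    have e : s • ιTensor φ P A i j n h (TensorProduct.tmul R a p) = ιTensor φ P A i j n h
        (TensorProduct.tmul R (show (ModuleCat.restrictScalars φ).obj (A.X j) from
          s • (show A.X j from a)) p) := ((ιTensor φ P A i j n h).map_smul s _).symm
    refine e.trans ?_
    rw [hA s hs j a]
    exact (congrArg (ιTensor φ P A i j n h) (TensorProduct.zero_tmul _ p)).trans (map_zero _)
  exact LinearMap.congr_fun this x

lemma IsKilledBy.mono {A : CochainComplex (ModuleCat.{u} S) ℤ} {I J : Ideal S}
    (hA : IsKilledBy A J) (h : I ≤ J) : IsKilledBy A I := fun s hs => hA s (h hs)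

lemma IsKilledBy.restrict {A : CochainComplex (ModuleCat.{u} S) ℤ} {I : Ideal R}
    (hA : IsKilledBy A (I.map φ)) : IsKilledBy (restrict φ A) I :=
  fun r hr n x => hA (φ r) (Ideal.mem_map_of_mem φ hr) n x

/-- The Koszul complex with coefficients in `M`, computed by a resolution of `M` and a replacement
of the Koszul complex. -/
lemma derivedIso_koszulOn (x : List S) {V : CochainComplex (ModuleCat.{u} S) ℤ}
    (hV : DerivedIso (koszul x) V) (M : CochainComplex (ModuleCat.{u} S) ℤ) :
    DerivedIso (koszulOn x M) (tensorComplex (RingHom.id S) (kProjRes M) V) := by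
  obtain ⟨f, _⟩ := hV.exists_quasiIso
  have := quasiIso_tensorComplexMap (RingHom.id S) (kProjRes M) f
  have := quasiIso_tensorComplexMap (RingHom.id S) (koszul x) (kProjResHom M)
  have h₁ : DerivedIso (koszulOn x M) (tensorComplex (RingHom.id S) (koszul x) M) :=
    derivedIso_of_iso (koszulOnIso x M ≪≫ (tensorKoszulIso x M).symm)
  have h₂ := derivedIso_of_quasiIso
    (tensorComplexMap (RingHom.id S) (𝟙 (koszul x)) (kProjResHom M))
  -- Both orders of the factors give the same iterated cone. The exchange puts the resolution of
  -- `M`, which is K-flat, in charge before the Koszul complex is replaced by `V`, about which no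
  -- flatness is known.
  have h₃ : DerivedIso (tensorComplex (RingHom.id S) (koszul x) (kProjRes M))
      (tensorComplex (RingHom.id S) (kProjRes M) (koszul x)) :=
    derivedIso_of_iso (tensorKoszulIso x _ ≪≫ (tensorKoszulIso₂ x _).symm)
  exact (h₁.trans h₂.symm).trans (h₃.trans (derivedIso_of_quasiIso
    (tensorComplexMap (RingHom.id S) (𝟙 (kProjRes M)) f)))

end KilledTensor

/-! ### The model of the Koszul complex annihilated by the maximal ideal of `R` -/

section LoewyKoszul
variable {R S : Type u} [CommRing R] [IsLocalRing R] [CommRing S] [IsLocalRing S]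

/-- The Koszul complex is bounded with finitely generated components, and null-homotopies show that
𝔫 annihilates its homology. Finiteness matters because the exponent in the hypothesis on `φ` is
obtained by `toNat`, which sends `⊤` to `0`. -/
lemma homotopicalLoewyLength_ne_top [IsNoetherianRing S] (x : List S)
    (hx : Ideal.ofList x = IsLocalRing.maximalIdeal S) :
    homotopicalLoewyLength (koszul x) ≠ ⊤ := by
  obtain ⟨k, V, f, _, hV⟩ := exists_quasiIso_isKilledBy_pow (koszul x) (finite_koszul_X x)
    (-(x.length : ℤ)) 0 (fun n hn => subsingleton_koszul_X x n hn.symm)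
    (IsLocalRing.maximalIdeal S) (fun m n hmn z hz s hs => by
      have hs' : s ∈ nullIdeal (koszul x) := by
        rw [koszul_eq_iteratedKoszul]
        exact ofList_le_nullIdeal x _ (hx ▸ hs)
      obtain ⟨H⟩ := hs'
      refine ⟨H.hom n m z, ?_⟩
      have := homotopy_zero_elements H m n (n + 1) hmn rfl z
      rw [hz, map_zero, zero_add] at this
      exact this.symm)
  have h₁ : homotopicalLoewyLength (koszul x) ≤ loewyLength V :=
    iInf₂_le V (derivedIso_of_quasiIso f)
  have h₂ : loewyLength V ≤ (k : ℕ∞) := iInf₂_le k hV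
  exact ne_top_of_le_ne_top (ENat.natCast_ne_top k) (h₁.trans h₂)

lemma exists_derivedIso_isKilledBy (M : CochainComplex (ModuleCat.{u} S) ℤ)
    (hM : homotopicalLoewyLength M ≠ ⊤) :
    ∃ V, DerivedIso M V ∧
      IsKilledBy V (IsLocalRing.maximalIdeal S ^ (homotopicalLoewyLength M).toNat) := by
  set c := (homotopicalLoewyLength M).toNat with hc
  -- A strict inequality above the infimum produces a complex and an exponent below `c + 1`, hence
  -- at most `c`.
  have h : homotopicalLoewyLength M < ((c + 1 : ℕ) : ℕ∞) := by
    rw [← ENat.natCast_toNat hM, ← hc]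
    exact_mod_cast Nat.lt_succ_self c
  rw [homotopicalLoewyLength] at h
  simp only [iInf_lt_iff] at h
  obtain ⟨V, hV, h⟩ := h
  rw [loewyLength] at h
  simp only [iInf_lt_iff] at h
  obtain ⟨i, hi, h⟩ := h
  have hi' : i ≤ c := by
    have : i < c + 1 := by exact_mod_cast h
    lia
  exact ⟨V, hV, fun s hs => hi s (Ideal.pow_le_pow_right hi' hs)⟩

/-- If `φ` maps the maximal ideal into a sufficiently high power of the maximal ideal, the Koszul
complex on a generating set of the maximal ideal is isomorphic in the derived category to a
complex annihilated by the image of the maximal ideal. -/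
lemma exists_derivedIso_koszulOn_isKilledBy [IsNoetherianRing S] (φ : R →+* S) (x : List S)
    (hx : Ideal.ofList x = IsLocalRing.maximalIdeal S)
    (hφ : ∀ r ∈ IsLocalRing.maximalIdeal R,
      φ r ∈ IsLocalRing.maximalIdeal S ^ (homotopicalLoewyLength (koszul x)).toNat)
    (M : CochainComplex (ModuleCat.{u} S) ℤ) :
    ∃ W, DerivedIso (koszulOn x M) W ∧ IsKilledBy W ((IsLocalRing.maximalIdeal R).map φ) := by
  obtain ⟨V, hV, hk⟩ := exists_derivedIso_isKilledBy (koszul x)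
    (homotopicalLoewyLength_ne_top x hx)
  exact ⟨_, derivedIso_koszulOn x hV M, ((hk.tensor (RingHom.id S) _).mono
    (Ideal.map_le_iff_le_comap.2 hφ))⟩

lemma DerivedIso.restrict (φ : R →+* S) {M N : CochainComplex (ModuleCat.{u} S) ℤ}
    (h : DerivedIso M N) : DerivedIso (restrict φ M) (restrict φ N) := by
  obtain ⟨f, _⟩ := h.exists_quasiIso_kProjRes
  exact (derivedIso_of_quasiIso (((ModuleCat.restrictScalars φ).mapHomologicalComplex
    (ComplexShape.up ℤ)).map (kProjResHom M))).symm.trans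
    (derivedIso_of_quasiIso (((ModuleCat.restrictScalars φ).mapHomologicalComplex
      (ComplexShape.up ℤ)).map f))

/-- As a complex of `R`-modules, `W` consists of vector spaces over the residue field, so it splits.
-/
lemma isFormal_restrict_of_isKilledBy (φ : R →+* S) {M W : CochainComplex (ModuleCat.{u} S) ℤ}
    (h : DerivedIso M W) (hW : IsKilledBy W ((IsLocalRing.maximalIdeal R).map φ)) :
    IsFormal (DerivedKoszul.restrict φ M) :=
  (h.restrict φ).isFormal (derivedIso_of_homotopyEquiv
    (nonempty_homotopyEquiv_homologyComplex (hW.restrict φ)).some)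

end LoewyKoszul

/-! ### Recognition of direct sums -/

section DirectSums
variable {S : Type u} [CommRing S]

/-- A module which is decomposed by families of inclusions and projections is a direct sum. -/
lemma nonempty_equiv_directSum {ι : Type*} [DecidableEq ι] {H : Type*} [AddCommGroup H] [Module S H]
    {A : ι → Type*} [∀ i, AddCommGroup (A i)] [∀ i, Module S (A i)] (ψ : ∀ i, A i →ₗ[S] H)
    (π : ∀ i, H →ₗ[S] A i) (h₁ : ∀ i x, π i (ψ i x) = x) (h₂ : ∀ i j x, i ≠ j → π j (ψ i x) = 0)
    (h₃ : ∀ v, ∃ s : Finset ι, v = ∑ i ∈ s, ψ i (π i v)) :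
    Nonempty (H ≃ₗ[S] DirectSum ι A) := by
  have key (j : ι) : π j ∘ₗ DirectSum.toModule S ι H ψ = DirectSum.component S ι A j := by
    refine DirectSum.linearMap_ext S fun i => LinearMap.ext fun x => ?_
    simp only [LinearMap.comp_apply, DirectSum.toModule_lof]
    by_cases hij : i = j
    · subst hij
      rw [h₁, DirectSum.component.lof_self]
    · rw [h₂ i j x hij, DirectSum.component.of, dif_neg hij]
  refine ⟨(LinearEquiv.ofBijective (DirectSum.toModule S ι H ψ) ⟨?_, ?_⟩).symm⟩
  · rw [injective_iff_map_eq_zero]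
    intro v hv
    refine DFinsupp.ext fun j => ?_
    have := LinearMap.congr_fun (key j) v
    rw [LinearMap.comp_apply, hv, map_zero] at this
    exact this.symm
  · intro v
    obtain ⟨s, hs⟩ := h₃ v
    refine ⟨∑ i ∈ s, DirectSum.lof S ι A i (π i v), ?_⟩
    rw [map_sum]
    conv_rhs => rw [hs]
    exact Finset.sum_congr rfl fun i _ => DirectSum.toModule_lof S i _

end DirectSums

/-! ### Reduction of the first factor modulo an ideal annihilating the second -/

section Reduction
variable {R S T : Type u} [CommRing R] [CommRing S] [CommRing T]

open HomologicalComplex TensorProduct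

lemma isIso_totalMap_left (F : ModuleCat.{u} R ⥤ ModuleCat.{u} S ⥤ ModuleCat.{u} T) [F.Additive]
    [∀ X, (F.obj X).Additive] {K L : CochainComplex (ModuleCat.{u} R) ℤ} (f : K ⟶ L)
    (M : CochainComplex (ModuleCat.{u} S) ℤ) (hf : ∀ i j, IsIso ((F.map (f.f i)).app (M.X j))) :
    IsIso (totalMap F f (𝟙 M)) := by
  have hn (n : ℤ) : IsIso ((totalMap F f (𝟙 M)).f n) := by
    have hι (i j : ℤ) (h : i + j = n) : ιTotal F K M i j n h ≫ (totalMap F f (𝟙 M)).f n =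
        (F.map (f.f i)).app (M.X j) ≫ ιTotal F L M i j n h := by
      refine (ι_mapBifunctorMap _ _ _ _ _ _ _ _).trans ?_
      rw [HomologicalComplex.id_f, CategoryTheory.Functor.map_id, Category.id_comp]
    let g : (total F L M).X n ⟶ (total F K M).X n :=
      mapBifunctorDesc fun i j (h : i + j = n) =>
        inv ((F.map (f.f i)).app (M.X j)) ≫ ιTotal F K M i j n h
    have hg (i j : ℤ) (h : i + j = n) : ιTotal F L M i j n h ≫ g =
        inv ((F.map (f.f i)).app (M.X j)) ≫ ιTotal F K M i j n h := ι_mapBifunctorDesc _ _ _ _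
    refine ⟨g, ?_, ?_⟩
    · apply mapBifunctor.hom_ext
      intro i j (h : i + j = n)
      refine (Category.assoc _ _ _).symm.trans ?_
      rw [hι, Category.assoc, hg, IsIso.hom_inv_id_assoc]
      exact (Category.comp_id _).symm
    · apply mapBifunctor.hom_ext
      intro i j (h : i + j = n)
      refine (Category.assoc _ _ _).symm.trans ?_
      rw [hg, Category.assoc, hι, IsIso.inv_hom_id_assoc]
      exact (Category.comp_id _).symm
  exact HomologicalComplex.Hom.isIso_of_components _

/-- The reduction of a complex modulo an ideal. -/
noncomputable def reduction (I : Ideal R) (P : CochainComplex (ModuleCat.{u} R) ℤ) :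
    CochainComplex (ModuleCat.{u} R) ℤ :=
  quotientComplex P (fun _ => I • ⊤) (fun i j => by
    rw [← Submodule.map_le_iff_le_comap, Submodule.map_smul'']
    exact Submodule.smul_mono le_rfl le_top)

/-- The projection of a complex to its reduction. -/
noncomputable def reductionHom (I : Ideal R) (P : CochainComplex (ModuleCat.{u} R) ℤ) :
    P ⟶ reduction I P :=
  quotientComplexHom P _ _

lemma reduction_isKilledBy (I : Ideal R) (P : CochainComplex (ModuleCat.{u} R) ℤ) :
    IsKilledBy (reduction I P) I := by
  intro s hs n x
  obtain ⟨x, rfl⟩ := (I • ⊤ : Submodule R (P.X n)).mkQ_surjective x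
  exact (Submodule.Quotient.mk_eq_zero _).2 (Submodule.smul_mem_smul hs trivial)

/-- Since `I` annihilates `W`, the image of `W ⊗ IP` in `W ⊗ P` is zero; right exactness of the
tensor product identifies `W ⊗ P` with `W ⊗ P/IP`. -/
lemma isIso_tensorComplexMap_reductionHom (φ : R →+* S) (I : Ideal R)
    (P : CochainComplex (ModuleCat.{u} R) ℤ) {W : CochainComplex (ModuleCat.{u} S) ℤ}
    (hW : IsKilledBy W (I.map φ)) :
    IsIso (tensorComplexMap φ (reductionHom I P) (𝟙 W)) := by
  apply isIso_totalMap_left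
  intro i j
  rw [ConcreteCategory.isIso_iff_bijective]
  let N := (ModuleCat.restrictScalars φ).obj (W.X j)
  let U : Submodule R (P.X i) := I • ⊤
  change Function.Bijective (LinearMap.lTensor N U.mkQ)
  refine ⟨?_, LinearMap.lTensor_surjective N U.mkQ_surjective⟩
  have hex : Function.Exact (LinearMap.lTensor N U.subtype) (LinearMap.lTensor N U.mkQ) :=
    lTensor_exact N (LinearMap.exact_subtype_mkQ U) U.mkQ_surjective
  have h0 : LinearMap.lTensor N U.subtype = 0 := by
    refine TensorProduct.ext' fun a u => ?_
    rw [LinearMap.lTensor_tmul, LinearMap.zero_apply]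
    have : U ≤ LinearMap.ker (TensorProduct.mk R N (P.X i) a) := Submodule.smul_le.2 fun r hr p _ => by
      change a ⊗ₜ (r • p) = 0
      have ha : r • a = 0 := hW (φ r) (Ideal.mem_map_of_mem φ hr) j a
      rw [← TensorProduct.smul_tmul, ha, TensorProduct.zero_tmul]
    exact this u.2
  rw [← LinearMap.ker_eq_bot, LinearMap.exact_iff.1 hex, h0, LinearMap.range_zero]

/-- Homotopy equivalences are preserved by tensor products. -/
lemma nonempty_homotopyEquiv_tensorComplex (φ : R →+* S) {P P' : CochainComplex (ModuleCat.{u} R) ℤ}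
    (e : HomotopyEquiv P P') (W : CochainComplex (ModuleCat.{u} S) ℤ) :
    Nonempty (HomotopyEquiv (tensorComplex φ P W) (tensorComplex φ P' W)) :=
  ⟨{ hom := tensorComplexMap φ e.hom (𝟙 W)
     inv := tensorComplexMap φ e.inv (𝟙 W)
     homotopyHomInvId := (Homotopy.ofEq ((totalMap_comp (tensorFunctor φ) _ _ _ _).symm.trans
       (congrArg (totalMap (tensorFunctor φ) (e.hom ≫ e.inv)) (Category.id_comp (𝟙 W))))).trans
       ((mapBifunctorMapHomotopy₁ e.homotopyHomInvId (𝟙 W) (tensorFunctor φ)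
         (ComplexShape.up ℤ)).trans (Homotopy.ofEq (totalMap_id _ _ _)))
     homotopyInvHomId := (Homotopy.ofEq ((totalMap_comp (tensorFunctor φ) _ _ _ _).symm.trans
       (congrArg (totalMap (tensorFunctor φ) (e.inv ≫ e.hom)) (Category.id_comp (𝟙 W))))).trans
       ((mapBifunctorMapHomotopy₁ e.homotopyInvHomId (𝟙 W) (tensorFunctor φ)
         (ComplexShape.up ℤ)).trans (Homotopy.ofEq (totalMap_id _ _ _))) }⟩

/-- The reduction `P/𝔪P` is a complex of vector spaces, homotopy equivalent to its homology, and
homotopy equivalences survive tensoring. The first factor may thus be assumed to have zero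
differential. -/
lemma nonempty_homology_tensor_reduction [IsLocalRing R] (φ : R →+* S)
    (P : CochainComplex (ModuleCat.{u} R) ℤ) {W : CochainComplex (ModuleCat.{u} S) ℤ}
    (hW : IsKilledBy W ((IsLocalRing.maximalIdeal R).map φ)) (n : ℤ) :
    Nonempty ((tensorComplex φ P W).homology n ≃ₗ[S] (tensorComplex φ
      (homologyComplex (reduction (IsLocalRing.maximalIdeal R) P)) W).homology n) := by
  have := isIso_tensorComplexMap_reductionHom φ (IsLocalRing.maximalIdeal R) P hW
  obtain ⟨e⟩ := nonempty_homotopyEquiv_homologyComplex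
    (reduction_isKilledBy (IsLocalRing.maximalIdeal R) P)
  obtain ⟨e'⟩ := nonempty_homotopyEquiv_tensorComplex φ e W
  exact ⟨homologyEquiv (tensorComplexMap φ (reductionHom _ P) (𝟙 W)) n ≪≫ₗ
    homologyEquiv e'.hom n⟩

end Reduction

/-! ### Inclusions of shifts of `W` in a tensor product, and projections onto them -/

section Contraction
variable {R S : Type u} [CommRing R] [IsLocalRing R] [CommRing S] (φ : R →+* S)

open HomologicalComplex TensorProduct

/-- The `S`-linear map `n ↦ n ⊗ l`. -/
noncomputable def tmulRight (N : ModuleCat.{u} S) {L : ModuleCat.{u} R} (l : L) :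
    N →ₗ[S] ((ModuleCat.restrictScalars φ).obj N ⊗[R] L) where
  toFun n := (show (ModuleCat.restrictScalars φ).obj N from n) ⊗ₜ l
  map_add' n n' := TensorProduct.add_tmul (show (ModuleCat.restrictScalars φ).obj N from n) n' l
  map_smul' _ _ := rfl

/-- The contraction of a tensor product by a linear form with values in the residue field. -/
noncomputable def contract {N : ModuleCat.{u} S}
    (hN : Module.IsTorsionBySet R ((ModuleCat.restrictScalars φ).obj N)
      (IsLocalRing.maximalIdeal R)) {L : ModuleCat.{u} R}
    (c : L →ₗ[R] IsLocalRing.ResidueField R) :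
    ((ModuleCat.restrictScalars φ).obj N ⊗[R] L) →ₗ[S] N :=
  letI : Module (IsLocalRing.ResidueField R) ((ModuleCat.restrictScalars φ).obj N) := hN.module
  haveI : IsScalarTower R (IsLocalRing.ResidueField R) ((ModuleCat.restrictScalars φ).obj N) :=
    hN.isScalarTower
  let f : ((ModuleCat.restrictScalars φ).obj N ⊗[R] L) →ₗ[R]
      (ModuleCat.restrictScalars φ).obj N :=
    TensorProduct.lift (LinearMap.mk₂ R (fun n l => c l • n) (fun n n' l => smul_add _ _ _)
      (fun r n l => smul_comm _ _ _) (fun n l l' => by rw [map_add, add_smul])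
      (fun r n l => by rw [map_smul, smul_assoc]))
  { toFun := f
    map_add' := map_add f
    map_smul' := fun s x => by
      induction x using TensorProduct.induction_on with
      | zero => rw [smul_zero, map_zero]; exact (smul_zero (A := N) s).symm
      | tmul n l =>
        obtain ⟨r, hr⟩ := IsLocalRing.residue_surjective (c l)
        have h (m : (ModuleCat.restrictScalars φ).obj N) : c l • m = r • m := by
          rw [← hr]; exact algebraMap_smul _ r m
        refine (h _).trans ?_
        refine Eq.trans ?_ (congrArg (fun t : N => s • t) (h n)).symm
        exact smul_comm (N := S) (α := (ModuleCat.restrictScalars φ).obj N) r s n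
      | add x y hx hy =>
        rw [smul_add, map_add, hx, hy, map_add]; exact (smul_add (A := N) s _ _).symm }

lemma contract_tmul {N : ModuleCat.{u} S}
    (hN : Module.IsTorsionBySet R ((ModuleCat.restrictScalars φ).obj N)
      (IsLocalRing.maximalIdeal R)) {L : ModuleCat.{u} R}
    (c : L →ₗ[R] IsLocalRing.ResidueField R) (n : (ModuleCat.restrictScalars φ).obj N) (l : L)
    (r : R) (hr : IsLocalRing.residue R r = c l) : contract φ hN c (n ⊗ₜ l) = r • n := by
  let _ : Module (IsLocalRing.ResidueField R) ((ModuleCat.restrictScalars φ).obj N) := hN.module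
  have : IsScalarTower R (IsLocalRing.ResidueField R) ((ModuleCat.restrictScalars φ).obj N) :=
    hN.isScalarTower
  have : contract φ hN c (n ⊗ₜ l) = c l • n := rfl
  rw [this, ← hr]
  exact algebraMap_smul _ r n

lemma d_ιTensor_of_eq (P : CochainComplex (ModuleCat.{u} R) ℤ)
    (A : CochainComplex (ModuleCat.{u} S) ℤ) (hP : ∀ i j, P.d i j = 0) (i j j' n n' : ℤ)
    (h : i + j = n) (hj : j + 1 = j') (hn : n + 1 = n') (h' : i + j' = n')
    (a : (ModuleCat.restrictScalars φ).obj (A.X j)) (p : P.X i) :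
    (tensorComplex φ P A).d n n' (ιTensor φ P A i j n h (a ⊗ₜ p)) =
      i.negOnePow • ιTensor φ P A i j' n' h'
        ((show (ModuleCat.restrictScalars φ).obj (A.X j') from A.d j j' a) ⊗ₜ p) := by
  subst hj hn
  rw [d_ιTensor, hP]
  exact (congrArg (· + _) ((congrArg (ιTensor φ P A (i + 1) j (n + 1) _)
    (TensorProduct.tmul_zero _ a)).trans (map_zero _))).trans (zero_add _)

variable {B : CochainComplex (ModuleCat.{u} R) ℤ} (hB : ∀ i j, B.d i j = 0)
  {W : CochainComplex (ModuleCat.{u} S) ℤ}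
  (hW : IsKilledBy W ((IsLocalRing.maximalIdeal R).map φ))

/-- The inclusion of a shift of `W` in the tensor product of `W` with a complex with zero
differential. -/
noncomputable def shiftInclusion (W : CochainComplex (ModuleCat.{u} S) ℤ) (p : ℤ) (e : B.X p) :
    W⟦-p⟧ ⟶ tensorComplex φ B W where
  f n := ModuleCat.ofHom (ιTensor φ B W p (n + -p) n (by lia) ∘ₗ tmulRight φ (W.X (n + -p)) e)
  comm' n n' hn := by
    have hn' : n + 1 = n' := hn
    ext w
    refine (d_ιTensor_of_eq φ B W hB p (n + -p) (n' + -p) n n' (by lia) (by lia) hn' (by lia)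
      w e).trans ?_
    -- The sign `(-1)^(-p)` of the shifted differential equals the sign `(-1)^p` of the total
    -- differential on the summand of first degree `p`.
    have h₁ : (W⟦-p⟧).d n n' = p.negOnePow • W.d (n + -p) (n' + -p) := by
      rw [← Int.negOnePow_neg]
      exact CochainComplex.shiftFunctor_obj_d' W (-p) n n'
    rw [h₁]
    exact ((ιTensor φ B W p (n' + -p) n' _ ∘ₗ tmulRight φ _ e).toAddMonoidHom.map_zsmul
      (p.negOnePow : ℤ) (W.d (n + -p) (n' + -p) w)).symm

lemma IsKilledBy.isTorsionBySet_restrict {W : CochainComplex (ModuleCat.{u} S) ℤ}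
    (hW : IsKilledBy W ((IsLocalRing.maximalIdeal R).map φ)) (j : ℤ) :
    Module.IsTorsionBySet R ((ModuleCat.restrictScalars φ).obj (W.X j))
      (IsLocalRing.maximalIdeal R) :=
  (hW.restrict φ).isTorsionBySet j

/-- The components of a projection from a tensor product to a shift of a factor. -/
noncomputable def shiftProjectionX (p : ℤ) (c : B.X p →ₗ[R] IsLocalRing.ResidueField R) (n : ℤ) :
    (tensorComplex φ B W).X n →ₗ[S] W.X (n + -p) :=
  tensorComplexDesc φ fun a j h => if ha : a = p then
    (W.XIsoOfEq (by lia)).hom.hom ∘ₗ contract φ (hW.isTorsionBySet_restrict φ j)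
      (c ∘ₗ (B.XIsoOfEq ha).hom.hom) else 0

lemma shiftProjectionX_ι (p : ℤ) (c : B.X p →ₗ[R] IsLocalRing.ResidueField R) (n : ℤ)
    (w : (ModuleCat.restrictScalars φ).obj (W.X (n + -p))) (b : B.X p) (h : p + (n + -p) = n) :
    shiftProjectionX φ hW p c n (ιTensor φ B W p (n + -p) n h (w ⊗ₜ b)) =
      contract φ (hW.isTorsionBySet_restrict φ (n + -p)) c (w ⊗ₜ b) := by
  refine (tensorComplexDesc_ι φ _ _ _ _ _).trans ?_
  rw [dif_pos rfl]
  rfl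

lemma shiftProjectionX_ι_of_ne (p : ℤ) (c : B.X p →ₗ[R] IsLocalRing.ResidueField R) (n a j : ℤ)
    (w : (ModuleCat.restrictScalars φ).obj (W.X j)) (b : B.X a) (h : a + j = n) (ha : a ≠ p) :
    shiftProjectionX φ hW p c n (ιTensor φ B W a j n h (w ⊗ₜ b)) = 0 := by
  refine (tensorComplexDesc_ι φ _ _ _ _ _).trans ?_
  rw [dif_neg ha]
  rfl

/-- The projection from a tensor product to a shift of a factor. -/
noncomputable def shiftProjection (p : ℤ) (c : B.X p →ₗ[R] IsLocalRing.ResidueField R) :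
    tensorComplex φ B W ⟶ W⟦-p⟧ where
  f n := ModuleCat.ofHom (shiftProjectionX φ hW p c n)
  comm' n n' hn := by
    have hn' : n + 1 = n' := hn
    apply ModuleCat.hom_ext
    apply tensorComplex_ext
    intro a j h w b
    have h₁ : (W⟦-p⟧).d n n' = p.negOnePow • W.d (n + -p) (n' + -p) := by
      rw [← Int.negOnePow_neg]
      exact CochainComplex.shiftFunctor_obj_d' W (-p) n n'
    have h₂ (x : (tensorComplex φ B W).X n') : shiftProjectionX φ hW p c n' (a.negOnePow • x) =
        a.negOnePow • shiftProjectionX φ hW p c n' x :=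
      (shiftProjectionX φ hW p c n').toAddMonoidHom.map_zsmul (a.negOnePow : ℤ) x
    rw [h₁]
    change p.negOnePow • W.d (n + -p) (n' + -p) (shiftProjectionX φ hW p c n _) =
      shiftProjectionX φ hW p c n' ((tensorComplex φ B W).d n n' _)
    by_cases ha : a = p
    · subst ha
      obtain rfl : j = n + -a := by lia
      rw [d_ιTensor_of_eq φ B W hB a (n + -a) (n' + -a) n n' h (by lia) hn' (by lia) w b, h₂,
        shiftProjectionX_ι, shiftProjectionX_ι]
      obtain ⟨r, hr⟩ := IsLocalRing.residue_surjective (c b)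
      rw [contract_tmul φ _ c _ b r hr, contract_tmul φ _ c _ b r hr]
      exact congrArg (a.negOnePow • ·) ((W.d (n + -a) (n' + -a)).hom.map_smul (φ r) w)
    · rw [shiftProjectionX_ι_of_ne φ hW p c n a j w b h ha,
        d_ιTensor_of_eq φ B W hB a j (j + 1) n n' h rfl hn' (by lia) w b, h₂,
        shiftProjectionX_ι_of_ne φ hW p c n' a (j + 1) _ b _ ha, map_zero, smul_zero, smul_zero]

/-- The composite is multiplication by the scalar `c e` of the residue field. Any lift `r` of it to
`R` will do, since `W` is annihilated by the image of the maximal ideal. -/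
lemma shiftInclusion_projection_apply (p : ℤ) (c : B.X p →ₗ[R] IsLocalRing.ResidueField R)
    (e : B.X p) (r : R) (hr : IsLocalRing.residue R r = c e) (n : ℤ) (w : (W⟦-p⟧).X n) :
    (shiftProjection φ hB hW p c).f n ((shiftInclusion φ hB W p e).f n w) = φ r • w := by
  refine (shiftProjectionX_ι φ hW p c n w e (by lia)).trans ?_
  exact contract_tmul φ _ c w e r hr

lemma shiftInclusion_projection_apply_of_ne (p q : ℤ)
    (c : B.X q →ₗ[R] IsLocalRing.ResidueField R) (e : B.X p) (hpq : p ≠ q) (n : ℤ)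
    (w : (W⟦-p⟧).X n) :
    (shiftProjection φ hB hW q c).f n ((shiftInclusion φ hB W p e).f n w) = 0 :=
  shiftProjectionX_ι_of_ne φ hW q c n p _ w e (by lia) hpq

end Contraction

/-! ### A tensor product with a complex of vector spaces as a sum of shifts -/

section Kunneth
variable {R S : Type u} [CommRing R] [IsLocalRing R] [CommRing S] (φ : R →+* S)

open HomologicalComplex TensorProduct

variable {B : CochainComplex (ModuleCat.{u} R) ℤ} (hB : ∀ i j, B.d i j = 0)
  {W : CochainComplex (ModuleCat.{u} S) ℤ}
  (hW : IsKilledBy W ((IsLocalRing.maximalIdeal R).map φ))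
  {I : ℤ → Type u} (β : ∀ p, B.X p ≃ₗ[R] (I p →₀ IsLocalRing.ResidueField R))

/-- The basis elements. -/
noncomputable def basisElement (i : Σ p, I p) : B.X i.1 := (β i.1).symm (Finsupp.single i.2 1)

/-- The coordinate functions. -/
noncomputable def basisCoordinate (i : Σ p, I p) : B.X i.1 →ₗ[R] IsLocalRing.ResidueField R :=
  Finsupp.lapply i.2 ∘ₗ (β i.1).toLinearMap

/-- An element of the tensor product involves only finitely many basis elements. The sum is asserted
for every larger finite set as well, which is what makes the set of good elements closed under
addition. -/
lemma exists_finset_sum_eq (n : ℤ) (z : (tensorComplex φ B W).X n) :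
    ∃ s : Finset (Σ p, I p), ∀ t, s ⊆ t → z = ∑ i ∈ t,
      (shiftInclusion φ hB W i.1 (basisElement β i)).f n
        ((shiftProjection φ hB hW i.1 (basisCoordinate β i)).f n z) := by
  classical
  let g (i : Σ p, I p) : (tensorComplex φ B W).X n →ₗ[S] (tensorComplex φ B W).X n :=
    ((shiftInclusion φ hB W i.1 (basisElement β i)).f n).hom ∘ₗ
        ((shiftProjection φ hB hW i.1 (basisCoordinate β i)).f n).hom
  let T : Submodule S ((tensorComplex φ B W).X n) :=
    { carrier := {z | ∃ s : Finset (Σ p, I p), ∀ t, s ⊆ t → z = ∑ i ∈ t, g i z}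
      zero_mem' := ⟨∅, fun t _ => by simp⟩
      add_mem' := by
        rintro x y ⟨s, hs⟩ ⟨s', hs'⟩
        refine ⟨s ∪ s', fun t ht => ?_⟩
        have h₁ := hs t (Finset.union_subset_left ht)
        have h₂ := hs' t (Finset.union_subset_right ht)
        calc x + y = ∑ i ∈ t, g i x + ∑ i ∈ t, g i y := congrArg₂ (· + ·) h₁ h₂
          _ = _ := by rw [← Finset.sum_add_distrib]; simp only [map_add]
      smul_mem' := by
        rintro a x ⟨s, hs⟩
        refine ⟨s, fun t ht => ?_⟩
        calc a • x = a • ∑ i ∈ t, g i x := congrArg (a • ·) (hs t ht)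
          _ = _ := by rw [Finset.smul_sum]; simp only [map_smul] }
  -- The good elements form a submodule `T`; that it is everything can be tested on pure tensors, by
  -- applying extensionality to the quotient map.
  suffices h : T.mkQ = 0 by
    have : z ∈ T := (Submodule.Quotient.mk_eq_zero T).1 (LinearMap.congr_fun h z)
    exact this
  apply tensorComplex_ext
  intro a j h w b
  refine (Submodule.Quotient.mk_eq_zero T).2 ?_
  obtain rfl : j = n + -a := by lia
  let s : Finset (Σ p, I p) := (β a b).support.map ⟨fun i => ⟨a, i⟩, sigma_mk_injective⟩
  have hg (i : I a) (r : R) (hr : IsLocalRing.residue R r = β a b i) :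
      g ⟨a, i⟩ (ιTensor φ B W a (n + -a) n h (w ⊗ₜ b)) = ιTensor φ B W a (n + -a) n h
        (w ⊗ₜ (r • basisElement β ⟨a, i⟩)) := by
    have h₁ := shiftProjectionX_ι φ hW a (basisCoordinate β ⟨a, i⟩) n w b h
    rw [contract_tmul φ _ _ w b r hr] at h₁
    refine (congrArg ((shiftInclusion φ hB W a (basisElement β ⟨a, i⟩)).f n) h₁).trans ?_
    refine congrArg (ιTensor φ B W a (n + -a) n h) ?_
    exact TensorProduct.smul_tmul r w _
  refine ⟨s, fun t ht => ?_⟩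
  rw [← Finset.sum_subset ht]
  · rw [Finset.sum_map]
    choose r hr using fun i : I a => IsLocalRing.residue_surjective (β a b i)
    have hb : b = ∑ i ∈ (β a b).support, r i • basisElement β ⟨a, i⟩ := by
      apply (β a).injective
      rw [map_sum]
      conv_lhs => rw [← Finsupp.sum_single (β a b)]
      refine Finset.sum_congr rfl fun i _ => ?_
      rw [map_smul, basisElement, LinearEquiv.apply_symm_apply, Finsupp.smul_single, ← hr i]
      congr 1
      rw [Algebra.smul_def, mul_one]
      rfl
    conv_lhs => rw [hb, TensorProduct.tmul_sum, map_sum]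
    exact Finset.sum_congr rfl fun i _ => (hg i (r i) (hr i)).symm
  · rintro ⟨p, i⟩ - hi
    by_cases hp : a = p
    · subst hp
      have h0 : β a b i = 0 := by
        by_contra hne
        exact hi (Finset.mem_map.2 ⟨i, Finsupp.mem_support_iff.2 hne, rfl⟩)
      rw [hg i 0 (by rw [h0, map_zero]), zero_smul, TensorProduct.tmul_zero, map_zero]
    · refine (congrArg ((shiftInclusion φ hB W p (basisElement β ⟨p, i⟩)).f n)
        (shiftProjectionX_ι_of_ne φ hW p _ n a _ w b h hp)).trans (map_zero _)

/-- The homology of a tensor product with a complex of vector spaces over the residue field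
with zero differential. -/
lemma nonempty_homology_tensor_equiv_shift (hB : ∀ i j, B.d i j = 0)
    (hW : IsKilledBy W ((IsLocalRing.maximalIdeal R).map φ))
    (β : ∀ p, B.X p ≃ₗ[R] (I p →₀ IsLocalRing.ResidueField R)) (n : ℤ) :
    Nonempty ((tensorComplex φ B W).homology n ≃ₗ[S]
      DirectSum (Σ p, I p) fun i => (W⟦-i.1⟧).homology n) := by
  classical
  have hφ₁ (i : Σ p, I p) : shiftInclusion φ hB W i.1 (basisElement β i) ≫
      shiftProjection φ hB hW i.1 (basisCoordinate β i) = 𝟙 _ := by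
    ext m w
    refine (shiftInclusion_projection_apply φ hB hW i.1 _ _ 1 ?_ m w).trans ?_
    · simp [basisCoordinate, basisElement]
    · rw [map_one, one_smul]; rfl
  have hφ₂ (i j : Σ p, I p) (hij : i ≠ j) : shiftInclusion φ hB W i.1 (basisElement β i) ≫
      shiftProjection φ hB hW j.1 (basisCoordinate β j) = 0 := by
    obtain ⟨p, i⟩ := i
    obtain ⟨q, j⟩ := j
    ext m w
    by_cases hpq : p = q
    · subst hpq
      have hij' : i ≠ j := fun h => hij (by rw [h])
      refine (shiftInclusion_projection_apply φ hB hW p _ _ 0 ?_ m w).trans ?_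
      · simp [basisCoordinate, basisElement, hij']
      · rw [map_zero, zero_smul]; rfl
    · exact shiftInclusion_projection_apply_of_ne φ hB hW p q _ _ hpq m w
  refine nonempty_equiv_directSum
    (fun i => (homologyMap (shiftInclusion φ hB W i.1 (basisElement β i)) n).hom)
    (fun i => (homologyMap (shiftProjection φ hB hW i.1 (basisCoordinate β i)) n).hom) ?_ ?_ ?_
  · intro i x
    have := congrArg (fun f : W⟦-i.1⟧ ⟶ W⟦-i.1⟧ => (homologyMap f n).hom x) (hφ₁ i)
    rw [homologyMap_comp, homologyMap_id] at this
    exact this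
  · intro i j x hij
    have := congrArg (fun f : W⟦-i.1⟧ ⟶ W⟦-j.1⟧ => (homologyMap f n).hom x) (hφ₂ i j hij)
    rw [homologyMap_comp, homologyMap_zero] at this
    exact this
  · intro v
    obtain ⟨z, rfl⟩ := homologyClass_surjective _ n v
    obtain ⟨s, hs⟩ := exists_finset_sum_eq φ hB hW β n z.1
    refine ⟨s, ?_⟩
    let y (i : Σ p, I p) : LinearMap.ker ((tensorComplex φ B W).d n (n + 1)).hom :=
      ⟨_, map_mem_ker (shiftInclusion φ hB W i.1 (basisElement β i)) n
        ⟨_, map_mem_ker (shiftProjection φ hB hW i.1 (basisCoordinate β i)) n z⟩⟩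
    have hy (i : Σ p, I p) : (homologyMap (shiftInclusion φ hB W i.1 (basisElement β i)) n).hom
        ((homologyMap (shiftProjection φ hB hW i.1 (basisCoordinate β i)) n).hom
          (homologyClass _ n z)) = homologyClass _ n (y i) :=
      (congrArg (homologyMap (shiftInclusion φ hB W i.1 (basisElement β i)) n).hom
        (homologyMap_homologyClass _ n z (map_mem_ker _ n z))).trans
        (homologyMap_homologyClass _ n _ _)
    have hz : z = ∑ i ∈ s, y i := by
      apply Subtype.ext
      rw [AddSubmonoidClass.coe_finsetSum]
      exact hs s (Finset.Subset.refl s)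
    conv_lhs => rw [hz, map_sum]
    exact Finset.sum_congr rfl fun i _ => (hy i).symm

end Kunneth

/-! ### Homology of tensor products with complexes annihilated by the maximal ideal -/

section TensorHomology
variable {R : Type u} [CommRing R] [IsLocalRing R]

/-- The homology of a shifted complex. -/
noncomputable def homologyShiftEquiv {S : Type u} [CommRing S]
    (W : CochainComplex (ModuleCat.{u} S) ℤ) (a n m : ℤ) (h : a + n = m) :
    (W⟦a⟧).homology n ≃ₗ[S] W.homology m :=
  ((CochainComplex.ShiftSequence.shiftIso (ModuleCat.{u} S) a n m h).app W).toLinearEquiv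

/-- The index set of a basis of the homology of the reduction of a complex modulo the maximal
ideal. -/
def residueBasisIndex (P : CochainComplex (ModuleCat.{u} R) ℤ) (p : ℤ) : Type u :=
  (exists_basis_of_isTorsionBySet (((reduction_isKilledBy (IsLocalRing.maximalIdeal R)
    P).homologyComplex).isTorsionBySet p)).choose

/-- A basis of the homology of the reduction of a complex modulo the maximal ideal. -/
noncomputable def residueBasis (P : CochainComplex (ModuleCat.{u} R) ℤ) (p : ℤ) :
    (homologyComplex (reduction (IsLocalRing.maximalIdeal R) P)).X p ≃ₗ[R]
      (residueBasisIndex P p →₀ IsLocalRing.ResidueField R) :=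
  (exists_basis_of_isTorsionBySet (((reduction_isKilledBy (IsLocalRing.maximalIdeal R)
    P).homologyComplex).isTorsionBySet p)).choose_spec.some

/-- The homology of the tensor product of a complex with a complex annihilated by the maximal
ideal. -/
theorem nonempty_homology_tensor_equiv (P : CochainComplex (ModuleCat.{u} R) ℤ)
    {S : Type u} [CommRing S] (φ : R →+* S) {W : CochainComplex (ModuleCat.{u} S) ℤ}
    (hW : IsKilledBy W ((IsLocalRing.maximalIdeal R).map φ)) (n : ℤ) :
    Nonempty ((tensorComplex φ P W).homology n ≃ₗ[S]
      DirectSum ℤ fun p => residueBasisIndex P p →₀ W.homology (n - p)) := by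
  classical
  obtain ⟨e₁⟩ := nonempty_homology_tensor_reduction φ P hW n
  -- The index sets come from `P` alone. The same sets occur for every `W`, so tensor products with
  -- different `W` can be compared.
  obtain ⟨e₂⟩ := nonempty_homology_tensor_equiv_shift φ (fun _ _ => rfl) hW (residueBasis P) n
  exact ⟨e₁ ≪≫ₗ e₂ ≪≫ₗ (DFinsupp.mapRange.linearEquiv fun i : Σ p, residueBasisIndex P p =>
    homologyShiftEquiv W (-i.1) n (n - i.1) (by lia)) ≪≫ₗ
    DirectSum.sigmaLcurryEquiv S (δ := fun p (_ : residueBasisIndex P p) => W.homology (n - p)) ≪≫ₗ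
    DFinsupp.mapRange.linearEquiv fun p =>
      (finsuppLEquivDirectSum S (W.homology (n - p)) (residueBasisIndex P p)).symm⟩

end TensorHomology

/-! ### Invariance of Tor, and its annihilation by 𝔫 -/

section TorInvariance
variable {R S : Type u} [CommRing R] [CommRing S] (φ : R →+* S)

/-- Tor is invariant under isomorphisms in the derived category. -/
lemma DerivedIso.nonempty_relTor_equiv {N N' : CochainComplex (ModuleCat.{u} S) ℤ}
    (h : DerivedIso N N') (n : ℤ) (L : CochainComplex (ModuleCat.{u} R) ℤ) :
    Nonempty (relTor φ n L N ≃ₗ[S] relTor φ n L N') := by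
  obtain ⟨f, _⟩ := h.exists_quasiIso_kProjRes
  have := quasiIso_tensorComplexMap φ (kProjRes L) f
  have := quasiIso_tensorComplexMap φ (kProjRes L) (kProjResHom N)
  exact ⟨(homologyEquiv (tensorComplexMap φ (𝟙 (kProjRes L)) (kProjResHom N)) (-n)).symm ≪≫ₗ
    homologyEquiv (tensorComplexMap φ (𝟙 (kProjRes L)) f) (-n)⟩

lemma homology_isTorsionBySet_of_iso {N N' : CochainComplex (ModuleCat.{u} S) ℤ} (e : N ≅ N')
    {I : Ideal S} (hN : I ≤ nullIdeal N') (n : ℤ) :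
    Module.IsTorsionBySet S (N.homology n) I := fun v s => by
  apply (homologyEquiv e.hom n).injective
  rw [map_smul, map_zero]
  exact smul_homology_eq_zero (hN s.2) n _

lemma homology_koszulOn_isTorsionBySet (x : List S) (M : CochainComplex (ModuleCat.{u} S) ℤ)
    (n : ℤ) : Module.IsTorsionBySet S ((koszulOn x M).homology n) (Ideal.ofList x) :=
  homology_isTorsionBySet_of_iso (koszulOnIso x M) (ofList_le_nullIdeal x M) n

/-- Tensor products with isomorphic complexes. -/
noncomputable def tensorComplexIsoRight (P : CochainComplex (ModuleCat.{u} R) ℤ)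
    {N N' : CochainComplex (ModuleCat.{u} S) ℤ} (e : N ≅ N') :
    tensorComplex φ P N ≅ tensorComplex φ P N' where
  hom := tensorComplexMap φ (𝟙 P) e.hom
  inv := tensorComplexMap φ (𝟙 P) e.inv
  hom_inv_id := (totalMap_comp (tensorFunctor φ) _ _ _ _).symm.trans (by
    rw [e.hom_inv_id, Category.comp_id]; exact totalMap_id _ _ _)
  inv_hom_id := (totalMap_comp (tensorFunctor φ) _ _ _ _).symm.trans (by
    rw [e.inv_hom_id, Category.comp_id]; exact totalMap_id _ _ _)

/-- Tensoring commutes with cones, so the complex that computes Tor is itself an iterated cone on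
`x`, where the elements of `x` act null-homotopically. -/
lemma relTor_koszulOn_isTorsionBySet (x : List S) (M : CochainComplex (ModuleCat.{u} S) ℤ)
    (n : ℤ) (L : CochainComplex (ModuleCat.{u} R) ℤ) :
    Module.IsTorsionBySet S (relTor φ n L (koszulOn x M)) (Ideal.ofList x) := by
  let e : tensorComplex φ (kProjRes L) (koszulOn x M) ≅
      iteratedKoszul x (tensorComplex φ (kProjRes L) M) :=
    tensorComplexIsoRight φ (kProjRes L) (koszulOnIso x M) ≪≫
    (tensorComplexIteratedKoszulIso φ (kProjRes L) M x).symm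
  exact homology_isTorsionBySet_of_iso e (ofList_le_nullIdeal x _) (-n)

end TorInvariance

/-! ### Modules as complexes, and direct sums with one nonzero summand -/

section SingleComplex
variable {R : Type u} [CommRing R]

lemma isKilledBy_complexOfModule {A : ModuleCat.{u} R} {I : Ideal R}
    (hA : Module.IsTorsionBySet R A I) : IsKilledBy (complexOfModule A) I := by
  intro s hs n v
  by_cases hn : n = 0
  · let e := (HomologicalComplex.singleObjXIsoOfEq (ComplexShape.up ℤ) 0 A n hn).toLinearEquiv
    apply e.injective
    rw [map_smul, map_zero]
    exact @hA (e v) ⟨s, hs⟩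
  · have := ModuleCat.isZero_iff_subsingleton.1
      (HomologicalComplex.isZero_single_obj_X (ComplexShape.up ℤ) 0 A n hn)
    exact Subsingleton.elim _ _

lemma subsingleton_homology_complexOfModule (A : ModuleCat.{u} R) (n : ℤ) (hn : n ≠ 0) :
    Subsingleton ((complexOfModule A).homology n) :=
  ModuleCat.isZero_iff_subsingleton.1
    (HomologicalComplex.isZero_single_obj_homology (ComplexShape.up ℤ) 0 A n hn)

/-- The homology in degree zero of a module, viewed as a complex. -/
noncomputable def homologyComplexOfModuleEquiv (A : ModuleCat.{u} R) (n : ℤ) (hn : n = 0) :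
    (complexOfModule A).homology n ≃ₗ[R] A :=
  (eqToIso (by rw [hn]) ≪≫
    HomologicalComplex.singleObjHomologySelfIso (ComplexShape.up ℤ) 0 A).toLinearEquiv

/-- A direct sum with one nonzero summand. -/
noncomputable def directSumEquivOfSubsingleton {ι : Type*} [DecidableEq ι] {A : ι → Type*}
    [∀ i, AddCommGroup (A i)] [∀ i, Module R (A i)] (q : ι) (h : ∀ p, p ≠ q → Subsingleton (A p)) :
    DirectSum ι A ≃ₗ[R] A q :=
  LinearEquiv.ofBijective (DirectSum.component R ι A q) ⟨fun v w hvw => DFinsupp.ext fun p => by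
      by_cases hp : p = q
      · subst hp; exact hvw
      · have := h p hp; exact Subsingleton.elim _ _,
    fun a => ⟨DirectSum.lof R ι A q a, DirectSum.component.lof_self _ _ _⟩⟩

/-- The homology of the tensor product with a module in the description through direct sums. -/
noncomputable def directSumHomologyComplexOfModuleEquiv (I : ℤ → Type u) (A : ModuleCat.{u} R)
    (n : ℤ) : (DirectSum ℤ fun p => I p →₀ (complexOfModule A).homology (n - p)) ≃ₗ[R]
      (I n →₀ A) :=
  directSumEquivOfSubsingleton (A := fun p => I p →₀ (complexOfModule A).homology (n - p)) n
    (fun p hp => by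
      have := subsingleton_homology_complexOfModule A (n - p) (by lia)
      infer_instance) ≪≫ₗ
    Finsupp.mapRange.linearEquiv (homologyComplexOfModuleEquiv A (n - n) (sub_self n))

end SingleComplex

/-! ### The Künneth formula over the residue fields -/

section ResidueTensor
variable {R S : Type u} [CommRing R] [IsLocalRing R] [CommRing S] [IsLocalRing S]

instance (H : ModuleCat.{u} S) (h : IsResidueModule H) : Module S (toResidue H h) :=
  inferInstanceAs (Module S H)

instance (H : ModuleCat.{u} S) (h : IsResidueModule H) :
    IsScalarTower S (IsLocalRing.ResidueField S) (toResidue H h) := by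
  let _ : Module (IsLocalRing.ResidueField S) H := h.module
  have : IsScalarTower S (IsLocalRing.ResidueField S) H := h.isScalarTower
  exact this

lemma nonempty_toResidue_equiv_of_eq {H : ℤ → ModuleCat.{u} S} (hH : ∀ n, IsResidueModule (H n))
    {m n : ℤ} (h : m = n) : Nonempty (toResidue (H m) (hH m) ≃ₗ[IsLocalRing.ResidueField S]
      toResidue (H n) (hH n)) := by
  subst h
  exact ⟨LinearEquiv.refl _ _⟩

/-- The tensor product over a field with a vector space with a basis. -/
lemma nonempty_tensorFunctor_equiv {k l : Type u} [CommRing k] [CommRing l] (ψ : k →+* l)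
    {T : ModuleCat.{u} k} {J : Type u} (e : T ≃ₗ[k] (J →₀ k)) (H : ModuleCat.{u} l) :
    Nonempty (((tensorFunctor ψ).obj T).obj H ≃ₗ[l] (J →₀ H)) := by
  classical
  let _ := ψ.toAlgebra
  let _ : Module k H := Module.compHom H ψ
  have : IsScalarTower k l H := ⟨fun a b h => mul_smul (ψ a) b h⟩
  let i : T ≅ ModuleCat.of k (J →₀ k) := e.toModuleIso
  exact ⟨(((tensorFunctor ψ).mapIso i).app H).toLinearEquiv ≪≫ₗ
    TensorProduct.finsuppScalarRight k l H J⟩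

/-- The equivalence which reindexes total degrees. -/
def antidiagonalEquiv (n : ℤ) : ℤ ≃ {p : ℤ × ℤ // p.1 + p.2 = n} where
  toFun p := ⟨(-p, n + p), by lia⟩
  invFun p := -p.1.1
  left_inv p := neg_neg p
  right_inv := by
    rintro ⟨⟨a, b⟩, h⟩
    have h' : a + b = n := h
    ext
    · exact neg_neg a
    · change n + -a = b
      lia

lemma map_residue_maximalIdeal :
    (IsLocalRing.maximalIdeal R).map (IsLocalRing.residue R) = ⊥ :=
  Ideal.map_quotient_self _

/-- Tor with coefficients in a complex which is isomorphic in the derived category to a complex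
annihilated by the maximal ideal. -/
lemma nonempty_relTor_equiv_directSum {S : Type u} [CommRing S] (φ : R →+* S)
    {N W : CochainComplex (ModuleCat.{u} S) ℤ} (h : DerivedIso N W)
    (hW : IsKilledBy W ((IsLocalRing.maximalIdeal R).map φ))
    (L : CochainComplex (ModuleCat.{u} R) ℤ) (n : ℤ) :
    Nonempty (relTor φ n L N ≃ₗ[S] DirectSum ℤ fun p =>
      residueBasisIndex (kProjRes L) p →₀ lowerHomology N (n + p)) := by
  obtain ⟨e₁⟩ := h.nonempty_relTor_equiv φ n L
  obtain ⟨e₂⟩ := nonempty_homology_tensor_equiv (kProjRes L) φ hW (-n)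
  let e₃ p := (h.symm.nonempty_homologyEquiv p).some
  exact ⟨e₁ ≪≫ₗ e₂ ≪≫ₗ DFinsupp.mapRange.linearEquiv fun p =>
    Finsupp.mapRange.linearEquiv (e₃ _ ≪≫ₗ (eqToIso (congrArg
      (fun m => N.homology m) (neg_add' n p).symm)).toLinearEquiv)⟩

/-- Let `I_p` index the chosen basis in cohomological degree `p`. Both sides are direct sums of
copies of `H_{n+p}(N)` indexed by `I_p`: on the left by the description of the tensor product with
`W`, on the right because `Tor_{-p}(L, k)` has a `k`-basis indexed by `I_p`. -/
theorem nonempty_toResidue_relTor_equiv (φ : R →+* S) [IsLocalHom φ]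
    {N W : CochainComplex (ModuleCat.{u} S) ℤ} (h : DerivedIso N W)
    (hW : IsKilledBy W ((IsLocalRing.maximalIdeal R).map φ))
    (L : CochainComplex (ModuleCat.{u} R) ℤ) (hT : ∀ n, IsResidueModule (relTor φ n L N))
    (hH : ∀ n, IsResidueModule (lowerHomology N n)) (n : ℤ) :
    Nonempty (toResidue (relTor φ n L N) (hT n)
      ≃ₗ[IsLocalRing.ResidueField S] DirectSum {p : ℤ × ℤ // p.1 + p.2 = n} fun p =>
        ((tensorFunctor (IsLocalRing.ResidueField.map φ)).obj
          (relTor (IsLocalRing.residue R) p.1.1 L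
            (complexOfModule (ModuleCat.of (IsLocalRing.ResidueField R)
              (IsLocalRing.ResidueField R))))).obj
          (toResidue (lowerHomology N p.1.2) (hH p.1.2))) := by
  let I := residueBasisIndex (kProjRes L)
  obtain ⟨e₄⟩ := nonempty_relTor_equiv_directSum φ h hW L n
  let e₅ : toResidue (relTor φ n L N) (hT n) ≃ₗ[S] DirectSum ℤ fun p =>
      (I p →₀ toResidue (lowerHomology N (n + p)) (hH (n + p))) := e₄
  -- An `S`-linear isomorphism of vector spaces over the residue field is linear over it, since `S`
  -- maps onto the residue field.
  have e₆ := e₅.extendScalarsOfSurjective (S := IsLocalRing.ResidueField S)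
    IsLocalRing.residue_surjective
  have hk : IsKilledBy (complexOfModule (ModuleCat.of (IsLocalRing.ResidueField R)
      (IsLocalRing.ResidueField R))) ((IsLocalRing.maximalIdeal R).map (IsLocalRing.residue R)) := by
    rw [map_residue_maximalIdeal]
    rintro s rfl n v
    exact zero_smul _ v
  have e₇ (p : {p : ℤ × ℤ // p.1 + p.2 = n}) :
      Nonempty ((I (-p.1.1) →₀ toResidue (lowerHomology N p.1.2) (hH p.1.2))
        ≃ₗ[IsLocalRing.ResidueField S]
        ((tensorFunctor (IsLocalRing.ResidueField.map φ)).obj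
          (relTor (IsLocalRing.residue R) p.1.1 L
            (complexOfModule (ModuleCat.of (IsLocalRing.ResidueField R)
              (IsLocalRing.ResidueField R))))).obj
          (toResidue (lowerHomology N p.1.2) (hH p.1.2))) := by
    -- The same description with `φ` the residue map and `W = k` concentrated in degree zero; it
    -- yields the basis of Tor over `k`.
    obtain ⟨e⟩ := nonempty_homology_tensor_equiv (kProjRes L) (IsLocalRing.residue R) hk (-p.1.1)
    obtain ⟨e'⟩ := nonempty_tensorFunctor_equiv (IsLocalRing.ResidueField.map φ)
      (T := relTor (IsLocalRing.residue R) p.1.1 L _)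
      (e ≪≫ₗ directSumHomologyComplexOfModuleEquiv I _ (-p.1.1))
      (toResidue (lowerHomology N p.1.2) (hH p.1.2))
    exact ⟨e'.symm⟩
  replace e₇ p := (e₇ p).some
  have e₈ (p : {p : ℤ × ℤ // p.1 + p.2 = n}) :
      Nonempty (toResidue (lowerHomology N (n + (antidiagonalEquiv n).symm p)) (hH _)
        ≃ₗ[IsLocalRing.ResidueField S] toResidue (lowerHomology N p.1.2) (hH p.1.2)) := by
    refine nonempty_toResidue_equiv_of_eq hH ?_
    change n + -p.1.1 = p.1.2
    have := p.2
    lia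
  replace e₈ p := (e₈ p).some
  exact ⟨e₆ ≪≫ₗ DirectSum.lequivCongrLeft (IsLocalRing.ResidueField S) (antidiagonalEquiv n) ≪≫ₗ
    DFinsupp.mapRange.linearEquiv fun p => Finsupp.mapRange.linearEquiv (e₈ p) ≪≫ₗ e₇ p⟩

end ResidueTensor

/-! ### Maps from a complex to a complex annihilated by the maximal ideal -/

section MapsToKilled
variable {R : Type u} [CommRing R] [IsLocalRing R]

open HomologicalComplex

lemma exists_linearMap_of_basis {A Y : Type u} [AddCommGroup A] [Module R A] [AddCommGroup Y]
    [Module R Y] {I : Type u} (β : A ≃ₗ[R] (I →₀ IsLocalRing.ResidueField R))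
    (hY : Module.IsTorsionBySet R Y (IsLocalRing.maximalIdeal R)) (y : I → Y) :
    ∃ g : A →ₗ[R] Y, ∀ i, g (β.symm (Finsupp.single i 1)) = y i := by
  let _ : Module (IsLocalRing.ResidueField R) Y := hY.module
  have : IsScalarTower R (IsLocalRing.ResidueField R) Y := hY.isScalarTower
  refine ⟨(Finsupp.linearCombination (IsLocalRing.ResidueField R) y).restrictScalars R ∘ₗ
    β.toLinearMap, fun i => ?_⟩
  simp

lemma linearMap_ext_of_basis {A Y : Type u} [AddCommGroup A] [Module R A] [AddCommGroup Y]
    [Module R Y] {I : Type u} (β : A ≃ₗ[R] (I →₀ IsLocalRing.ResidueField R)) {f g : A →ₗ[R] Y}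
    (h : ∀ i, f (β.symm (Finsupp.single i 1)) = g (β.symm (Finsupp.single i 1))) : f = g := by
  have key : f ∘ₗ β.symm.toLinearMap = g ∘ₗ β.symm.toLinearMap := by
    refine Finsupp.lhom_ext fun i c => ?_
    obtain ⟨r, rfl⟩ := IsLocalRing.residue_surjective c
    have : Finsupp.single i (IsLocalRing.residue R r) =
        r • Finsupp.single i (1 : IsLocalRing.ResidueField R) := by
      rw [Finsupp.smul_single, Algebra.smul_def, mul_one]
      rfl
    rw [this, map_smul, map_smul]
    exact congrArg (r • ·) (h i)
  ext a
  have := LinearMap.congr_fun key (β a)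
  simpa using this

variable (P : CochainComplex (ModuleCat.{u} R) ℤ)

/-- The homotopy equivalence from the reduction of a complex modulo the maximal ideal to
its homology. -/
noncomputable def reductionEquiv : HomotopyEquiv (reduction (IsLocalRing.maximalIdeal R) P)
    (homologyComplex (reduction (IsLocalRing.maximalIdeal R) P)) :=
  (nonempty_homotopyEquiv_homologyComplex
    (reduction_isKilledBy (IsLocalRing.maximalIdeal R) P)).some

lemma exists_residueCocycle (p : ℤ) (i : residueBasisIndex P p) :
    ∃ c : P.X p, (reductionHom (IsLocalRing.maximalIdeal R) P).f p c =
      (reductionEquiv P).inv.f p ((residueBasis P p).symm (Finsupp.single i 1)) :=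
  Submodule.mkQ_surjective _ _

/-- Elements of a complex that are cocycles modulo the maximal ideal, and represent the elements of
a basis of the homology of the reduction. -/
noncomputable def residueCocycle (p : ℤ) (i : residueBasisIndex P p) : P.X p :=
  (exists_residueCocycle P p i).choose

lemma reductionHom_residueCocycle (p : ℤ) (i : residueBasisIndex P p) :
    (reductionHom (IsLocalRing.maximalIdeal R) P).f p (residueCocycle P p i) =
      (reductionEquiv P).inv.f p ((residueBasis P p).symm (Finsupp.single i 1)) :=
  (exists_residueCocycle P p i).choose_spec

/-- Modulo 𝔪, the element is the image under a chain map of an element of a complex with zero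
differential. -/
lemma d_residueCocycle_mem (p q : ℤ) (i : residueBasisIndex P p) :
    P.d p q (residueCocycle P p i) ∈
      (IsLocalRing.maximalIdeal R • ⊤ : Submodule R (P.X q)) := by
  have h : (reductionHom (IsLocalRing.maximalIdeal R) P).f q (P.d p q (residueCocycle P p i)) =
      0 := by
    rw [hom_comm_apply, reductionHom_residueCocycle, ← hom_comm_apply]
    exact map_zero _
  exact (Submodule.Quotient.mk_eq_zero _).1 h

variable {P} {X : CochainComplex (ModuleCat.{u} R) ℤ}

lemma IsKilledBy.smul_top_eq_zero {I : Ideal R} (hX : IsKilledBy X I) {A : Type*} [AddCommGroup A]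
    [Module R A] {n : ℤ} (f : A →ₗ[R] X.X n) {a : A} (ha : a ∈ (I • ⊤ : Submodule R A)) :
    f a = 0 := by
  have : (I • ⊤ : Submodule R A) ≤ LinearMap.ker f := Submodule.smul_le.2 fun r hr a _ => by
    rw [LinearMap.mem_ker, map_smul]
    exact hX r hr n _
  exact this ha

/-- Morphisms to a complex annihilated by an ideal factor through the reduction. -/
noncomputable def reductionDesc {I : Ideal R} (hX : IsKilledBy X I) (f : P ⟶ X) :
    reduction I P ⟶ X where
  f n := ModuleCat.ofHom ((I • ⊤ : Submodule R (P.X n)).liftQ (f.f n).hom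
    (fun _ ha => hX.smul_top_eq_zero _ ha))
  comm' i j _ := by
    apply ModuleCat.hom_ext
    refine Submodule.linearMap_qext _ (LinearMap.ext fun x => ?_)
    exact (hom_comm_apply f i j x).symm

lemma reductionHom_desc {I : Ideal R} (hX : IsKilledBy X I) (f : P ⟶ X) :
    reductionHom I P ≫ reductionDesc hX f = f := rfl

/-- A morphism to a complex annihilated by the maximal ideal is null-homotopic if it maps the
chosen cocycles to coboundaries. -/
lemma nonempty_homotopy_zero_of_residueCocycle (hX : IsKilledBy X (IsLocalRing.maximalIdeal R))
    (f : P ⟶ X) (hf : ∀ (q p : ℤ) (_ : q + 1 = p) (i : residueBasisIndex P p),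
      ∃ y, X.d q p y = f.f p (residueCocycle P p i)) : Nonempty (Homotopy f 0) := by
  -- The map `f` factors through `P/𝔪P`, which is homotopy equivalent to its homology. On the
  -- homology the differential is zero, so a null-homotopy is a free choice, basis element by basis
  -- element, of elements of `X` bounding the images.
  let g := reductionDesc hX f
  have hg (p : ℤ) (i : residueBasisIndex P p) :
      ((reductionEquiv P).inv ≫ g).f p ((residueBasis P p).symm (Finsupp.single i 1)) =
        f.f p (residueCocycle P p i) :=
    congrArg (g.f p) (reductionHom_residueCocycle P p i).symm
  choose y hy using hf
  choose h hh using fun q p (hqp : q + 1 = p) =>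
    exists_linearMap_of_basis (residueBasis P p) (hX.isTorsionBySet q) (y q p hqp)
  obtain ⟨H⟩ := nonempty_homotopy_zero_of_elements ((reductionEquiv P).inv ≫ g)
    (fun p q hqp => h q p hqp) (fun q p r hqp hpr x => by
      have h₁ : (((reductionEquiv P).inv ≫ g).f p).hom = (X.d q p).hom ∘ₗ h q p hqp := by
        apply linearMap_ext_of_basis (residueBasis P p)
        intro i
        rw [LinearMap.comp_apply, hh]
        exact (hg p i).trans (hy q p hqp i).symm
      have h₂ : (homologyComplex (reduction (IsLocalRing.maximalIdeal R) P)).d p r x = 0 := rfl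
      rw [h₂, map_zero, zero_add]
      exact LinearMap.congr_fun h₁ x)
  have H₁ : Homotopy g 0 :=
    (Homotopy.ofEq (Category.id_comp g).symm).trans
      (((reductionEquiv P).homotopyHomInvId.symm.compRight g).trans
        ((Homotopy.ofEq (Category.assoc _ _ _)).trans
          ((H.compLeft (reductionEquiv P).hom).trans (Homotopy.ofEq comp_zero))))
  exact ⟨(Homotopy.ofEq (reductionHom_desc hX f).symm).trans
    ((H₁.compLeft (reductionHom _ P)).trans (Homotopy.ofEq comp_zero))⟩

/-- Morphisms to a complex annihilated by the maximal ideal can be prescribed on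
the chosen cocycles. -/
lemma exists_hom_residueCocycle (hX : IsKilledBy X (IsLocalRing.maximalIdeal R))
    (z : ∀ p, residueBasisIndex P p → X.X p) (hz : ∀ p q i, X.d p q (z p i) = 0) :
    ∃ f : P ⟶ X, ∀ p i, f.f p (residueCocycle P p i) = z p i := by
  choose h hh using fun p => exists_linearMap_of_basis (residueBasis P p) (hX.isTorsionBySet p) (z p)
  let g : homologyComplex (reduction (IsLocalRing.maximalIdeal R) P) ⟶ X :=
    { f p := ModuleCat.ofHom (h p)
      comm' p q _ := by
        have : (X.d p q).hom ∘ₗ h p = 0 := by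
          apply linearMap_ext_of_basis (residueBasis P p)
          intro i
          rw [LinearMap.comp_apply, hh]
          exact hz p q i
        ext v
        exact (LinearMap.congr_fun this v).trans (map_zero (h q)).symm }
  refine ⟨reductionHom _ P ≫ (reductionEquiv P).hom ≫ g, fun p i => ?_⟩
  have h₁ : g.f p ((reductionEquiv P).hom.f p ((reductionHom _ P).f p (residueCocycle P p i))) =
      g.f p ((reductionEquiv P).hom.f p ((reductionEquiv P).inv.f p
        ((residueBasis P p).symm (Finsupp.single i 1)))) := by rw [reductionHom_residueCocycle]
  -- On a complex with zero differential homotopic endomorphisms are equal, so this composite is the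
  -- identity on the nose.
  have h₂ : ((reductionEquiv P).inv ≫ (reductionEquiv P).hom).f p = 𝟙 _ := by
    have := (reductionEquiv P).homotopyInvHomId.comm p
    rw [dNext_eq _ (show (ComplexShape.up ℤ).Rel p (p + 1) from rfl),
      prevD_eq _ (show (ComplexShape.up ℤ).Rel (p - 1) p from by simp)] at this
    refine this.trans ?_
    have e₁ : (homologyComplex (reduction (IsLocalRing.maximalIdeal R) P)).d p (p + 1) = 0 := rfl
    have e₂ : (homologyComplex (reduction (IsLocalRing.maximalIdeal R) P)).d (p - 1) p = 0 := rfl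
    rw [e₁, e₂, zero_comp, comp_zero, add_zero, zero_add]
    rfl
  refine h₁.trans ?_
  refine Eq.trans ?_ (hh p i)
  exact congrArg (fun t : (homologyComplex (reduction (IsLocalRing.maximalIdeal R) P)).X p ⟶
    (homologyComplex (reduction (IsLocalRing.maximalIdeal R) P)).X p => g.f p (t ((residueBasis P p).symm (Finsupp.single i 1)))) h₂

end MapsToKilled

/-! ### Modules of morphisms, with scalars acting through the target -/

section HomModules
variable {S : Type u} [CommRing S] {D : Type*} [Category D] [Preadditive D]

/-- The morphisms from an object to the value of a functor on a complex of `S`-modules; it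
is an `S`-module through the action of `S` on the complex. -/
def HomModule (A : D) (G : CochainComplex (ModuleCat.{u} S) ℤ ⥤ D)
    (N : CochainComplex (ModuleCat.{u} S) ℤ) : Type _ := A ⟶ G.obj N

variable (A : D) (G : CochainComplex (ModuleCat.{u} S) ℤ ⥤ D) [G.Additive]
  {N N' N'' : CochainComplex (ModuleCat.{u} S) ℤ}

instance : AddCommGroup (HomModule A G N) := inferInstanceAs (AddCommGroup (A ⟶ G.obj N))

noncomputable instance : Module S (HomModule A G N) where
  smul s f := (f ≫ G.map (s • 𝟙 N) : A ⟶ G.obj N)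
  one_smul := fun (f : A ⟶ G.obj N) => show f ≫ G.map ((1 : S) • 𝟙 N) = f by
    rw [one_smul, G.map_id]; exact Category.comp_id _
  mul_smul := fun s t (f : A ⟶ G.obj N) => show f ≫ G.map ((s * t) • 𝟙 N) =
      (f ≫ G.map (t • 𝟙 N)) ≫ G.map (s • 𝟙 N) by
    rw [Category.assoc, ← G.map_comp, Linear.smul_comp, Linear.comp_smul, Category.id_comp,
      smul_smul, mul_comm]
  smul_zero s := zero_comp
  smul_add s f g := Preadditive.add_comp _ _ _ _ _ _
  add_smul := fun s t (f : A ⟶ G.obj N) => show f ≫ G.map ((s + t) • 𝟙 N) =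
      f ≫ G.map (s • 𝟙 N) + f ≫ G.map (t • 𝟙 N) by
    rw [add_smul, G.map_add, Preadditive.comp_add]
  zero_smul := fun (f : A ⟶ G.obj N) => show f ≫ G.map ((0 : S) • 𝟙 N) = 0 by
    rw [zero_smul, G.map_zero, comp_zero]

namespace HomModule

variable {A G}

lemma smul_comp_comm (s : S) (g : N ⟶ N') : (s • 𝟙 N) ≫ g = g ≫ (s • 𝟙 N') := by
  rw [Linear.smul_comp, Linear.comp_smul, Category.id_comp, Category.comp_id]

variable (A G) in
/-- The map induced by a morphism of complexes. -/
noncomputable def map (g : N ⟶ N') : HomModule A G N →ₗ[S] HomModule A G N' where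
  toFun f := (show A ⟶ G.obj N from f) ≫ G.map g
  map_add' f f' := Preadditive.add_comp _ _ _ _ _ _
  map_smul' := fun s (f : A ⟶ G.obj N) => by
    change (f ≫ G.map (s • 𝟙 N)) ≫ G.map g = (f ≫ G.map g) ≫ G.map (s • 𝟙 N')
    rw [Category.assoc, Category.assoc, ← G.map_comp, ← G.map_comp, smul_comp_comm]

variable (A G) in
/-- Isomorphic complexes have isomorphic modules of morphisms. -/
noncomputable def mapEquiv (e : N ≅ N') : HomModule A G N ≃ₗ[S] HomModule A G N' :=
  LinearEquiv.ofLinearMap (map A G e.hom) (map A G e.inv)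
    (LinearMap.ext fun (f : A ⟶ G.obj N') => by
      change (f ≫ G.map e.inv) ≫ G.map e.hom = f
      rw [Category.assoc, ← G.map_comp, e.inv_hom_id, G.map_id]; exact Category.comp_id _)
    (LinearMap.ext fun (f : A ⟶ G.obj N) => by
      change (f ≫ G.map e.hom) ≫ G.map e.inv = f
      rw [Category.assoc, ← G.map_comp, e.hom_inv_id, G.map_id]; exact Category.comp_id _)

variable (A) in
/-- Isomorphic functors, the second one composed with an endofunctor which is compatible
with multiplication, have isomorphic modules of morphisms. -/
noncomputable def isoEquiv {G : CochainComplex (ModuleCat.{u} S) ℤ ⥤ D} [G.Additive]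
    {G' : CochainComplex (ModuleCat.{u} S) ℤ ⥤ D} [G'.Additive]
    (F : CochainComplex (ModuleCat.{u} S) ℤ ⥤ CochainComplex (ModuleCat.{u} S) ℤ)
    (hF : ∀ (s : S) (N : CochainComplex (ModuleCat.{u} S) ℤ),
      F.map (s • 𝟙 N) = s • 𝟙 (F.obj N)) (e : G ≅ F ⋙ G')
    (N : CochainComplex (ModuleCat.{u} S) ℤ) :
    HomModule A G N ≃ₗ[S] HomModule A G' (F.obj N) where
  toFun f := (show A ⟶ G.obj N from f) ≫ e.hom.app N
  map_add' f f' := Preadditive.add_comp _ _ _ _ _ _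
  map_smul' := fun s (f : A ⟶ G.obj N) => by
    change (f ≫ G.map (s • 𝟙 N)) ≫ e.hom.app N = (f ≫ e.hom.app N) ≫ G'.map (s • 𝟙 (F.obj N))
    rw [Category.assoc, Category.assoc, e.hom.naturality, ← hF]
    rfl
  invFun f := (show A ⟶ G'.obj (F.obj N) from f) ≫ e.inv.app N
  left_inv := fun (f : A ⟶ G.obj N) => by
    change (f ≫ e.hom.app N) ≫ e.inv.app N = f
    rw [Category.assoc, Iso.hom_inv_id_app]; exact Category.comp_id _
  right_inv := fun (f : A ⟶ G'.obj (F.obj N)) => by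
    change (f ≫ e.inv.app N) ≫ e.hom.app N = f
    rw [Category.assoc, Iso.inv_hom_id_app]; exact Category.comp_id _

end HomModule
end HomModules

/-! ### Ext as homotopy classes of maps, and its derived invariance -/

section Ext
variable {R S : Type u} [CommRing R] [CommRing S] (φ : R →+* S)

/-- The functor from complexes of `S`-modules to the homotopy category of complexes of
`R`-modules. -/
noncomputable abbrev restrictQuotient :
    CochainComplex (ModuleCat.{u} S) ℤ ⥤ HomotopyCategory (ModuleCat.{u} R) (ComplexShape.up ℤ) :=
  (ModuleCat.restrictScalars φ).mapHomologicalComplex (ComplexShape.up ℤ) ⋙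
    HomotopyCategory.quotient _ _

/-- Homotopy classes of chain maps from a complex of `R`-modules to a complex of `S`-modules. -/
abbrev HomotopyClasses (P : CochainComplex (ModuleCat.{u} R) ℤ)
    (N : CochainComplex (ModuleCat.{u} S) ℤ) : Type u :=
  HomModule ((HomotopyCategory.quotient _ _).obj P) (restrictQuotient φ) N

/-- Ext in terms of chain maps to a shifted complex. -/
noncomputable def relExtEquiv (n : ℤ) (L : CochainComplex (ModuleCat.{u} R) ℤ)
    (N : CochainComplex (ModuleCat.{u} S) ℤ) :
    relExt φ n L N ≃ₗ[S] HomotopyClasses φ (kProjRes L) (N⟦n⟧) :=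
  let e : HomModule ((HomotopyCategory.quotient _ _).obj (kProjRes L)) (restrictShift φ n) N ≃ₗ[S]
      HomotopyClasses φ (kProjRes L) ((shiftFunctor _ n).obj N) :=
    HomModule.isoEquiv _ (shiftFunctor _ n)
      (fun s N => by rw [CategoryTheory.Functor.map_smul, CategoryTheory.Functor.map_id])
      ((Functor.associator _ _ _).symm ≪≫ ((restrictQuotient φ).commShiftIso n).symm) N
  { toFun := e
    map_add' := e.map_add
    map_smul' := e.map_smul
    invFun := e.symm
    left_inv := e.left_inv
    right_inv := e.right_inv }

variable {φ} {P : CochainComplex (ModuleCat.{u} R) ℤ} {N N' : CochainComplex (ModuleCat.{u} S) ℤ}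

/-- Quasi-isomorphisms induce isomorphisms on homotopy classes of chain maps from a K-projective
complex. -/
noncomputable def homotopyClassesEquiv [P.IsKProjective] (f : N ⟶ N') [QuasiIso f] :
    HomotopyClasses φ P N ≃ₗ[S] HomotopyClasses φ P N' :=
  LinearEquiv.ofBijective (HomModule.map _ _ f) <| by
    let _ : HasDerivedCategory (ModuleCat.{u} R) := HasDerivedCategory.standard _
    have hf : IsIso (DerivedCategory.Qh.map ((restrictQuotient φ).map f)) := by
      have : IsIso (DerivedCategory.Q.map
          (((ModuleCat.restrictScalars φ).mapHomologicalComplex (ComplexShape.up ℤ)).map f)) :=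
        inferInstance
      exact this
    -- Homotopy classes of maps out of a K-projective complex are its morphisms in the derived
    -- category, and there `f` becomes invertible.
    have h₁ := CochainComplex.IsKProjective.Qh_map_bijective P ((restrictQuotient φ).obj N)
    have h₂ := CochainComplex.IsKProjective.Qh_map_bijective P ((restrictQuotient φ).obj N')
    have h₃ : Function.Bijective fun g : DerivedCategory.Qh.obj
        ((HomotopyCategory.quotient _ _).obj P) ⟶
          DerivedCategory.Qh.obj ((restrictQuotient φ).obj N) =>
        g ≫ DerivedCategory.Qh.map ((restrictQuotient φ).map f) :=
      ⟨fun a b h => (cancel_mono _).1 h, fun a => ⟨a ≫ inv (DerivedCategory.Qh.map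
        ((restrictQuotient φ).map f)), by simp⟩⟩
    refine (h₂.of_comp_iff' _).1 ?_
    convert! h₃.comp h₁ using 1
    funext g
    exact DerivedCategory.Qh.map_comp _ _

/-- Ext is invariant under isomorphisms in the derived category. -/
lemma DerivedIso.nonempty_relExt_equiv (h : DerivedIso N N') (n : ℤ)
    (L : CochainComplex (ModuleCat.{u} R) ℤ) :
    Nonempty (relExt φ n L N ≃ₗ[S] relExt φ n L N') := by
  obtain ⟨f, _⟩ := h.exists_quasiIso_kProjRes
  exact ⟨relExtEquiv φ n L N ≪≫ₗ (homotopyClassesEquiv ((kProjResHom N)⟦n⟧')).symm ≪≫ₗ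
    homotopyClassesEquiv (f⟦n⟧') ≪≫ₗ (relExtEquiv φ n L N').symm⟩

end Ext

/-! ### The exact sequence of homotopy classes of maps to a cone -/

section ExtCone
variable {R S : Type u} [CommRing R] [CommRing S] {φ : R →+* S}
  {P : CochainComplex (ModuleCat.{u} R) ℤ} {N N' : CochainComplex (ModuleCat.{u} S) ℤ}
  (g : N ⟶ N')

open Pretriangulated CochainComplex HomotopyCategory

variable (φ) in
lemma restrict_triangleh_distinguished :
    ((ModuleCat.restrictScalars φ).mapHomotopyCategory (ComplexShape.up ℤ)).mapTriangle.obj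
      (mappingCone.triangleh g) ∈ distTriang _ :=
  Functor.map_distinguished _ _ (mappingCone_triangleh_distinguished g)

variable (φ N) in
/-- The compatibility of the restriction of scalars with shifts. -/
noncomputable def restrictQuotientShiftIso : (restrictQuotient φ).obj (N⟦(1 : ℤ)⟧) ≅
    ((restrictQuotient φ).obj N)⟦(1 : ℤ)⟧ :=
  ((ModuleCat.restrictScalars φ).mapHomotopyCategory (ComplexShape.up ℤ)).mapIso
    (((HomotopyCategory.quotient _ _).commShiftIso (1 : ℤ)).app N) ≪≫
  (((ModuleCat.restrictScalars φ).mapHomotopyCategory (ComplexShape.up ℤ)).commShiftIso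
    (1 : ℤ)).app ((HomotopyCategory.quotient _ _).obj N)

variable (φ) in
lemma restrictQuotientShiftIso_naturality :
    (restrictQuotient φ).map (g⟦(1 : ℤ)⟧') ≫ (restrictQuotientShiftIso φ N').hom =
      (restrictQuotientShiftIso φ N).hom ≫ ((restrictQuotient φ).map g)⟦(1 : ℤ)⟧' := by
  let F := (ModuleCat.restrictScalars φ).mapHomotopyCategory (ComplexShape.up ℤ)
  let Q := HomotopyCategory.quotient (ModuleCat.{u} S) (ComplexShape.up ℤ)
  change F.map (Q.map (g⟦(1 : ℤ)⟧')) ≫ F.map ((Q.commShiftIso (1 : ℤ)).hom.app N') ≫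
    (F.commShiftIso (1 : ℤ)).hom.app (Q.obj N') = (F.map ((Q.commShiftIso (1 : ℤ)).hom.app N) ≫
    (F.commShiftIso (1 : ℤ)).hom.app (Q.obj N)) ≫ (F.map (Q.map g))⟦(1 : ℤ)⟧'
  rw [Category.assoc, ← Functor.commShiftIso_hom_naturality, ← F.map_comp_assoc,
    Functor.commShiftIso_hom_naturality, F.map_comp_assoc]

variable (φ) in
-- The third morphism of the restricted triangle ends in the shift of the restriction of `N`,
-- whereas the scalar action is defined on maps to the restriction of the shift. The comparison
-- isomorphism allows exactness to be stated for the latter.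
lemma restrict_triangleh_mor₃ :
    (((ModuleCat.restrictScalars φ).mapHomotopyCategory (ComplexShape.up ℤ)).mapTriangle.obj
      (mappingCone.triangleh g)).mor₃ = (restrictQuotient φ).map (mappingCone.triangle g).mor₃ ≫
        (restrictQuotientShiftIso φ N).hom := by
  let F := (ModuleCat.restrictScalars φ).mapHomotopyCategory (ComplexShape.up ℤ)
  let Q := HomotopyCategory.quotient (ModuleCat.{u} S) (ComplexShape.up ℤ)
  change F.map (Q.map (mappingCone.triangle g).mor₃ ≫ (Q.commShiftIso (1 : ℤ)).hom.app N) ≫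
    (F.commShiftIso (1 : ℤ)).hom.app (Q.obj N) = F.map (Q.map (mappingCone.triangle g).mor₃) ≫
      F.map ((Q.commShiftIso (1 : ℤ)).hom.app N) ≫ (F.commShiftIso (1 : ℤ)).hom.app (Q.obj N)
  exact (congrArg (· ≫ (F.commShiftIso (1 : ℤ)).hom.app (Q.obj N)) (F.map_comp _ _)).trans
    (Category.assoc _ _ _)

/-- Morphisms from a fixed object to a distinguished triangle form an exact sequence; here at the
target of `g`. -/
lemma exists_map_eq_of_map_inr_eq_zero (f : HomotopyClasses φ P N')
    (hf : HomModule.map _ _ (mappingCone.inr g) f = 0) :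
    ∃ f₀ : HomotopyClasses φ P N, HomModule.map _ _ g f₀ = f := by
  obtain ⟨f₀, h⟩ := Triangle.coyoneda_exact₂ _ (restrict_triangleh_distinguished φ g) f hf
  exact ⟨f₀, h.symm⟩

lemma exists_map_inr_eq_of_map_mor₃_eq_zero (f : HomotopyClasses φ P (mappingCone g))
    (hf : HomModule.map _ _ (mappingCone.triangle g).mor₃ f = 0) :
    ∃ f₀ : HomotopyClasses φ P N', HomModule.map _ _ (mappingCone.inr g) f₀ = f := by
  let f' : (HomotopyCategory.quotient _ _).obj P ⟶ (restrictQuotient φ).obj (mappingCone g) := f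
  obtain ⟨f₀, h⟩ := Triangle.coyoneda_exact₃ _ (restrict_triangleh_distinguished φ g) f' (by
    rw [restrict_triangleh_mor₃]
    refine (Category.assoc _ _ _).symm.trans ?_
    exact (congrArg (fun t : (HomotopyCategory.quotient _ _).obj P ⟶
      (restrictQuotient φ).obj (N⟦(1 : ℤ)⟧) => t ≫ (restrictQuotientShiftIso φ N).hom) hf).trans
        zero_comp)
  exact ⟨f₀, h.symm⟩

lemma exists_map_mor₃_eq_of_map_eq_zero (f : HomotopyClasses φ P (N⟦(1 : ℤ)⟧))
    (hf : HomModule.map _ _ (g⟦(1 : ℤ)⟧') f = 0) :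
    ∃ f₀ : HomotopyClasses φ P (mappingCone g),
      HomModule.map _ _ (mappingCone.triangle g).mor₃ f₀ = f := by
  let f' : (HomotopyCategory.quotient _ _).obj P ⟶ (restrictQuotient φ).obj (N⟦(1 : ℤ)⟧) := f
  have hf' : f' ≫ (restrictQuotient φ).map (g⟦(1 : ℤ)⟧') = 0 := hf
  have h₁ : (f' ≫ (restrictQuotientShiftIso φ N).hom) ≫ ((restrictQuotient φ).map g)⟦(1 : ℤ)⟧' =
      0 := by
    rw [Category.assoc, ← restrictQuotientShiftIso_naturality]
    exact (Category.assoc _ _ _).symm.trans ((congrArg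
      (· ≫ (restrictQuotientShiftIso φ N').hom) hf').trans zero_comp)
  obtain ⟨f₀, h⟩ := Triangle.coyoneda_exact₁ _ (restrict_triangleh_distinguished φ g)
    (f' ≫ (restrictQuotientShiftIso φ N).hom) h₁
  refine ⟨f₀, ?_⟩
  rw [restrict_triangleh_mor₃] at h
  have h₂ := h.trans (Category.assoc _ _ _).symm
  exact ((cancel_mono (restrictQuotientShiftIso φ N).hom).1 h₂).symm

/-- The length of the module of homotopy classes of maps to the cone of a morphism
which induces zero. -/
lemma length_homotopyClasses_cone
    (h₀ : ∀ f : HomotopyClasses φ P N, HomModule.map _ _ g f = 0)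
    (h₁ : ∀ f : HomotopyClasses φ P (N⟦(1 : ℤ)⟧), HomModule.map _ _ (g⟦(1 : ℤ)⟧') f = 0) :
    Module.length S (HomotopyClasses φ P (mappingCone g)) =
      Module.length S (HomotopyClasses φ P N') +
        Module.length S (HomotopyClasses φ P (N⟦(1 : ℤ)⟧)) := by
  refine Module.length_eq_add_of_exact (HomModule.map _ _ (mappingCone.inr g))
    (HomModule.map _ _ (mappingCone.triangle g).mor₃) ?_ ?_ ?_
  · rw [← LinearMap.ker_eq_bot, LinearMap.ker_eq_bot']
    intro f hf
    obtain ⟨f₀, rfl⟩ := exists_map_eq_of_map_inr_eq_zero g f hf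
    exact h₀ f₀
  · intro f
    obtain ⟨f₀, rfl⟩ := exists_map_mor₃_eq_of_map_eq_zero g f (h₁ f)
    exact ⟨f₀, rfl⟩
  · intro f
    constructor
    · intro hf
      exact exists_map_inr_eq_of_map_mor₃_eq_zero g f hf
    · rintro ⟨f₀, rfl⟩
      have h : mappingCone.inr g ≫ (mappingCone.triangle g).mor₃ = 0 := by
        simp
      have h' : (restrictQuotient φ).map (mappingCone.inr g) ≫
          (restrictQuotient φ).map (mappingCone.triangle g).mor₃ = 0 := by
        exact ((restrictQuotient φ).map_comp _ _).symm.trans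
          ((congrArg (fun t : N' ⟶ N⟦(1 : ℤ)⟧ => (restrictQuotient φ).map t) h).trans
            ((restrictQuotient φ).map_zero _ _))
      let f₁ : (HomotopyCategory.quotient _ _).obj P ⟶ (restrictQuotient φ).obj N' := f₀
      change (f₁ ≫ (restrictQuotient φ).map (mappingCone.inr g)) ≫
        (restrictQuotient φ).map (mappingCone.triangle g).mor₃ = 0
      rw [Category.assoc, h', comp_zero]

end ExtCone

/-! ### Homotopy classes of maps to a complex annihilated by the maximal ideal -/

section ExtKilled
variable {R S : Type u} [CommRing R] [IsLocalRing R] [CommRing S] {φ : R →+* S}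
  (P : CochainComplex (ModuleCat.{u} R) ℤ) {W : CochainComplex (ModuleCat.{u} S) ℤ}

/-- The differential of a chosen cocycle lies in `𝔪P`, which `f` sends to zero. -/
lemma map_residueCocycle_mem_ker (hW : IsKilledBy (restrict φ W) (IsLocalRing.maximalIdeal R)) (f : P ⟶ restrict φ W) (p : ℤ) (i : residueBasisIndex P p) :
    f.f p (residueCocycle P p i) ∈ LinearMap.ker (W.d p (p + 1)).hom :=
  (hom_comm_apply f p (p + 1) (residueCocycle P p i)).symm.trans
    (hW.smul_top_eq_zero (f.f (p + 1)).hom (d_residueCocycle_mem P p (p + 1) i))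

/-- The cohomology classes of the images of the chosen cocycles. -/
noncomputable def evalResidueCocycle (hW : IsKilledBy (restrict φ W) (IsLocalRing.maximalIdeal R))
    (f : P ⟶ restrict φ W) (p : ℤ) (i : residueBasisIndex P p) :
    W.homology p :=
  homologyClass W p ⟨f.f p (residueCocycle P p i), map_residueCocycle_mem_ker P hW f p i⟩

variable (hW : IsKilledBy (restrict φ W) (IsLocalRing.maximalIdeal R))

lemma evalResidueCocycle_add (f g : P ⟶ restrict φ W) :
    evalResidueCocycle P hW (f + g) = evalResidueCocycle P hW f + evalResidueCocycle P hW g := by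
  funext p i
  exact map_add (homologyClass W p) ⟨f.f p (residueCocycle P p i), _⟩ ⟨g.f p _, _⟩

lemma evalResidueCocycle_smul (f : P ⟶ restrict φ W) (s : S) :
    evalResidueCocycle P hW (f ≫ ((ModuleCat.restrictScalars φ).mapHomologicalComplex _).map
      (s • 𝟙 W)) = s • evalResidueCocycle P hW f := by
  funext p i
  exact map_smul (homologyClass W p) s ⟨f.f p (residueCocycle P p i), _⟩

/-- If all classes vanish, the bounding elements define a null-homotopy. Conversely, a null-homotopy
sends the differential of a chosen cocycle, an element of `𝔪P`, to zero, so the value of `f` on the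
cocycle is a boundary. -/
lemma evalResidueCocycle_eq_zero_iff (f : P ⟶ restrict φ W) :
    evalResidueCocycle P hW f = 0 ↔ Nonempty (Homotopy f 0) := by
  constructor
  · intro h
    refine nonempty_homotopy_zero_of_residueCocycle hW f fun q p hqp i => ?_
    have := congrFun (congrFun h p) i
    exact (homologyClass_eq_zero_iff W q p hqp _).1 this
  · rintro ⟨H⟩
    funext p i
    refine (homologyClass_eq_zero_iff W (p - 1) p (by lia) _).2 ?_
    refine ⟨H.hom p (p - 1) (residueCocycle P p i), ?_⟩
    have h := homotopy_zero_elements H (p - 1) p (p + 1) (by lia) rfl (residueCocycle P p i)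
    refine Eq.trans ?_ h.symm
    have h₂ : H.hom (p + 1) p (P.d p (p + 1) (residueCocycle P p i)) = 0 :=
      hW.smul_top_eq_zero (H.hom (p + 1) p).hom (d_residueCocycle_mem P p (p + 1) i)
    rw [h₂, zero_add]
    rfl

/-- Homotopy classes of chain maps to a complex annihilated by the maximal ideal. -/
lemma nonempty_homotopyClasses_equiv
    (hW : IsKilledBy (restrict φ W) (IsLocalRing.maximalIdeal R)) :
    Nonempty (HomotopyClasses φ P W ≃ₗ[S] ∀ p, residueBasisIndex P p → W.homology p) := by
  let Q := HomotopyCategory.quotient (ModuleCat.{u} R) (ComplexShape.up ℤ)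
  have hQ (f : P ⟶ restrict φ W) : Q.map f = 0 ↔ evalResidueCocycle P hW f = 0 := by
    rw [evalResidueCocycle_eq_zero_iff]
    refine ⟨fun h => ⟨HomotopyCategory.homotopyOfEq _ _ (h.trans (Q.map_zero _ _).symm)⟩, fun ⟨H⟩ =>
      (HomotopyCategory.eq_of_homotopy _ _ H).trans (Q.map_zero _ _)⟩
  have hQ' (f g : P ⟶ restrict φ W) (h : Q.map f = Q.map g) :
      evalResidueCocycle P hW f = evalResidueCocycle P hW g := by
    have h₁ : Q.map (f - g) = 0 := by rw [Q.map_sub, h, sub_self]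
    have h₂ := evalResidueCocycle_add P hW (f - g) g
    rw [(hQ _).1 h₁, zero_add, sub_add_cancel] at h₂
    exact h₂
  -- Evaluation on classes uses arbitrary representatives `r f`; it is additive and `S`-linear
  -- because, by `hQ'`, homotopic maps have equal evaluations.
  have hs (f : HomotopyClasses φ P W) : ∃ f' : P ⟶ restrict φ W, Q.map f' = f := Q.map_surjective f
  choose r hr using hs
  let ev : HomotopyClasses φ P W →ₗ[S] ∀ p, residueBasisIndex P p → W.homology p :=
    { toFun f := evalResidueCocycle P hW (r f)
      map_add' f g := by
        rw [← evalResidueCocycle_add]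
        refine hQ' _ _ ((hr _).trans ?_)
        rw [Q.map_add, hr, hr]
        rfl
      map_smul' s f := by
        rw [RingHom.id_apply, ← evalResidueCocycle_smul]
        refine hQ' _ _ ((hr _).trans ?_)
        rw [Q.map_comp, hr]
        rfl }
  refine ⟨LinearEquiv.ofBijective ev ⟨?_, ?_⟩⟩
  · rw [← LinearMap.ker_eq_bot, LinearMap.ker_eq_bot']
    intro f hf
    exact (hr f).symm.trans ((hQ _).2 hf)
  · intro z
    have hz (p : ℤ) (i : residueBasisIndex P p) := homologyClass_surjective W p (z p i)
    choose c hc using hz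
    obtain ⟨f, hf⟩ := exists_hom_residueCocycle (P := P) hW (fun p i => (c p i).1) (fun p q i => by
      by_cases h : p + 1 = q
      · subst h
        exact (c p i).2
      · rw [HomologicalComplex.shape _ _ _ h]
        rfl)
    refine ⟨Q.map f, ?_⟩
    refine (hQ' _ f (hr _)).trans ?_
    funext p i
    refine Eq.trans ?_ (hc p i)
    exact congrArg (homologyClass W p) (Subtype.ext (hf p i))

end ExtKilled

/-! ### Null-homotopic scalars on resolutions, tensor products and maps -/

section ResidueNull
variable {R S : Type u} [CommRing R] [CommRing S]

/-- Multiplication by `z` on `L` is zero, so on the resolution it is zero in the derived category;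
by K-projectivity it is then null-homotopic. -/
lemma mem_nullIdeal_kProjRes {L : CochainComplex (ModuleCat.{u} R) ℤ} {I : Ideal R}
    (hL : IsKilledBy L I) {z : R} (hz : z ∈ I) : z ∈ nullIdeal (kProjRes L) := by
  let _ : HasDerivedCategory (ModuleCat.{u} R) := HasDerivedCategory.standard _
  have h₀ : (z • 𝟙 (kProjRes L)) ≫ kProjResHom L = 0 := by
    ext n x
    refine (map_smul ((kProjResHom L).f n).hom z x).trans ?_
    exact hL z hz n ((kProjResHom L).f n x)
  have h₁ : DerivedCategory.Q.map (z • 𝟙 (kProjRes L)) = 0 := by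
    rw [← cancel_mono (DerivedCategory.Q.map (kProjResHom L)), ← Functor.map_comp, h₀,
      Functor.map_zero, zero_comp]
  have h₂ : (HomotopyCategory.quotient _ _).map (z • 𝟙 (kProjRes L)) = 0 :=
    (CochainComplex.IsKProjective.Qh_map_bijective (kProjRes L) _).injective
      (h₁.trans (Functor.map_zero _ _ _).symm)
  exact ⟨HomotopyCategory.homotopyOfEq _ _ (h₂.trans (Functor.map_zero _ _ _).symm)⟩

variable (φ : R →+* S)

lemma tensorFunctor_smul_map (z : R) (A : ModuleCat.{u} R) (B : ModuleCat.{u} S) :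
    ((tensorFunctor φ).map (z • 𝟙 A)).app B = φ z • 𝟙 _ :=
  ModuleCat.hom_ext (tensorMap_ext φ fun n l => (TensorProduct.smul_tmul z n l).symm)

lemma totalMap_smul_id (z : R) (P : CochainComplex (ModuleCat.{u} R) ℤ)
    (N : CochainComplex (ModuleCat.{u} S) ℤ) :
    tensorComplexMap φ (z • 𝟙 P) (𝟙 N) = φ z • 𝟙 (tensorComplex φ P N) := by
  change totalMap (tensorFunctor φ) (z • 𝟙 P) (𝟙 N) = φ z • 𝟙 (total (tensorFunctor φ) P N)
  ext n : 1
  apply HomologicalComplex.mapBifunctor.hom_ext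
  intro i j h
  refine (HomologicalComplex.ι_mapBifunctorMap _ _ _ _ _ _ _ _).trans ?_
  have h₁ : ((tensorFunctor φ).map ((z • 𝟙 P : P ⟶ P).f i)).app (N.X j) = φ z • 𝟙 _ :=
    tensorFunctor_smul_map φ z _ _
  have h₂ : (φ z • 𝟙 (total (tensorFunctor φ) P N) :
    total (tensorFunctor φ) P N ⟶ total (tensorFunctor φ) P N).f n = φ z • 𝟙 _ := rfl
  rw [h₁, h₂, HomologicalComplex.id_f, CategoryTheory.Functor.map_id, Category.id_comp,
    Linear.smul_comp, Linear.comp_smul, Category.id_comp]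
  exact congrArg (φ z • ·) (Category.comp_id _).symm

lemma map_mem_nullIdeal_tensorComplex {P : CochainComplex (ModuleCat.{u} R) ℤ} {z : R}
    (hz : z ∈ nullIdeal P) (N : CochainComplex (ModuleCat.{u} S) ℤ) :
    φ z ∈ nullIdeal (tensorComplex φ P N) := by
  obtain ⟨H⟩ := hz
  refine ⟨(Homotopy.ofEq (totalMap_smul_id φ z P N).symm).trans
    ((HomologicalComplex.mapBifunctorMapHomotopy₁ H (𝟙 N) (tensorFunctor φ)
      (ComplexShape.up ℤ)).trans (Homotopy.ofEq ?_))⟩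
  exact totalMap_zero_left _ _

lemma mem_nullIdeal_tensorComplex (P : CochainComplex (ModuleCat.{u} R) ℤ)
    {N : CochainComplex (ModuleCat.{u} S) ℤ} {s : S} (hs : s ∈ nullIdeal N) :
    s ∈ nullIdeal (tensorComplex φ P N) := by
  obtain ⟨H⟩ := hs
  refine ⟨(Homotopy.ofEq (totalMap_smul_right _ (tensorFunctor_map_smul φ) s P N).symm).trans
    ((HomologicalComplex.mapBifunctorMapHomotopy₂ (𝟙 P) H (tensorFunctor φ)
      (ComplexShape.up ℤ)).trans (Homotopy.ofEq ?_))⟩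
  exact totalMap_zero_right _ _

lemma nullIdeal_le_shift (N : CochainComplex (ModuleCat.{u} S) ℤ) (n : ℤ) :
    nullIdeal N ≤ nullIdeal (N⟦n⟧) := by
  rintro s ⟨H⟩
  refine ⟨(Homotopy.ofEq ?_).trans ((H.shift n).trans (Homotopy.ofEq (Functor.map_zero _ _ _)))⟩
  rw [CategoryTheory.Functor.map_smul, CategoryTheory.Functor.map_id]

variable {φ}

lemma smul_homotopyClasses_eq_zero (P : CochainComplex (ModuleCat.{u} R) ℤ)
    {N : CochainComplex (ModuleCat.{u} S) ℤ} {s : S} (hs : s ∈ nullIdeal N)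
    (f : HomotopyClasses φ P N) : s • f = 0 := by
  obtain ⟨H⟩ := hs
  have h : (restrictQuotient φ).map (s • 𝟙 N) = 0 :=
    (HomotopyCategory.eq_of_homotopy _ _
      ((ModuleCat.restrictScalars φ).mapHomotopy H)).trans ((restrictQuotient φ).map_zero _ _)
  let f' : (HomotopyCategory.quotient _ _).obj P ⟶ (restrictQuotient φ).obj N := f
  change f' ≫ (restrictQuotient φ).map (s • 𝟙 N) = 0
  rw [h, comp_zero]

/-- By `R`-linearity of chain maps, multiplication by `φ z` on the target equals multiplication by
`z` on the source. -/
lemma map_smul_homotopyClasses_eq_zero {P : CochainComplex (ModuleCat.{u} R) ℤ} {z : R}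
    (hz : z ∈ nullIdeal P) {N : CochainComplex (ModuleCat.{u} S) ℤ}
    (f : HomotopyClasses φ P N) : φ z • f = 0 := by
  obtain ⟨H⟩ := hz
  let Q := HomotopyCategory.quotient (ModuleCat.{u} R) (ComplexShape.up ℤ)
  obtain ⟨f', rfl⟩ : ∃ f' : P ⟶ restrict φ N, Q.map f' = f := Q.map_surjective f
  have h : (f' ≫ ((ModuleCat.restrictScalars φ).mapHomologicalComplex _).map (φ z • 𝟙 N)) =
      (z • 𝟙 P) ≫ f' := by
    ext n x
    exact ((f'.f n).hom.map_smul z x).symm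
  refine Eq.trans (b := Q.map ((z • 𝟙 P) ≫ f')) ?_ ?_
  · rw [← h]
    exact (Q.map_comp _ _).symm
  · exact (HomotopyCategory.eq_of_homotopy _ _ ((H.compRight f').trans
      (Homotopy.ofEq zero_comp))).trans (Q.map_zero _ _)

end ResidueNull

/-! ### Lengths of Tor and Ext under iterated cones, and the change of Koszul complex -/

section LengthFunctions
variable {R S : Type u} [CommRing R] [IsLocalRing R] [CommRing S]

/-- Numerical invariants of complexes which behave like the lengths of the cohomology of
cohomological functors of `R`-modules that vanish on multiplication by elements of the maximal
ideal. -/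
structure IsLengthFunction (φ : R →+* S)
    (T : CochainComplex (ModuleCat.{u} S) ℤ → ℤ → ℕ∞) : Prop where
  congr {N N' : CochainComplex (ModuleCat.{u} S) ℤ} (h : DerivedIso N N') : T N = T N'
  cone_of_mem_nullIdeal {N : CochainComplex (ModuleCat.{u} S) ℤ} {s : S} (hs : s ∈ nullIdeal N)
    (n : ℤ) : T (CochainComplex.mappingCone (s • 𝟙 N)) n = T N n + T N (n + 1)
  cone_of_mem_maximalIdeal (N : CochainComplex (ModuleCat.{u} S) ℤ) {z : R}
    (hz : z ∈ IsLocalRing.maximalIdeal R) (n : ℤ) :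
    T (CochainComplex.mappingCone (φ z • 𝟙 N)) n = T N n + T N (n + 1)

variable (φ : R →+* S)

/-- The lengths of the cohomology of `k ⊗ N`. -/
noncomputable def torLength (N : CochainComplex (ModuleCat.{u} S) ℤ) (n : ℤ) : ℕ∞ :=
  Module.length S ((tensorComplex φ (kProjRes (residueComplex R)) N).homology n)

/-- The lengths of the cohomology of `RHom(k, N)`. -/
noncomputable def extLength (N : CochainComplex (ModuleCat.{u} S) ℤ) (n : ℤ) : ℕ∞ :=
  Module.length S (HomotopyClasses φ (kProjRes (residueComplex R)) (N⟦n⟧))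

lemma residueField_isTorsionBySet : Module.IsTorsionBySet R (IsLocalRing.ResidueField R)
    (IsLocalRing.maximalIdeal R) := by
  intro x r
  obtain ⟨x, rfl⟩ := IsLocalRing.residue_surjective x
  change IsLocalRing.residue R (r * x) = 0
  rw [IsLocalRing.residue_eq_zero_iff]
  exact Ideal.mul_mem_right _ _ r.2

lemma maximalIdeal_le_nullIdeal_kProjRes :
    IsLocalRing.maximalIdeal R ≤ nullIdeal (kProjRes (residueComplex R)) := fun _ hz =>
  mem_nullIdeal_kProjRes (isKilledBy_complexOfModule residueField_isTorsionBySet) hz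

/-- Tensoring commutes with cones, and both kinds of scalars are null-homotopic on the tensor
product with the resolution of `k`: elements of the null ideal through `N`, elements of 𝔪 through
`k`. The homology sequence of the cone then breaks into short exact sequences. -/
lemma isLengthFunction_torLength : IsLengthFunction φ (torLength φ) := by
  have key (N : CochainComplex (ModuleCat.{u} S) ℤ) (s : S)
      (hs : s ∈ nullIdeal (tensorComplex φ (kProjRes (residueComplex R)) N)) (n : ℤ) :
      torLength φ (CochainComplex.mappingCone (s • 𝟙 N)) n =
        torLength φ N n + torLength φ N (n + 1) := by
    have h (m : ℤ) : HomologicalComplex.homologyMap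
        (s • 𝟙 (tensorComplex φ (kProjRes (residueComplex R)) N)) m = 0 := by
      obtain ⟨H⟩ := hs
      rw [H.homologyMap_eq, HomologicalComplex.homologyMap_zero]
    refine Eq.trans ?_ (length_homology_cone _ n (n + 1) rfl (h _) (h _))
    exact (homologyEquiv (tensorComplexIteratedKoszulIso φ (kProjRes (residueComplex R)) N
      [s]).inv n).length_eq
  refine ⟨fun {N N'} h => ?_, fun {N s} hs n => key N s (mem_nullIdeal_tensorComplex φ _ hs) n,
    fun N {z} hz n => key N _ (map_mem_nullIdeal_tensorComplex φ
      (maximalIdeal_le_nullIdeal_kProjRes hz) N) n⟩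
  funext n
  obtain ⟨e⟩ := h.nonempty_relTor_equiv φ (-n) (residueComplex R)
  have := e.length_eq
  change Module.length S ((tensorComplex φ (kProjRes (residueComplex R)) N).homology (- -n)) =
    Module.length S ((tensorComplex φ (kProjRes (residueComplex R)) N').homology (- -n)) at this
  rwa [neg_neg] at this

lemma extLength_eq (N : CochainComplex (ModuleCat.{u} S) ℤ) (n : ℤ) :
    extLength φ N n = Module.length S (relExt φ n (residueComplex R) N) :=
  (relExtEquiv φ n (residueComplex R) N).length_eq.symm

/-- The same argument with homotopy classes of maps. The shift of a cone is identified with the cone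
of the shifted map, so that the sequence for the triangle of `N⟦n⟧` applies. -/
lemma isLengthFunction_extLength : IsLengthFunction φ (extLength φ) := by
  have key (N : CochainComplex (ModuleCat.{u} S) ℤ) (s : S)
      (hs : ∀ m (f : HomotopyClasses φ (kProjRes (residueComplex R)) (N⟦(m : ℤ)⟧)), s • f = 0)
      (n : ℤ) : extLength φ (CochainComplex.mappingCone (s • 𝟙 N)) n =
        extLength φ N n + extLength φ N (n + 1) := by
    let e₁ : N⟦n⟧⟦(1 : ℤ)⟧ ≅ N⟦n + 1⟧ := ((shiftFunctorAdd _ n 1).app N).symm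
    have h₁ : (s • 𝟙 N)⟦n⟧' = s • 𝟙 (N⟦n⟧) := by
      rw [CategoryTheory.Functor.map_smul, CategoryTheory.Functor.map_id]
    have h₂ : (s • 𝟙 (N⟦n⟧))⟦(1 : ℤ)⟧' = s • 𝟙 (N⟦n⟧⟦(1 : ℤ)⟧) := by
      rw [CategoryTheory.Functor.map_smul, CategoryTheory.Functor.map_id]
    let e₂ : (CochainComplex.mappingCone (s • 𝟙 N))⟦n⟧ ≅
        CochainComplex.mappingCone (s • 𝟙 (N⟦n⟧)) :=
      CochainComplex.mappingCone.shiftIso (s • 𝟙 N) n ≪≫ eqToIso (by rw [h₁])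
    refine (HomModule.mapEquiv _ _ e₂).length_eq.trans ?_
    refine (length_homotopyClasses_cone _ (fun f => hs n f) (fun f => ?_)).trans ?_
    · rw [h₂]
      apply (HomModule.mapEquiv _ _ e₁).injective
      rw [map_zero]
      change HomModule.mapEquiv _ _ e₁ (s • f) = 0
      rw [map_smul]
      exact hs _ _
    · exact congrArg (Module.length S (HomotopyClasses φ (kProjRes (residueComplex R)) (N⟦n⟧)) + ·)
        (HomModule.mapEquiv _ _ e₁).length_eq
  refine ⟨fun {N N'} h => ?_, fun {N s} hs n => key N s (fun m f =>
      smul_homotopyClasses_eq_zero _ (nullIdeal_le_shift N m hs) f) n,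
    fun N {z} hz n => key N _ (fun m f => map_smul_homotopyClasses_eq_zero
      (maximalIdeal_le_nullIdeal_kProjRes hz) f) n⟩
  funext n
  obtain ⟨e⟩ := h.nonempty_relExt_equiv (φ := φ) n (residueComplex R)
  rw [extLength_eq, extLength_eq]
  exact e.length_eq

/-- The sum of a sequence and its shift. -/
def shiftSum (a : ℤ → ℕ∞) (n : ℤ) : ℕ∞ := a n + a (n + 1)

variable {φ} {T : CochainComplex (ModuleCat.{u} S) ℤ → ℤ → ℕ∞}

/-- Scalars that are null-homotopic on `N` remain so on every partial cone, so each further cone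
replaces the length sequence by its sum with its shift. The first assertion is what the induction
for the second requires. -/
lemma IsLengthFunction.iteratedKoszul_of_le_nullIdeal (hT : IsLengthFunction φ T)
    {N : CochainComplex (ModuleCat.{u} S) ℤ} :
    ∀ {xs : List S}, (∀ s ∈ xs, s ∈ nullIdeal N) →
      Ideal.ofList xs ⊔ nullIdeal N ≤ nullIdeal (iteratedKoszul xs N) ∧
      T (iteratedKoszul xs N) = shiftSum^[xs.length] (T N)
  | [], _ => ⟨by simp [Ideal.ofList, iteratedKoszul], rfl⟩
  | s :: xs, h => by
    obtain ⟨h₁, h₂⟩ := iteratedKoszul_of_le_nullIdeal hT (xs := xs)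
      fun t ht => h t (List.mem_cons_of_mem _ ht)
    refine ⟨sup_le (ofList_le_nullIdeal _ _) ((le_sup_right.trans h₁).trans
      (nullIdeal_le_cone _ _)), ?_⟩
    rw [List.length_cons, Function.iterate_succ_apply', ← h₂]
    funext n
    exact hT.cone_of_mem_nullIdeal (h₁ (Submodule.mem_sup_right (h s (by simp)))) n

lemma IsLengthFunction.iteratedKoszul_map (hT : IsLengthFunction φ T)
    (N : CochainComplex (ModuleCat.{u} S) ℤ) :
    ∀ {zs : List R}, (∀ z ∈ zs, z ∈ IsLocalRing.maximalIdeal R) →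
      T (iteratedKoszul (zs.map φ) N) = shiftSum^[zs.length] (T N)
  | [], _ => rfl
  | z :: zs, h => by
    rw [List.length_cons, Function.iterate_succ_apply', ← iteratedKoszul_map hT N (zs := zs)
      fun t ht => h t (List.mem_cons_of_mem _ ht)]
    funext n
    exact hT.cone_of_mem_maximalIdeal _ (h z (by simp)) n

/-- The comparison of the invariants of the Koszul complexes on generators of the maximal ideal of
`S`, and on generators of it modulo the maximal ideal of `R`. -/
lemma IsLengthFunction.exists_shiftSum_eq [IsNoetherianRing R] (hT : IsLengthFunction φ T)
    {x y : List S} (hxy : Ideal.ofList x =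
      (IsLocalRing.maximalIdeal R).map φ ⊔ Ideal.ofList y) (M : CochainComplex (ModuleCat.{u} S) ℤ) :
    ∃ a b : ℕ, shiftSum^[a] (T (koszulOn y M)) = shiftSum^[b] (T (koszulOn x M)) := by
  obtain ⟨Z, hZ⟩ := IsNoetherian.noetherian (IsLocalRing.maximalIdeal R)
  have hZ' : Ideal.ofList Z.toList = IsLocalRing.maximalIdeal R := by
    rw [← hZ]
    refine congrArg Ideal.span ?_
    ext z
    simp
  have hw : Ideal.ofList (Z.toList.map φ ++ y) = Ideal.ofList x := by
    rw [Ideal.ofList_append, ← Ideal.map_ofList, hZ', hxy]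
  rw [hT.congr (derivedIso_of_iso (koszulOnIso y M)), hT.congr (derivedIso_of_iso (koszulOnIso x M))]
  -- Write `w` for the list `φ(Z)` followed by `y`; it generates the same ideal as `x`. The cones on
  -- `x` over `K[w; M]` contribute `x.length` iterations, since those elements are already
  -- null-homotopic there, and the cones on `φ(Z)` over `K[y; M]` contribute the others. In the
  -- opposite order, the cones on `w` over `K[x; M]` contribute the length of `w`. The two complexes
  -- are isomorphic.
  refine ⟨x.length + Z.toList.length, (Z.toList.map φ ++ y).length, ?_⟩
  rw [Function.iterate_add_apply, ← hT.iteratedKoszul_map _ (zs := Z.toList) (fun z hz => by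
    rw [← hZ]; exact Submodule.subset_span (by simpa using hz))]
  rw [← iteratedKoszul_append, ← (hT.iteratedKoszul_of_le_nullIdeal fun s hs =>
    ofList_le_nullIdeal (Z.toList.map φ ++ y) M (hw ▸ Ideal.subset_span hs)).2,
    ← (hT.iteratedKoszul_of_le_nullIdeal fun s hs =>
    ofList_le_nullIdeal x M (hw ▸ Ideal.subset_span hs)).2]
  exact hT.congr (derivedIso_of_iso (iteratedKoszulComm _ _ _))

end LengthFunctions

/-! ### Lengths of products and direct sums -/

section LengthSums
variable {S : Type*} [Ring S] {ι : Type*} {A : ι → Type*} [∀ i, AddCommGroup (A i)]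
  [∀ i, Module S (A i)]

lemma length_pi_le (s : Finset ι) (hs : ∀ i ∉ s, Subsingleton (A i)) :
    Module.length S (∀ i, A i) ≤ ∑ i ∈ s, Module.length S (A i) := by
  have h : Module.length S (∀ i, A i) ≤ Module.length S (∀ i : s, A i) := by
    refine Module.length_le_of_injective
      (LinearMap.pi fun i : s => LinearMap.proj (R := S) (φ := A) i.1) fun v w hvw => ?_
    funext i
    by_cases hi : i ∈ s
    · exact congrFun hvw ⟨i, hi⟩
    · have := hs i hi
      exact Subsingleton.elim _ _
  refine h.trans ((Module.length_pi_of_fintype (R := S) fun i : s => A i).trans_le ?_)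
  exact (Finset.sum_coe_sort s fun i => Module.length S (A i)).le

lemma length_directSum_le_length_pi :
    Module.length S (DirectSum ι A) ≤ Module.length S (∀ i, A i) :=
  Module.length_le_of_injective (DFinsupp.coeFnLinearMap S) DFunLike.coe_injective

lemma length_le_length_directSum [DecidableEq ι] (i : ι) :
    Module.length S (A i) ≤ Module.length S (DirectSum ι A) :=
  Module.length_le_of_injective (DirectSum.lof S ι A i) (DirectSum.of_injective i)

lemma length_le_length_pi (i : ι) : Module.length S (A i) ≤ Module.length S (∀ i, A i) :=
  Module.length_le_of_surjective (LinearMap.proj i) (Function.surjective_eval i)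

end LengthSums

/-! ### Comparison of lengths with the Betti numbers of the residue field -/

section LengthBounds
variable {R S : Type u} [CommRing R] [IsLocalRing R] [CommRing S]

variable (R) in
/-- The ranks of the reduction of the chosen resolution of the residue field, in cohomological
grading. -/
noncomputable def residueRank (p : ℤ) : ℕ∞ :=
  ENat.card (residueBasisIndex (kProjRes (residueComplex R)) p)

/-- The residue field is annihilated by 𝔪, so the description of tensor products applies with `φ`
the identity and `W = k`; one copy of `k` occurs for each basis element, and `k` has length one. -/
lemma bettiResidueField_eq (n : ℤ) : bettiResidueField R n = residueRank R (-n) := by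
  let e : koszulOn [] (residueComplex R) ≅ residueComplex R := koszulOnIso [] _
  obtain ⟨e₁⟩ := (derivedIso_of_iso e).nonempty_relTor_equiv (RingHom.id R) n (residueComplex R)
  have hk : IsKilledBy (residueComplex R) ((IsLocalRing.maximalIdeal R).map (RingHom.id R)) := by
    rw [Ideal.map_id]
    exact isKilledBy_complexOfModule residueField_isTorsionBySet
  obtain ⟨e₂⟩ := nonempty_homology_tensor_equiv (kProjRes (residueComplex R)) (RingHom.id R) hk (-n)
  refine (e₁ ≪≫ₗ e₂ ≪≫ₗ directSumHomologyComplexOfModuleEquiv _ _ (-n)).length_eq.trans ?_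
  have : IsSimpleModule R (IsLocalRing.ResidueField R) :=
    isSimpleModule_iff_quot_maximal.2 ⟨_, inferInstance, ⟨LinearEquiv.refl _ _⟩⟩
  have h₁ : Module.length R (ModuleCat.of R (IsLocalRing.ResidueField R)) = 1 :=
    Module.length_eq_one R (IsLocalRing.ResidueField R)
  rw [Module.length_finsupp, h₁, mul_one]
  rfl

variable {φ : R →+* S} {N W : CochainComplex (ModuleCat.{u} S) ℤ}

lemma torLength_eq (h : DerivedIso N W)
    (hW : IsKilledBy W ((IsLocalRing.maximalIdeal R).map φ)) (n : ℤ) :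
    torLength φ N n = Module.length S (DirectSum ℤ fun p =>
      residueBasisIndex (kProjRes (residueComplex R)) p →₀ W.homology (n - p)) := by
  obtain ⟨e⟩ := nonempty_homology_tensor_equiv (kProjRes (residueComplex R)) φ hW n
  rw [(isLengthFunction_torLength φ).congr h]
  exact e.length_eq

lemma extLength_eq_length_pi (h : DerivedIso N W)
    (hW : IsKilledBy W ((IsLocalRing.maximalIdeal R).map φ)) (n : ℤ) :
    extLength φ N n = Module.length S (∀ p,
      residueBasisIndex (kProjRes (residueComplex R)) p → W.homology (n + p)) := by
  have hW' : IsKilledBy (restrict φ (W⟦n⟧)) (IsLocalRing.maximalIdeal R) :=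
    fun z hz i v => hW (φ z) (Ideal.mem_map_of_mem φ hz) (i + n) v
  obtain ⟨e⟩ := nonempty_homotopyClasses_equiv (kProjRes (residueComplex R)) hW'
  rw [(isLengthFunction_extLength φ).congr h]
  exact (e ≪≫ₗ LinearEquiv.piCongrRight fun p => LinearEquiv.piCongrRight fun _ =>
    homologyShiftEquiv W n p (n + p) rfl).length_eq

lemma DerivedIso.length_homology (h : DerivedIso N W) (n : ℤ) :
    Module.length S (N.homology n) = Module.length S (W.homology n) :=
  (h.nonempty_homologyEquiv n).some.length_eq

/-- The single summand with `p = n` contributes `residueRank R n` copies of the nonzero module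
`H^j(N)`. -/
lemma residueRank_le_torLength (h : DerivedIso N W)
    (hW : IsKilledBy W ((IsLocalRing.maximalIdeal R).map φ)) {j : ℤ}
    (hj : Nontrivial (N.homology j)) (n : ℤ) : residueRank R n ≤ torLength φ N (n + j) := by
  rw [torLength_eq h hW]
  refine le_trans ?_ (length_le_length_directSum n)
  rw [Module.length_finsupp, add_sub_cancel_left, ← h.length_homology]
  exact ENat.self_le_mul_right _ Module.length_pos.ne'

/-- Here the factor with `p = -n` of the product is retained; its entries lie in degree `(n + j) - n
= j`. -/
lemma residueRank_le_extLength (h : DerivedIso N W)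
    (hW : IsKilledBy W ((IsLocalRing.maximalIdeal R).map φ)) {j : ℤ}
    (hj : Nontrivial (N.homology j)) (n : ℤ) : residueRank R (-n) ≤ extLength φ N (n + j) := by
  rw [extLength_eq_length_pi h hW]
  refine le_trans ?_ (length_le_length_pi (-n))
  have hj' : n + j + -n = j := add_neg_cancel_comm n j
  have : Nontrivial (W.homology (n + j + -n)) := by
    rw [hj']
    exact (h.nonempty_homologyEquiv j).some.symm.toEquiv.nontrivial
  rw [Module.length_pi]
  exact ENat.self_le_mul_right _ Module.length_pos.ne'

/-- Only the summands with `n - p` in the finite set `s` are nonzero; the remaining sum is reindexed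
by `j = n - p`. -/
lemma torLength_le (h : DerivedIso N W)
    (hW : IsKilledBy W ((IsLocalRing.maximalIdeal R).map φ)) {s : Finset ℤ}
    (hs : ∀ j ∉ s, Subsingleton (N.homology j)) (n : ℤ) :
    torLength φ N n ≤ ∑ j ∈ s, residueRank R (n - j) * Module.length S (N.homology j) := by
  rw [torLength_eq h hW]
  refine length_directSum_le_length_pi.trans
    ((length_pi_le (s.image fun j => n - j) fun p hp => ?_).trans ?_)
  · have h₁ : Subsingleton (N.homology (n - p)) :=
      hs _ fun h => hp (Finset.mem_image.2 ⟨_, h, sub_sub_cancel n p⟩)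
    have : Subsingleton (W.homology (n - p)) :=
      (h.nonempty_homologyEquiv (n - p)).some.symm.toEquiv.subsingleton
    infer_instance
  · rw [Finset.sum_image fun i _ j _ hij => sub_right_injective hij]
    refine Finset.sum_le_sum fun j _ => le_of_eq ?_
    rw [Module.length_finsupp, sub_sub_cancel, ← h.length_homology]
    rfl

lemma extLength_le (h : DerivedIso N W)
    (hW : IsKilledBy W ((IsLocalRing.maximalIdeal R).map φ)) {s : Finset ℤ}
    (hs : ∀ j ∉ s, Subsingleton (N.homology j)) (n : ℤ) :
    extLength φ N n ≤ ∑ j ∈ s, residueRank R (-(n - j)) * Module.length S (N.homology j) := by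
  rw [extLength_eq_length_pi h hW]
  refine (length_pi_le (s.image fun j => -(n - j)) fun p hp => ?_).trans ?_
  · have h₁ : Subsingleton (N.homology (n + p)) :=
      hs _ fun h => hp (Finset.mem_image.2 ⟨_, h, by lia⟩)
    have : Subsingleton (W.homology (n + p)) :=
      (h.nonempty_homologyEquiv (n + p)).some.symm.toEquiv.subsingleton
    infer_instance
  · rw [Finset.sum_image fun i _ j _ hij => sub_right_injective (neg_injective hij)]
    refine Finset.sum_le_sum fun j _ => le_of_eq ?_
    have : n + -(n - j) = j := by lia
    rw [Module.length_pi, ← h.length_homology]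
    exact congrArg (fun m => residueRank R (-(n - j)) * Module.length S (N.homology m)) this

end LengthBounds

/-! ### Growth of sequences under domination -/

section Growth

/-- A sequence is dominated by another one if it is bounded by a multiple of a finite sum of
shifts of it. -/
def Dominated (b a : ℤ → ℕ∞) : Prop :=
  ∃ (C : ℕ) (s : Finset ℤ), ∀ n, b n ≤ C * ∑ i ∈ s, a (n + i)

lemma Dominated.of_le {a b : ℤ → ℕ∞} (j : ℤ) (h : ∀ n, b n ≤ a (n + j)) : Dominated b a :=
  ⟨1, {j}, fun n => by simpa using h n⟩

lemma Dominated.refl (a : ℤ → ℕ∞) : Dominated a a := .of_le 0 fun n => by rw [add_zero]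

lemma Dominated.trans {a b c : ℤ → ℕ∞} (h : Dominated a b) (h' : Dominated b c) :
    Dominated a c := by
  obtain ⟨C, s, h⟩ := h
  obtain ⟨C', s', h'⟩ := h'
  let t : Finset ℤ := (s ×ˢ s').image fun p => p.1 + p.2
  refine ⟨C * (s.card * C'), t, fun n => (h n).trans ?_⟩
  have key : ∑ i ∈ s, b (n + i) ≤ ∑ _i ∈ s, C' * ∑ k ∈ t, c (n + k) := by
    refine Finset.sum_le_sum fun i hi => (h' _).trans ?_
    have h₁ : ∑ j ∈ s', c (n + i + j) = ∑ k ∈ s'.image (fun j => i + j), c (n + k) := by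
      rw [Finset.sum_image fun _ _ _ _ h => add_left_cancel h]
      exact Finset.sum_congr rfl fun j _ => congrArg c (add_assoc n i j)
    rw [h₁]
    gcongr
    intro k hk
    obtain ⟨j, hj, rfl⟩ := Finset.mem_image.1 hk
    exact Finset.mem_image.2 ⟨(i, j), Finset.mem_product.2 ⟨hi, hj⟩, rfl⟩
  rw [Finset.sum_const, nsmul_eq_mul] at key
  push_cast
  rw [mul_assoc, mul_assoc]
  gcongr

lemma Dominated.of_le_sum {a b : ℤ → ℕ∞} (s : Finset ℤ) (c : ℤ → ℕ∞)
    (hc : ∀ i ∈ s, c i ≠ ⊤) (h : ∀ n, b n ≤ ∑ i ∈ s, a (n - i) * c i) : Dominated b a := by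
  refine ⟨∑ i ∈ s, (c i).toNat, s.image fun i => -i, fun n => (h n).trans ?_⟩
  rw [Finset.sum_image fun i _ j _ hij => neg_injective hij, Finset.mul_sum]
  refine Finset.sum_le_sum fun i hi => ?_
  rw [mul_comm, sub_eq_add_neg]
  gcongr
  rw [← ENat.natCast_toNat (hc i hi)]
  exact_mod_cast Finset.single_le_sum (f := fun i => (c i).toNat) (fun _ _ => Nat.zero_le _) hi

lemma dominated_shiftSum_iterate (a : ℤ → ℕ∞) : ∀ e : ℕ, Dominated (shiftSum^[e] a) a
  | 0 => .refl a
  | e + 1 => by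
    rw [Function.iterate_succ_apply']
    refine Dominated.trans ⟨1, {0, 1}, fun n => ?_⟩ (dominated_shiftSum_iterate a e)
    simp [shiftSum]

lemma dominated_of_shiftSum_iterate (a : ℤ → ℕ∞) : ∀ e : ℕ, Dominated a (shiftSum^[e] a)
  | 0 => .refl a
  | e + 1 => by
    rw [Function.iterate_succ_apply']
    exact (dominated_of_shiftSum_iterate a e).trans (.of_le 0 fun n => by
      rw [add_zero]; exact le_self_add)

lemma Dominated.comp_neg {a b : ℤ → ℕ∞} (h : Dominated b a) :
    Dominated (fun n => b (-n)) (fun n => a (-n)) := by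
  obtain ⟨C, s, h⟩ := h
  refine ⟨C, s.image fun i => -i, fun n => (h (-n)).trans (le_of_eq ?_)⟩
  rw [Finset.sum_image fun i _ j _ hij => neg_injective hij]
  simp only [neg_add, neg_neg]

lemma eventually_add_int {p : ℤ → Prop} (h : ∀ᶠ n : ℕ in Filter.atTop, p n) (i : ℤ) :
    ∀ᶠ n : ℕ in Filter.atTop, p (n + i) := by
  obtain ⟨N, hN⟩ := Filter.eventually_atTop.1 h
  refine Filter.eventually_atTop.2 ⟨N + i.natAbs, fun n hn => ?_⟩
  have := hN (n + i).toNat (by lia)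
  rwa [Int.toNat_of_nonneg (by lia)] at this

/-- Complexity compares extended numbers. A real upper bound excludes the value `⊤`, and the
comparison becomes one of real numbers. -/
lemma enat_le_coe_real_iff (x : ℕ∞) (r : ℝ) :
    ((x : ENNReal) : EReal) ≤ (r : EReal) ↔ ∃ m : ℕ, x = m ∧ (m : ℝ) ≤ r := by
  induction x using ENat.recTopCoe with
  | top => simp
  | coe m =>
    have hm : (((m : ℕ∞) : ENNReal) : EReal) = ((m : ℝ) : EReal) := by
      rw [ENat.toENNReal_coe]
      rfl
    rw [hm, EReal.coe_le_coe_iff]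
    constructor
    · intro h
      exact ⟨m, rfl, h⟩
    · rintro ⟨m', h, h'⟩
      obtain rfl : m = m' := by exact_mod_cast h
      exact h'

/-- For `n > 2|i|` the number `n + i` lies between `n/2` and `2n`. For `d = 0` the exponent is `-1`
and the lower estimate is used, for `d > 0` the upper one; the constant `2^(d+1)` covers both cases.
-/
lemma eventually_zpow_add_le (d : ℕ) (i : ℤ) : ∀ᶠ n : ℕ in Filter.atTop,
    (((n : ℤ) + i : ℤ) : ℝ) ^ ((d : ℤ) - 1) ≤ 2 ^ (d + 1) * (n : ℝ) ^ ((d : ℤ) - 1) := by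
  filter_upwards [Filter.eventually_ge_atTop (2 * i.natAbs + 1)] with n hn
  have h₁ : (n : ℤ) ≤ 2 * (n + i) := by lia
  have h₂ : (n : ℤ) + i ≤ 2 * n := by lia
  have h₁' : (n : ℝ) ≤ 2 * (((n : ℤ) + i : ℤ) : ℝ) := by exact_mod_cast h₁
  have h₂' : (((n : ℤ) + i : ℤ) : ℝ) ≤ 2 * n := by exact_mod_cast h₂
  have hn' : (0 : ℝ) < n := by
    have : 0 < n := by lia
    exact_mod_cast this
  have h₃ : (0 : ℝ) < (((n : ℤ) + i : ℤ) : ℝ) := by linarith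
  rcases d with _ | d
  · simp only [Nat.cast_zero, zero_sub, zpow_neg, zpow_one, zero_add, pow_one]
    rw [← div_eq_mul_inv, inv_eq_one_div, div_le_div_iff₀ h₃ hn']
    linarith
  · have : ((d + 1 : ℕ) : ℤ) - 1 = d := by push_cast; ring
    rw [this, zpow_natCast, zpow_natCast]
    calc _ ≤ (2 * (n : ℝ)) ^ d := pow_le_pow_left₀ h₃.le h₂' d
      _ = 2 ^ d * (n : ℝ) ^ d := mul_pow _ _ _
      _ ≤ _ := by
        gcongr
        · norm_num
        · lia

lemma Dominated.cxSeq_le {a b : ℤ → ℕ∞} (h : Dominated b a) : cxSeq b ≤ cxSeq a := by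
  obtain ⟨C, s, h⟩ := h
  refine le_iInf₂ fun d ⟨c, hc⟩ => iInf₂_le d ?_
  -- The constant is replaced by its absolute value, so that the bounds are products of nonnegative
  -- factors and can be estimated factor by factor.
  let P (n : ℤ) : Prop := ∃ m : ℕ, a n = m ∧ (m : ℝ) ≤ |c| * (n : ℝ) ^ ((d : ℤ) - 1)
  have hP : ∀ᶠ n : ℕ in Filter.atTop, P n := by
    filter_upwards [hc] with n hn
    obtain ⟨m, h₁, h₂⟩ := (enat_le_coe_real_iff _ _).1 hn
    refine ⟨m, h₁, h₂.trans ?_⟩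
    rw [Int.cast_natCast]
    gcongr
    exact le_abs_self c
  -- There are `s.card` shifts, and each costs at most a factor `2^(d+1)`.
  refine ⟨C * (s.card * (|c| * 2 ^ (d + 1))), ?_⟩
  have h₁ : ∀ᶠ n : ℕ in Filter.atTop, ∀ i ∈ s, P (n + i) ∧
      (((n : ℤ) + i : ℤ) : ℝ) ^ ((d : ℤ) - 1) ≤ 2 ^ (d + 1) * (n : ℝ) ^ ((d : ℤ) - 1) :=
    (Finset.eventually_all s).2 fun i _ =>
      (eventually_add_int hP i).and (eventually_zpow_add_le d i)
  filter_upwards [h₁] with n hn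
  choose! m hm using fun i (hi : i ∈ s) => (hn i hi).1
  have h₂ : b n ≤ ((C * ∑ i ∈ s, m i : ℕ) : ℕ∞) := by
    refine (h n).trans (le_of_eq ?_)
    push_cast
    rw [Finset.sum_congr rfl fun i hi => (hm i hi).1]
  obtain ⟨k, hk⟩ := ENat.ne_top_iff_exists.1 (ne_top_of_le_ne_top (ENat.natCast_ne_top _) h₂)
  rw [← hk] at h₂ ⊢
  refine (enat_le_coe_real_iff _ _).2 ⟨k, rfl, ?_⟩
  have h₃ : k ≤ C * ∑ i ∈ s, m i := by exact_mod_cast h₂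
  have h₄ : (k : ℝ) ≤ C * ∑ i ∈ s, (m i : ℝ) := by exact_mod_cast h₃
  refine h₄.trans ?_
  rw [mul_assoc, mul_assoc]
  gcongr
  rw [← nsmul_eq_mul]
  refine Finset.sum_le_card_nsmul _ _ _ fun i hi => (hm i hi).2.trans ?_
  rw [mul_assoc]
  gcongr
  exact (hn i hi).2

/-- Choose `c₀` strictly between the curvature of `a` and a given finite `c` above it. Eventually
`a_n ≤ c₀^n`, so `b_n ≤ K c₀^n` for a finite constant `K`, and `K` is eventually below `(c/c₀)^n`;
hence `b_n ≤ c^n`. -/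
lemma Dominated.curvSeq_le {a b : ℤ → ℕ∞} (h : Dominated b a) : curvSeq b ≤ curvSeq a := by
  obtain ⟨C, s, h⟩ := h
  refine le_of_forall_gt_imp_ge_of_dense fun c hc => ?_
  by_cases hct : c = ⊤
  · rw [hct]; exact le_top
  obtain ⟨c₀, hac, hcc⟩ := exists_between hc
  have hc₀ : c₀ ≠ 0 := (pos_of_gt hac).ne'
  have hc₀t : c₀ ≠ ⊤ := hcc.ne_top
  -- Integer exponents are used because shifts may be negative; `c₀` is neither zero nor infinite,
  -- so its powers multiply as expected.
  have h₁ : ∀ᶠ n : ℕ in Filter.atTop, ((a n : ℕ∞) : ENNReal) ≤ c₀ ^ (n : ℤ) := by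
    filter_upwards [Filter.eventually_lt_of_limsup_lt hac, Filter.eventually_gt_atTop 0] with n hn hn'
    have hn₀ : (n : ℝ) ≠ 0 := by exact_mod_cast hn'.ne'
    have := ENNReal.rpow_le_rpow hn.le (Nat.cast_nonneg (α := ℝ) n)
    rw [← ENNReal.rpow_mul, one_div_mul_cancel hn₀, ENNReal.rpow_one, ENNReal.rpow_natCast] at this
    rwa [zpow_natCast]
  let K : ENNReal := C * ∑ i ∈ s, c₀ ^ i
  have hK : K ≠ ⊤ := ENNReal.mul_ne_top (ENNReal.natCast_ne_top C)
    (ENNReal.sum_ne_top.2 fun i _ => ENNReal.zpow_ne_top hc₀ hc₀t i)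
  have h₂ : ∀ᶠ n : ℕ in Filter.atTop, ((b n : ℕ∞) : ENNReal) ≤ K * c₀ ^ n := by
    filter_upwards [(Finset.eventually_all s).2 fun i _ => eventually_add_int
      (p := fun n => ((a n : ℕ∞) : ENNReal) ≤ c₀ ^ n) h₁ i] with n hn
    have h₃ : ((b n : ℕ∞) : ENNReal) ≤ ((C * ∑ i ∈ s, a (n + i) : ℕ∞) : ENNReal) := by
      exact_mod_cast h n
    refine h₃.trans ?_
    have h₄ : ((C * ∑ i ∈ s, a (n + i) : ℕ∞) : ENNReal) =
        C * ∑ i ∈ s, ((a (n + i) : ℕ∞) : ENNReal) := by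
      rw [ENat.toENNReal_mul, ENat.toENNReal_coe]
      exact congrArg _ (map_sum ENat.toENNRealRingHom _ _)
    rw [h₄, mul_assoc, Finset.sum_mul]
    gcongr with i hi
    refine (hn i hi).trans (le_of_eq ?_)
    rw [ENNReal.zpow_add hc₀ hc₀t, zpow_natCast, mul_comm]
  have h₃ : ∀ᶠ n : ℕ in Filter.atTop, K < (c / c₀) ^ n := by
    have : 1 < c / c₀ := by
      rw [ENNReal.lt_div_iff_mul_lt (Or.inl hc₀) (Or.inl hc₀t), one_mul]
      exact hcc
    exact (ENNReal.tendsto_pow_atTop_nhds_top_iff.2 this).eventually (lt_mem_nhds hK.lt_top)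
  refine Filter.limsup_le_of_le (by isBoundedDefault) ?_
  filter_upwards [h₂, h₃, Filter.eventually_gt_atTop 0] with n hn hn' hn''
  have hn₀ : (n : ℝ) ≠ 0 := by exact_mod_cast hn''.ne'
  have h₄ : ((b n : ℕ∞) : ENNReal) ≤ c ^ n := by
    refine hn.trans ((mul_le_mul_left hn'.le _).trans (le_of_eq ?_))
    rw [← mul_pow, ENNReal.div_mul_cancel hc₀ hc₀t]
  refine (ENNReal.rpow_le_rpow h₄ (by positivity)).trans (le_of_eq ?_)
  rw [← ENNReal.rpow_natCast, ← ENNReal.rpow_mul, mul_one_div_cancel hn₀, ENNReal.rpow_one]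

end Growth

/-! ### Finiteness and nonvanishing of Koszul homology -/

section Nonvanishing
variable {S : Type u} [CommRing S]

lemma subsingleton_homology_cone {X Y : CochainComplex (ModuleCat.{u} S) ℤ} (g : X ⟶ Y) (n m : ℤ)
    (h : n + 1 = m) (hY : Subsingleton (Y.homology n)) (hX : Subsingleton (X.homology m)) :
    Subsingleton ((CochainComplex.mappingCone g).homology n) := by
  have h₁ : LinearMap.ker (coneδ g n m h) = ⊥ := by
    rw [ker_coneδ, LinearMap.range_eq_bot]
    exact LinearMap.ext fun v => by rw [Subsingleton.elim v 0, map_zero, map_zero]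
  exact (LinearMap.ker_eq_bot.1 h₁).subsingleton

lemma finite_homology_cone [IsNoetherianRing S] {X Y : CochainComplex (ModuleCat.{u} S) ℤ}
    (g : X ⟶ Y) (n m : ℤ) (h : n + 1 = m) (hY : Module.Finite S (Y.homology n))
    (hX : Module.Finite S (X.homology m)) :
    Module.Finite S ((CochainComplex.mappingCone g).homology n) := by
  have := isNoetherian_of_range_eq_ker
    (HomologicalComplex.homologyMap (CochainComplex.mappingCone.inr g) n).hom (coneδ g n m h)
    (ker_coneδ g n m h).symm
  infer_instance

lemma finite_homology_iteratedKoszul [IsNoetherianRing S]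
    {N : CochainComplex (ModuleCat.{u} S) ℤ} (hN : ∀ n, Module.Finite S (N.homology n)) :
    ∀ (xs : List S) (n : ℤ), Module.Finite S ((iteratedKoszul xs N).homology n)
  | [], n => hN n
  | _ :: xs, n => finite_homology_cone _ n (n + 1) rfl (finite_homology_iteratedKoszul hN xs n)
    (finite_homology_iteratedKoszul hN xs (n + 1))

lemma exists_subsingleton_homology_iteratedKoszul {N : CochainComplex (ModuleCat.{u} S) ℤ}
    (hN : ∃ s : Finset ℤ, ∀ n ∉ s, Subsingleton (N.homology n)) :
    ∀ xs : List S, ∃ s : Finset ℤ, ∀ n ∉ s, Subsingleton ((iteratedKoszul xs N).homology n)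
  | [] => hN
  | _ :: xs => by
    obtain ⟨s, hs⟩ := exists_subsingleton_homology_iteratedKoszul hN xs
    refine ⟨s ∪ s.image (· - 1), fun n hn => ?_⟩
    rw [Finset.mem_union, not_or] at hn
    refine subsingleton_homology_cone _ n (n + 1) rfl (hs n hn.1) (hs (n + 1) fun h => hn.2 ?_)
    exact Finset.mem_image.2 ⟨n + 1, h, add_sub_cancel_right n 1⟩

variable [IsLocalRing S]

/-- If the cone is acyclic, multiplication by `s` is bijective on the homology of `N`. Each homology
module is finitely generated and `s` lies in the maximal ideal, so Nakayama's lemma makes it vanish.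
-/
lemma acyclic_of_acyclic_cone {N : CochainComplex (ModuleCat.{u} S) ℤ}
    (hN : ∀ n, Module.Finite S (N.homology n)) {s : S} (hs : s ∈ IsLocalRing.maximalIdeal S)
    (h : (CochainComplex.mappingCone (s • 𝟙 N)).Acyclic) : N.Acyclic := by
  have h' := (acyclic_cone_iff _).1 h
  rw [acyclic_iff_subsingleton]
  intro n
  have h₁ : Function.Surjective (HomologicalComplex.homologyMap (s • 𝟙 N) n) :=
    (homologyEquiv (s • 𝟙 N) n).surjective
  have h₂ (w : N.homology n) : HomologicalComplex.homologyMap (s • 𝟙 N) n w = s • w := by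
    obtain ⟨z, rfl⟩ := homologyClass_surjective N n w
    rw [← map_smul]
    exact homologyMap_homologyClass (s • 𝟙 N) n z _
  have h₃ : (⊤ : Submodule S (N.homology n)) ≤ IsLocalRing.maximalIdeal S • ⊤ := by
    intro v _
    obtain ⟨w, rfl⟩ := h₁ v
    rw [h₂]
    exact Submodule.smul_mem_smul hs trivial
  have h₄ := Submodule.eq_bot_of_le_smul_of_le_jacobson_bot _ _ (hN n).fg_top h₃
    (IsLocalRing.maximalIdeal_le_jacobson _)
  exact (Submodule.subsingleton_iff S).1 (subsingleton_of_bot_eq_top h₄.symm)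

lemma acyclic_of_acyclic_iteratedKoszul [IsNoetherianRing S]
    {N : CochainComplex (ModuleCat.{u} S) ℤ} (hN : ∀ n, Module.Finite S (N.homology n)) :
    ∀ {xs : List S}, (∀ s ∈ xs, s ∈ IsLocalRing.maximalIdeal S) →
      (iteratedKoszul xs N).Acyclic → N.Acyclic
  | [], _, h => h
  | s :: xs, hs, h => acyclic_of_acyclic_iteratedKoszul hN
    (fun t ht => hs t (List.mem_cons_of_mem _ ht))
    (acyclic_of_acyclic_cone (finite_homology_iteratedKoszul hN xs) (hs s (by simp)) h)

lemma derivedIso_zero_of_acyclic {N : CochainComplex (ModuleCat.{u} S) ℤ} (hN : N.Acyclic) :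
    DerivedIso N 0 := by
  have : QuasiIso (0 : N ⟶ 0) := by
    rw [quasiIso_iff]
    intro n
    rw [quasiIsoAt_iff_exactAt _ n (hN n), HomologicalComplex.exactAt_iff_isZero_homology]
    exact (HomologicalComplex.homologyFunctor _ _ n).map_isZero (isZero_zero _)
  exact derivedIso_of_quasiIso (0 : N ⟶ 0)

/-- The module is a finite-dimensional vector space over the residue field, and its length does not
change when computed there. -/
lemma length_ne_top_of_isTorsionBySet {H : Type*} [AddCommGroup H] [Module S H] [Module.Finite S H]
    (hH : Module.IsTorsionBySet S H (IsLocalRing.maximalIdeal S)) : Module.length S H ≠ ⊤ := by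
  let _ : Module (IsLocalRing.ResidueField S) H := hH.module
  have : IsScalarTower S (IsLocalRing.ResidueField S) H := hH.isScalarTower
  have : Module.Finite (IsLocalRing.ResidueField S) H :=
    Module.Finite.of_restrictScalars_finite S _ _
  rw [Module.length_eq_of_surjective (R := IsLocalRing.ResidueField S)
    IsLocalRing.residue_surjective]
  exact Module.length_ne_top

variable [IsNoetherianRing S] {x : List S} {M : CochainComplex (ModuleCat.{u} S) ℤ}

lemma exists_nontrivial_homology_koszulOn (hx : Ideal.ofList x = IsLocalRing.maximalIdeal S)
    (hM : ∀ n, Module.Finite S (M.homology n)) (h₀ : ¬ DerivedIso M 0) :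
    ∃ j, Nontrivial ((koszulOn x M).homology j) := by
  by_contra! h
  refine h₀ (derivedIso_zero_of_acyclic (acyclic_of_acyclic_iteratedKoszul hM (xs := x)
    (fun s hs => hx ▸ Ideal.subset_span hs) (acyclic_of_iso (koszulOnIso x M)
      (acyclic_iff_subsingleton.2 h))))

lemma length_homology_koszulOn_ne_top (hx : Ideal.ofList x = IsLocalRing.maximalIdeal S)
    (hM : ∀ n, Module.Finite S (M.homology n)) (n : ℤ) :
    Module.length S ((koszulOn x M).homology n) ≠ ⊤ := by
  have h := finite_homology_iteratedKoszul hM x n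
  have : Module.Finite S ((koszulOn x M).homology n) :=
    Module.Finite.equiv (homologyEquiv (koszulOnIso x M).inv n)
  exact length_ne_top_of_isTorsionBySet (hx ▸ homology_koszulOn_isTorsionBySet x M n)

lemma exists_subsingleton_homology_koszulOn
    (hM : ∃ s : Finset ℤ, ∀ n ∉ s, Subsingleton (M.homology n)) :
    ∃ s : Finset ℤ, ∀ n ∉ s, Subsingleton ((koszulOn x M).homology n) := by
  obtain ⟨s, hs⟩ := exists_subsingleton_homology_iteratedKoszul hM x
  refine ⟨s, fun n hn => ?_⟩
  have := hs n hn
  exact (homologyEquiv (koszulOnIso x M).hom n).toEquiv.subsingleton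

lemma IsDPlus.finite_homology (h : IsDPlus M) (n : ℤ) : Module.Finite S (M.homology n) := by
  obtain ⟨m, rfl⟩ : ∃ m, n = -m := ⟨-n, (neg_neg n).symm⟩
  exact h.1 m

lemma IsDMinus.finite_homology (h : IsDMinus M) (n : ℤ) : Module.Finite S (M.homology n) := by
  obtain ⟨m, rfl⟩ : ∃ m, n = -m := ⟨-n, (neg_neg n).symm⟩
  exact h.1 m

lemma IsDBounded.exists_subsingleton (h : IsDBounded M) :
    ∃ s : Finset ℤ, ∀ n ∉ s, Subsingleton (M.homology n) := by
  obtain ⟨⟨-, a, ha⟩, -, b, hb⟩ := h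
  refine ⟨Finset.Icc (-b) (-a), fun n hn => ?_⟩
  obtain ⟨m, rfl⟩ : ∃ m, n = -m := ⟨-n, (neg_neg n).symm⟩
  rw [Finset.mem_Icc, not_and_or] at hn
  rcases hn with hn | hn
  · exact hb m (by lia)
  · exact ha m (by lia)

end Nonvanishing

/-! ### Domination between the Betti numbers of `k` and the Betti and Bass numbers over `φ` -/

section Comparison
variable {R S : Type u} [CommRing R] [IsLocalRing R] [IsNoetherianRing R] [CommRing S]
  [IsLocalRing S] {φ : R →+* S}

/-- Pull back to `S` the equality of ideals of `S/𝔪S`; as `φ` is local, 𝔫 contains `𝔪S`. -/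
lemma ofList_eq_map_sup [IsLocalHom φ] {x y : List S}
    (hx : Ideal.ofList x = IsLocalRing.maximalIdeal S) (hy : IsMinimalGeneratingModulo φ y) :
    Ideal.ofList x = (IsLocalRing.maximalIdeal R).map φ ⊔ Ideal.ofList y := by
  have h := congrArg (Ideal.comap (Ideal.Quotient.mk ((IsLocalRing.maximalIdeal R).map φ))) hy.1
  rw [closedFiberIdeal, Ideal.comap_map_quotientMk, Ideal.comap_map_quotientMk] at h
  rw [hx, h, eq_comm, sup_eq_right]
  exact IsLocalRing.map_maximalIdeal_le φ

variable {T : CochainComplex (ModuleCat.{u} S) ℤ → ℤ → ℕ∞} {x y : List S}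

/-- A sequence and its sum with its shift dominate each other, so the two Koszul complexes have
length sequences of the same growth. -/
lemma IsLengthFunction.dominated (hT : IsLengthFunction φ T) (hxy : Ideal.ofList x =
    (IsLocalRing.maximalIdeal R).map φ ⊔ Ideal.ofList y)
    (M : CochainComplex (ModuleCat.{u} S) ℤ) :
    Dominated (T (koszulOn y M)) (T (koszulOn x M)) ∧
      Dominated (T (koszulOn x M)) (T (koszulOn y M)) := by
  obtain ⟨a, b, h⟩ := hT.exists_shiftSum_eq hxy M
  have h₁ := dominated_of_shiftSum_iterate (T (koszulOn y M)) a
  have h₂ := dominated_of_shiftSum_iterate (T (koszulOn x M)) b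
  rw [h] at h₁
  rw [← h] at h₂
  exact ⟨h₁.trans (dominated_shiftSum_iterate _ b), h₂.trans (dominated_shiftSum_iterate _ a)⟩

variable {M W : CochainComplex (ModuleCat.{u} S) ℤ}

lemma bass_eq_extLength (φ : R →+* S) (y : List S) (M : CochainComplex (ModuleCat.{u} S) ℤ) :
    bass φ y M = fun n => extLength φ (koszulOn y M) (n - edim φ) :=
  funext fun _ => (extLength_eq φ _ _).symm

/-- The domination is established for cohomologically graded sequences and then reflected, since
Betti numbers are indexed homologically. -/
lemma dominated_betti
    (hxy : Ideal.ofList x = (IsLocalRing.maximalIdeal R).map φ ⊔ Ideal.ofList y)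
    (hW : DerivedIso (koszulOn x M) W) (hW' : IsKilledBy W ((IsLocalRing.maximalIdeal R).map φ))
    (h : ∃ j, Nontrivial ((koszulOn x M).homology j)) :
    Dominated (bettiResidueField R) (betti φ y M) := by
  obtain ⟨j, hj⟩ := h
  have h₁ : Dominated (residueRank R) (torLength φ (koszulOn x M)) :=
    .of_le j (residueRank_le_torLength hW hW' hj)
  rw [funext bettiResidueField_eq]
  exact (h₁.trans ((isLengthFunction_torLength φ).dominated hxy M).2).comp_neg

lemma betti_dominated
    (hxy : Ideal.ofList x = (IsLocalRing.maximalIdeal R).map φ ⊔ Ideal.ofList y)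
    (hW : DerivedIso (koszulOn x M) W) (hW' : IsKilledBy W ((IsLocalRing.maximalIdeal R).map φ))
    {s : Finset ℤ} (hs : ∀ j ∉ s, Subsingleton ((koszulOn x M).homology j))
    (hl : ∀ j, Module.length S ((koszulOn x M).homology j) ≠ ⊤) :
    Dominated (betti φ y M) (bettiResidueField R) := by
  have h₁ : Dominated (torLength φ (koszulOn x M)) (residueRank R) :=
    .of_le_sum s _ (fun j _ => hl j) (torLength_le hW hW' hs)
  rw [funext bettiResidueField_eq]
  exact (((isLengthFunction_torLength φ).dominated hxy M).1.trans h₁).comp_neg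

/-- Ext is already indexed cohomologically, so the ranks of the resolution of `k` are reflected
instead; the normalizing shift by `edim φ` does not affect domination. -/
lemma dominated_bass
    (hxy : Ideal.ofList x = (IsLocalRing.maximalIdeal R).map φ ⊔ Ideal.ofList y)
    (hW : DerivedIso (koszulOn x M) W) (hW' : IsKilledBy W ((IsLocalRing.maximalIdeal R).map φ))
    (h : ∃ j, Nontrivial ((koszulOn x M).homology j)) :
    Dominated (bettiResidueField R) (bass φ y M) := by
  obtain ⟨j, hj⟩ := h
  rw [funext bettiResidueField_eq, bass_eq_extLength]
  have h₁ : Dominated (fun n => residueRank R (-n)) (extLength φ (koszulOn x M)) :=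
    .of_le j (residueRank_le_extLength hW hW' hj)
  refine (h₁.trans ((isLengthFunction_extLength φ).dominated hxy M).2).trans
    (.of_le (edim φ) fun n => ?_)
  rw [add_sub_cancel_right]

lemma bass_dominated
    (hxy : Ideal.ofList x = (IsLocalRing.maximalIdeal R).map φ ⊔ Ideal.ofList y)
    (hW : DerivedIso (koszulOn x M) W) (hW' : IsKilledBy W ((IsLocalRing.maximalIdeal R).map φ))
    {s : Finset ℤ} (hs : ∀ j ∉ s, Subsingleton ((koszulOn x M).homology j))
    (hl : ∀ j, Module.length S ((koszulOn x M).homology j) ≠ ⊤) :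
    Dominated (bass φ y M) (bettiResidueField R) := by
  rw [funext bettiResidueField_eq, bass_eq_extLength]
  have h₁ : Dominated (extLength φ (koszulOn x M)) (fun n => residueRank R (-n)) :=
    .of_le_sum s _ (fun j _ => hl j) (extLength_le hW hW' hs)
  exact (Dominated.of_le (-edim φ) fun n => le_rfl).trans
    (((isLengthFunction_extLength φ).dominated hxy M).1.trans h₁)

end Comparison

end DerivedKoszul

theorem proposition3p4 {R S : Type u} [CommRing R] [IsLocalRing R] [IsNoetherianRing R]
    [CommRing S] [IsLocalRing S] [IsNoetherianRing S] (φ : R →+* S) [IsLocalHom φ]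
    (x : List S) (hx : IsMinimalGenerating x)
    (y : List S) (hy : IsMinimalGeneratingModulo φ y)
    (hφ : ∀ r ∈ IsLocalRing.maximalIdeal R,
      φ r ∈ IsLocalRing.maximalIdeal S ^ (homotopicalLoewyLength (koszul x)).toNat)
    (M : CochainComplex (ModuleCat.{u} S) ℤ) :
    IsFormal (restrict φ (koszulOn x M)) ∧
    (∀ L : CochainComplex (ModuleCat.{u} R) ℤ,
      ∃ (hT : ∀ n, IsResidueModule (relTor φ n L (koszulOn x M)))
        (hH : ∀ n, IsResidueModule (lowerHomology (koszulOn x M) n)),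
        ∀ n : ℤ, Nonempty (toResidue (relTor φ n L (koszulOn x M)) (hT n)
          ≃ₗ[IsLocalRing.ResidueField S] DirectSum {p : ℤ × ℤ // p.1 + p.2 = n} fun p =>
            ((tensorFunctor (IsLocalRing.ResidueField.map φ)).obj
              (relTor (IsLocalRing.residue R) p.1.1 L
                (complexOfModule (ModuleCat.of (IsLocalRing.ResidueField R)
                  (IsLocalRing.ResidueField R))))).obj
              (toResidue (lowerHomology (koszulOn x M) p.1.2) (hH p.1.2)))) ∧
    (IsDPlus M → ¬ DerivedIso M 0 →
      curvSeq (bettiResidueField R) ≤ curvSeq (betti φ y M) ∧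
      cxSeq (bettiResidueField R) ≤ cxSeq (betti φ y M)) ∧
    (IsDMinus M → ¬ DerivedIso M 0 →
      curvSeq (bettiResidueField R) ≤ curvSeq (bass φ y M) ∧
      cxSeq (bettiResidueField R) ≤ cxSeq (bass φ y M)) ∧
    (IsDBounded M → ¬ DerivedIso M 0 →
      curvSeq (betti φ y M) = curvSeq (bettiResidueField R) ∧
      cxSeq (betti φ y M) = cxSeq (bettiResidueField R) ∧
      curvSeq (bass φ y M) = curvSeq (bettiResidueField R) ∧
      cxSeq (bass φ y M) = cxSeq (bettiResidueField R)) := by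
  -- The model `W` of `K^M`, annihilated by `𝔪S`, is the only way in which the hypothesis on `φ(𝔪)`
  -- enters.
  obtain ⟨W, hW, hW'⟩ := exists_derivedIso_koszulOn_isKilledBy φ x hx.1 hφ M
  have hxy := ofList_eq_map_sup hx.1 hy
  refine ⟨isFormal_restrict_of_isKilledBy φ hW hW', fun L => ?_, fun hM h₀ => ?_, fun hM h₀ => ?_,
    fun hM h₀ => ?_⟩
  · have hT n : IsResidueModule (relTor φ n L (koszulOn x M)) := by
      rw [IsResidueModule, ← hx.1]
      exact relTor_koszulOn_isTorsionBySet φ x M n L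
    have hH n : IsResidueModule (lowerHomology (koszulOn x M) n) := by
      rw [IsResidueModule, ← hx.1]
      exact homology_koszulOn_isTorsionBySet x M (-n)
    exact ⟨hT, hH, nonempty_toResidue_relTor_equiv φ hW hW' L hT hH⟩
  · have h := dominated_betti hxy hW hW'
      (exists_nontrivial_homology_koszulOn hx.1 hM.finite_homology h₀)
    exact ⟨h.curvSeq_le, h.cxSeq_le⟩
  · have h := dominated_bass hxy hW hW'
      (exists_nontrivial_homology_koszulOn hx.1 hM.finite_homology h₀)
    exact ⟨h.curvSeq_le, h.cxSeq_le⟩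
  · have hj := exists_nontrivial_homology_koszulOn hx.1 hM.1.finite_homology h₀
    have hl := length_homology_koszulOn_ne_top hx.1 hM.1.finite_homology
    obtain ⟨s, hs⟩ := exists_subsingleton_homology_koszulOn (x := x) hM.exists_subsingleton
    have h₁ := betti_dominated hxy hW hW' hs hl
    have h₂ := dominated_betti hxy hW hW' hj
    have h₃ := bass_dominated hxy hW hW' hs hl
    have h₄ := dominated_bass hxy hW hW' hj
    exact ⟨h₁.curvSeq_le.antisymm h₂.curvSeq_le, h₁.cxSeq_le.antisymm h₂.cxSeq_le,
      h₃.curvSeq_le.antisymm h₄.curvSeq_le, h₃.cxSeq_le.antisymm h₄.cxSeq_le⟩
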